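/- For a finite simple graph $G$ let $N(v)$ be the set of neighbors of $v$ and $N[v]=N(v)\cup\{v\}$. The neighborhood complexity of $G$ is the function $$\pi_G(k)=\max_{A\subseteq V(G),\ |A|\le k}\ \bigl|\{N(v)\cap A : v\in V(G)\}\bigr| .$$ A compact neighborhood cover of $G$ is a family $\mathcal K$ of subsets of $V(G)$ such that for every vertex $v$ there is a $C\in\mathcal K$ with $N[v]\subseteq C$, and such that for every $C\in\mathcal K$ the induced subgraph $G[C]$ has diameter at most $4$ (so any two vertices of $C$ are also at distance at most $4$ in $G$). The overlap of $\mathcal K$ is $\max_{v\in V(G)}|\{C\in\mathcal K : v\in C\}|$. **Theorem.** There is a randomized algorithm with the following property. Let $G$ be a graph with $n$ vertices and $m$ edges, and let $c\ge 1$ be a rational number such that $\pi_G(k)\le c\cdot k$ for all $k\ge 1$. On input $G$ (given by adjacency lists) and $c$ (given by numerator and denominator), every run of the algorithm halts in time $\mathcal O((n+m)\log n)$ if $n\ge 2$ and in time $\mathcal O(1)$ if $n\le 1$, where the constants in the $\mathcal O$-notation are absolute, and with probability at least $2/3$ it outputs a compact neighborhood cover of $G$ with overlap at most $1+12c^2\log^2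 n$ (read as $1$ if $n = 0$). Here $\log$ is the logarithm to base $2$, and time is the number of steps on a word RAM that can draw a uniformly random integer from $\{0,\dots,k\}$, for any word $k$, in one step, and whose words have at least $d\cdot\log(n+p+q+2)$ bits, where $c=p/q$ in lowest terms and $d$ is an absolute constant. -/

import Mathlib

/-! ### Set systems and neighborhood complexity -/

/-- The shatter function of a set system `F` on a finite ground set `V`: the maximum, over all
`A ⊆ V` with `|A| ≤ k`, of the number of distinct traces `X ∩ A` with `X ∈ F`. -/
def shatterFunction {V : Type*} [Fintype V] [DecidableEq V] (F : Finset (Finset V)) (k : ℕ) : ℕ :=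
  (Finset.univ.filter fun A : Finset V => A.card ≤ k).sup fun A => (F.image fun X => X ∩ A).card

/-- The family of all open neighborhoods `N(v)` of a graph. -/
def neighborhoodSystem {V : Type*} [Fintype V] [DecidableEq V] (G : SimpleGraph V)
    [DecidableRel G.Adj] : Finset (Finset V) :=
  Finset.univ.image fun v => G.neighborFinset v

/-- The neighborhood complexity `π_G` of a graph. -/
def neighborhoodComplexity {V : Type*} [Fintype V] [DecidableEq V] (G : SimpleGraph V)
    [DecidableRel G.Adj] (k : ℕ) : ℕ :=
  shatterFunction (neighborhoodSystem G) k

/-! ### Compact neighborhood covers -/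

/-- A compact neighborhood cover: every closed neighborhood `N[v]` lies in a member of the family,
and every member induces a subgraph of diameter at most 4. (The diameter `ediam` is `⊤` for a
disconnected graph. Distances in `G` are at most those in the induced subgraph.) -/
structure IsCompactNeighborhoodCover {V : Type*} (G : SimpleGraph V)
    (𝒦 : Finset (Finset V)) : Prop where
  covers : ∀ v : V, ∃ C ∈ 𝒦, v ∈ C ∧ ∀ u : V, G.Adj v u → u ∈ C
  diam_le : ∀ C ∈ 𝒦, (G.induce (C : Set V)).ediam ≤ 4

/-- The overlap of a family: the maximum number of members that share a vertex. -/
def overlap {V : Type*} [Fintype V] [DecidableEq V] (𝒦 : Finset (Finset V)) : ℕ :=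
  Finset.univ.sup fun v : V => (𝒦.filter fun C => v ∈ C).card

/-! ### Randomized word RAM

Programs are finite and use finitely many registers and arrays (each named by a fixed number in
the program text) that hold `w`-bit words. All arithmetic is modulo `2 ^ w`. -/

namespace WordRAM

/-- Binary word operations. -/
inductive Op where
  | add | sub | mul | div | lt | eq

/-- Subtraction is truncated at `0`, division rounds down (and gives `0` for the divisor `0`),
comparisons give `1` for true and `0` for false. -/
def Op.apply : Op → ℕ → ℕ → ℕ
  | .add, x, y => x + y
  | .sub, x, y => x - y
  | .mul, x, y => x * y
  | .div, x, y => x / y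
  | .lt, x, y => if x < y then 1 else 0
  | .eq, x, y => if x = y then 1 else 0

/-- Expressions: constants, registers, array cells `a[e]`, operations. -/
inductive Expr where
  | lit (k : ℕ)
  | reg (x : ℕ)
  | cell (a : ℕ) (e : Expr)
  | op (o : Op) (e₁ e₂ : Expr)

/-- Statements of the programming language. -/
inductive Stmt where
  | skip
  | seq (p q : Stmt)
  /-- set the register `x` to `e` -/
  | assign (x : ℕ) (e : Expr)
  /-- set the array cell `a[i]` to `e` -/
  | store (a : ℕ) (i e : Expr)
  /-- set the register `x` to a fresh uniformly random element of `{0, …, e}` -/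
  | rand (x : ℕ) (e : Expr)
  /-- execute `p` if `e ≠ 0`, and `q` otherwise -/
  | branch (e : Expr) (p q : Stmt)
  /-- while `e ≠ 0`, execute `p` -/
  | loop (e : Expr) (p : Stmt)

/-- The contents of the registers and of the arrays. -/
structure State where
  reg : ℕ → ℕ
  arr : ℕ → ℕ → ℕ

/-- The value of an expression on a machine with word length `w`. -/
def Expr.eval (w : ℕ) (s : State) : Expr → ℕ
  | .lit k => k % 2 ^ w
  | .reg x => s.reg x
  | .cell a e => s.arr a (e.eval w s)
  | .op o e₁ e₂ => o.apply (e₁.eval w s) (e₂.eval w s) % 2 ^ w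

def State.setReg (s : State) (x v : ℕ) : State :=
  { s with reg := Function.update s.reg x v }

def State.setCell (s : State) (a i v : ℕ) : State :=
  { s with arr := Function.update s.arr a (Function.update (s.arr a) i v) }

/-- A configuration: the statements still to be executed, and the memory. The machine has halted
when the list is empty. -/
abbrev Config := List Stmt × State

/-- One step of the machine, as a probability distribution on the next configuration. Every step
executes at most one assignment, store, random choice or test, so up to a factor that depends only
on the program, the number of steps is the number of elementary word operations. -/
noncomputable def step (w : ℕ) : Config → PMF Config
  | ([], s) => PMF.pure ([], s)
  | (.skip :: k, s) => PMF.pure (k, s)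
  | (.seq p q :: k, s) => PMF.pure (p :: q :: k, s)
  | (.assign x e :: k, s) => PMF.pure (k, s.setReg x (e.eval w s))
  | (.store a i e :: k, s) => PMF.pure (k, s.setCell a (i.eval w s) (e.eval w s))
  | (.rand x e :: k, s) =>
      (PMF.uniformOfFintype (Fin (e.eval w s + 1))).map fun r => (k, s.setReg x r)
  | (.branch e p q :: k, s) => PMF.pure (if e.eval w s ≠ 0 then p :: k else q :: k, s)
  | (.loop e p :: k, s) => PMF.pure (if e.eval w s ≠ 0 then p :: .loop e p :: k else k, s)

/-- The distribution of the configuration after `T` steps. -/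
noncomputable def steps (w : ℕ) : ℕ → Config → PMF Config
  | 0, cfg => PMF.pure cfg
  | T + 1, cfg => (step w cfg).bind (steps w T)

/-- The memory holds the list of lists `L` in the standard format: the number of lists is in
register 0, the concatenation of the lists is in array 1, and array 0 gives the positions at which
the individual lists start and end. -/
structure Holds (s : State) (L : List (List ℕ)) : Prop where
  count : s.reg 0 = L.length
  offset : ∀ i ≤ L.length, s.arr 0 i = (L.take i).flatten.length
  data : ∀ (j : ℕ) (h : j < L.flatten.length), s.arr 1 j = L.flatten[j]

/-- The initial memory for the lists `L` and the numbers `p`, `q`: the lists in the above format,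
`p` and `q` in registers 1 and 2, and zeros everywhere else. -/
def inputState (L : List (List ℕ)) (p q : ℕ) : State where
  reg x := if x = 0 then L.length else if x = 1 then p else if x = 2 then q else 0
  arr a i :=
    if a = 0 then (if i ≤ L.length then (L.take i).flatten.length else 0)
    else if a = 1 then L.flatten.getD i 0
    else 0

theorem holds_inputState (L : List (List ℕ)) (p q : ℕ) : Holds (inputState L p q) L where
  count := by simp [inputState]
  offset i hi := by simp [inputState, hi]
  data j h := List.getD_eq_getElem (hn := h) _ 0

/-- The final memory is that of a machine that has output the family `𝒦` of subsets of
`{0, …, n - 1}`, each set as a list of its elements. -/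
def OutputsFamily {n : ℕ} (s : State) (𝒦 : Finset (Finset (Fin n))) : Prop :=
  ∃ L : List (List (Fin n)),
    Holds s (L.map (List.map Fin.val)) ∧ 𝒦 = (L.map List.toFinset).toFinset

end WordRAM

/-! ### Graphs as input -/

/-- `adj` gives, for each vertex, the list of its neighbors, in any order and without repetition. -/
def IsAdjacencyLists {n : ℕ} (G : SimpleGraph (Fin n)) (adj : Fin n → List (Fin n)) : Prop :=
  ∀ v, (adj v).Nodup ∧ ∀ u, u ∈ adj v ↔ G.Adj v u

/-- The initial memory for a graph given by adjacency lists and a rational number `c`. -/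
def graphInput {n : ℕ} (adj : Fin n → List (Fin n)) (c : ℚ) : WordRAM.State :=
  WordRAM.inputState (List.ofFn fun v => (adj v).map Fin.val) c.num.natAbs c.den

namespace WordRAM

/-! ### Steps of the machine -/

/-! Suppose the vertices have a linear order that every N(x) enters and leaves only O(c² log² n)
times. Cut this order greedily into maximal intervals with a common neighbor (a single vertex is
always allowed), and take the closed neighborhoods of the intervals as clusters. A common neighbor
lies in the cluster and is within distance 2 of all its members, so the diameter is at most 4. A
vertex v lies in a cluster only if the interval contains v or meets N(v). By maximality, a new
interval inside a run of N(v) is impossible once the previous interval lies in N(v), so the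
intervals that meet N(v) number at most the changes of N(v) along the order plus one
(`countP_greedyIntervals_le`, `exists_cover`).

The order arises by concatenating blocks, initially single vertices, in phases. With N blocks left,
draw a random sample M of k = ⌊N/(2c²)⌋ block heads. Let A contain one vertex for each trace on M,
and concatenate the blocks whose heads have equal traces on A. The linear bound, used twice, leaves
at most c|A| ≤ c²|M| ≤ N/2 blocks (`run_contract`), so there are at most log n phases. Given x, let
a ∈ A have the same trace on M. The set N(a) contains all or none of the heads in a class, so N(x)
changes along the heads of a class only next to a head on which N(x) and N(a) disagree. With changes
counted cyclically, each disagreement costs at most two new changes (`sum_cyclicChanges_merge_le`).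
A pair with d disagreements passes the sample with probability (1 - d/N)^k; for d > t = (27/4)c² ln
n this is at most n⁻³ (`mul_pow_rate_le`). A union bound over n² pairs shows that a phase adds more
than 2t changes to some neighborhood with probability at most 1/n. When k < 8, fewer than 16c²
blocks are left, and joining them adds at most as many changes. The total failure probability is at
most (log n)/n ≤ 1/3 for n ≥ 16; for smaller n the overlap is trivially small enough.

On the machine, `Run` treats deterministic code and `Spec` randomized code. Sampling is analyzed by
a conditional expectation that does not increase on average (`spec_sampleLoop`, `expectedBad_step`).
A phase takes time O(n + m): classes are found by partition refinement, with class numbers and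
marking keys that are always fresh, so that no array is ever cleared, and blocks are linked lists,
joined in constant time. The greedy cuts are found online by storing for each z the latest run of
consecutive neighbors of z. -/

theorem steps_succ_of_step_eq_pure {w T : ℕ} {c c' : Config} (h : step w c = PMF.pure c') :
    steps w (T + 1) c = steps w T c' := by
  rw [steps, h, PMF.pure_bind]

theorem steps_halted (w T : ℕ) (s : State) : steps w T ([], s) = PMF.pure ([], s) := by
  induction T with
  | zero => rfl
  | succ T ih => rw [steps_succ_of_step_eq_pure (c' := ([], s)) rfl, ih]

theorem steps_add (w T T' : ℕ) (c : Config) :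
    steps w (T + T') c = (steps w T c).bind (steps w T') := by
  induction T generalizing c with
  | zero => simp [steps, PMF.pure_bind]
  | succ T ih =>
    rw [Nat.add_right_comm, steps, steps, PMF.bind_bind]
    congr 1
    funext c'
    exact ih c'

/-- Halted configurations are fixed by `step`. This allows branches of different length to share one
time bound. -/
theorem steps_add_of_halted {w T : ℕ} {c : Config}
    (h : ∀ c' ∈ (steps w T c).support, c'.1 = []) (T' : ℕ) :
    steps w (T + T') c = steps w T c := by
  rw [steps_add]
  conv_rhs => rw [← PMF.bind_pure (steps w T c)]
  ext c''
  rw [PMF.bind_apply, PMF.bind_apply]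
  refine tsum_congr fun c' => ?_
  by_cases hc : c' ∈ (steps w T c).support
  · obtain ⟨k, s⟩ := c'
    obtain rfl : k = [] := h _ hc
    rw [steps_halted]
  · rw [PMF.mem_support_iff, not_not] at hc
    rw [hc, zero_mul, zero_mul]

/-! ### Deterministic runs -/

/-- Started in the memory `s`, the program `p` makes no random choices, takes at most `B` steps,
and leaves a memory that satisfies `Q`. -/
def Run (w : ℕ) (p : Stmt) (s : State) (B : ℕ) (Q : State → Prop) : Prop :=
  ∃ t ≤ B, ∃ s', Q s' ∧ ∀ k T, steps w (t + T) (p :: k, s) = steps w T (k, s')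

namespace Run

variable {w : ℕ} {p q : Stmt} {s : State} {B B' : ℕ} {Q R : State → Prop}

theorem mono (h : Run w p s B Q) (hB : B ≤ B') (hQ : ∀ s', Q s' → R s') : Run w p s B' R := by
  obtain ⟨t, ht, s', hs', hr⟩ := h
  exact ⟨t, ht.trans hB, s', hQ _ hs', hr⟩

theorem weaken (h : Run w p s B Q) (hQ : ∀ s', Q s' → R s') : Run w p s B R :=
  h.mono le_rfl hQ

theorem skip (h : Q s) : Run w .skip s 1 Q :=
  ⟨1, le_rfl, s, h, fun k T => by rw [Nat.add_comm]; exact steps_succ_of_step_eq_pure rfl⟩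

theorem assign {x : ℕ} {e : Expr} (h : Q (s.setReg x (e.eval w s))) :
    Run w (.assign x e) s 1 Q :=
  ⟨1, le_rfl, _, h, fun k T => by rw [Nat.add_comm]; exact steps_succ_of_step_eq_pure rfl⟩

theorem store {a : ℕ} {i e : Expr} (h : Q (s.setCell a (i.eval w s) (e.eval w s))) :
    Run w (.store a i e) s 1 Q :=
  ⟨1, le_rfl, _, h, fun k T => by rw [Nat.add_comm]; exact steps_succ_of_step_eq_pure rfl⟩

theorem seq (hp : Run w p s B R) (hq : ∀ s', R s' → Run w q s' B' Q) :
    Run w (.seq p q) s (B + B' + 1) Q := by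
  obtain ⟨t, ht, s', hs', hr⟩ := hp
  obtain ⟨t', ht', s'', hs'', hr'⟩ := hq s' hs'
  refine ⟨t + t' + 1, by omega, s'', hs'', fun k T => ?_⟩
  rw [show t + t' + 1 + T = (t + (t' + T)) + 1 by omega,
    steps_succ_of_step_eq_pure (c' := (p :: q :: k, s)) rfl, hr, hr']

theorem branch {e : Expr} (hp : e.eval w s ≠ 0 → Run w p s B Q)
    (hq : e.eval w s = 0 → Run w q s B Q) : Run w (.branch e p q) s (B + 1) Q := by
  by_cases h : e.eval w s = 0
  · obtain ⟨t, ht, s', hs', hr⟩ := hq h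
    refine ⟨t + 1, by omega, s', hs', fun k T => ?_⟩
    rw [Nat.add_right_comm, steps_succ_of_step_eq_pure (c' := (q :: k, s)), hr]
    simp [step, h]
  · obtain ⟨t, ht, s', hs', hr⟩ := hp h
    refine ⟨t + 1, by omega, s', hs', fun k T => ?_⟩
    rw [Nat.add_right_comm, steps_succ_of_step_eq_pure (c' := (p :: k, s)), hr]
    simp [step, h]

/-- Downward induction from `hi`: the invariant carries the iteration index, so the number of
remaining iterations is known. The cost may depend on the index, which later allows sums over
degrees. -/
theorem loop {e : Expr} (I : ℕ → State → Prop) (cost : ℕ → ℕ) {lo hi : ℕ} (hle : lo ≤ hi)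
    (h0 : I lo s)
    (hstep : ∀ j, lo ≤ j → j < hi → ∀ s, I j s →
      e.eval w s ≠ 0 ∧ Run w p s (cost j) (I (j + 1)))
    (hend : ∀ s, I hi s → e.eval w s = 0) :
    Run w (.loop e p) s (∑ j ∈ Finset.Ico lo hi, (cost j + 1) + 1) (I hi) := by
  induction hle using Nat.decreasingInduction generalizing s with
  | self =>
    refine ⟨1, by simp, s, h0, fun k T => ?_⟩
    rw [Nat.add_comm, steps_succ_of_step_eq_pure (c' := (k, s))]
    simp [step, hend s h0]
  | of_succ j hj ih =>
    obtain ⟨he, t, ht, s', hs', hr⟩ := hstep j le_rfl hj s h0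
    obtain ⟨t', ht', s'', hs'', hr'⟩ := ih hs' fun j' h => hstep j' (by omega)
    refine ⟨t + t' + 1, ?_, s'', hs'', fun k T => ?_⟩
    · rw [← Finset.sum_Ioo_add_eq_sum_Ico (by simpa using hj)]
      have : Finset.Ioo j hi = Finset.Ico (j + 1) hi := by ext; simp
      rw [this]
      omega
    · rw [show t + t' + 1 + T = (t + (t' + T)) + 1 by omega,
        steps_succ_of_step_eq_pure (c' := (p :: .loop e p :: k, s)), hr, hr']
      simp [step, he]

end Run

/-- `for i = a, …, b - 1 do p` -/
def Stmt.forLoop (i : ℕ) (a b : Expr) (p : Stmt) : Stmt :=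
  .seq (.assign i a)
    (.loop (.op .lt (.reg i) b) (.seq p (.assign i (.op .add (.reg i) (.lit 1)))))

/-- The bound is evaluated anew in each round, hence `hb`; `hhi` keeps the counter from wrapping
around. The overhead of three steps per round is the test, the sequencing and the increment. -/
theorem Run.forLoop {w : ℕ} {p : Stmt} {s : State} {i lo hi : ℕ} {a b : Expr}
    (I : ℕ → State → Prop) (cost : ℕ → ℕ) (hle : lo ≤ hi) (hhi : hi < 2 ^ w)
    (ha : a.eval w s = lo) (h0 : I lo (s.setReg i lo))
    (hb : ∀ j s, I j s → s.reg i = j → b.eval w s = hi)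
    (hstep : ∀ j, lo ≤ j → j < hi → ∀ s, s.reg i = j → I j s →
      Run w p s (cost j) fun s' => s'.reg i = j ∧ I (j + 1) (s'.setReg i (j + 1))) :
    Run w (.forLoop i a b p) s (∑ j ∈ Finset.Ico lo hi, (cost j + 3) + 3)
      fun s' => s'.reg i = hi ∧ I hi s' := by
  refine (Run.seq (R := fun s' => s'.reg i = lo ∧ I lo s') (B := 1)
    (Run.assign ?_) fun s' hs' =>
    Run.loop (fun j s' => s'.reg i = j ∧ I j s') (fun j => cost j + 2) hle hs' ?_ ?_).mono
      ?_ fun _ h => h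
  · rw [ha]
    exact ⟨by simp [State.setReg], h0⟩
  · rintro j h1 h2 s ⟨hj, hI⟩
    constructor
    · have : 1 % 2 ^ w = 1 := Nat.mod_eq_of_lt (by omega)
      simp [Expr.eval, Op.apply, hj, hb j s hI hj, h2, this]
    · refine (Run.seq (hstep j h1 h2 s hj hI) fun s' hs' => Run.assign ?_).mono
        (B := cost j + 1 + 1) (by omega) fun _ h => h
      have h3 : (Expr.op .add (.reg i) (.lit 1)).eval w s' = j + 1 := by
        have : 1 % 2 ^ w = 1 := Nat.mod_eq_of_lt (by omega)
        simp only [Expr.eval, Op.apply, hs'.1, this]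
        exact Nat.mod_eq_of_lt (by omega)
      rw [h3]
      exact ⟨by simp [State.setReg], hs'.2⟩
  · rintro s ⟨hj, hI⟩
    simp [Expr.eval, Op.apply, hj, hb hi s hI hj]
  · simp only [Finset.sum_add_distrib, Finset.sum_const, smul_eq_mul]
    omega

/-! ### Straight-line programs -/

/-- There are no loops and no random choices. -/
def Stmt.IsStraight : Stmt → Prop
  | .skip | .assign _ _ | .store _ _ _ => True
  | .seq p q | .branch _ p q => p.IsStraight ∧ q.IsStraight
  | .rand _ _ | .loop _ _ => False

/-- The effect of a straight-line program. -/
def Stmt.exec (w : ℕ) : Stmt → State → State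
  | .assign x e, s => s.setReg x (e.eval w s)
  | .store a i e, s => s.setCell a (i.eval w s) (e.eval w s)
  | .seq p q, s => q.exec w (p.exec w s)
  | .branch e p q, s => if e.eval w s = 0 then q.exec w s else p.exec w s
  | .skip, s | .rand _ _, s | .loop _ _, s => s

/-- A bound on the running time of a straight-line program. -/
def Stmt.size : Stmt → ℕ
  | .seq p q | .branch _ p q => p.size + q.size + 1
  | .skip | .assign _ _ | .store _ _ _ | .rand _ _ | .loop _ _ => 1

/-- Correctness of loop-free code reduces to computing `exec`. A branch is charged for both of its
sides, so the time bound does not depend on the memory. -/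
theorem Run.straight {w : ℕ} {p : Stmt} {s : State} {Q : State → Prop} (hp : p.IsStraight)
    (h : Q (p.exec w s)) : Run w p s p.size Q := by
  induction p generalizing s Q with
  | skip => exact .skip h
  | assign x e => exact .assign h
  | store a i e => exact .store h
  | seq p q ihp ihq =>
    exact .seq (R := fun s' => s' = p.exec w s) (ihp hp.1 rfl) fun s' hs' =>
      ihq hp.2 (by rw [hs']; exact h)
  | branch e p q ihp ihq =>
    simp only [Stmt.exec] at h
    refine .branch (B := p.size + q.size) (fun he => ?_) fun he => ?_
    · rw [if_neg he] at h
      exact (ihp hp.1 h).mono (by omega) fun _ h => h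
    · rw [if_pos he] at h
      exact (ihq hp.2 h).mono (by omega) fun _ h => h
  | rand x e => exact hp.elim
  | loop e p => exact hp.elim

@[simp] theorem State.reg_setReg (s : State) (x v y : ℕ) :
    (s.setReg x v).reg y = if y = x then v else s.reg y := by
  simp [State.setReg, Function.update_apply]

@[simp] theorem State.arr_setReg (s : State) (x v : ℕ) : (s.setReg x v).arr = s.arr := rfl

@[simp] theorem State.reg_setCell (s : State) (a i v : ℕ) : (s.setCell a i v).reg = s.reg := rfl

@[simp] theorem State.arr_setCell (s : State) (a i v b : ℕ) :
    (s.setCell a i v).arr b = if b = a then Function.update (s.arr a) i v else s.arr b := by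
  simp only [State.setCell, Function.update_apply]

/-! ### Randomized runs -/

/-- Started in the configuration `c`, every run halts within `T` steps, and the final memory
violates `Q` with probability at most `δ`. -/
structure Spec (w T : ℕ) (c : Config) (Q : State → Prop) (δ : ℝ) : Prop where
  halts : ∀ c' ∈ (steps w T c).support, c'.1 = []
  fails : (steps w T c).toOuterMeasure {c' | ¬ Q c'.2} ≤ ENNReal.ofReal δ

namespace Spec

variable {w T T' : ℕ} {c : Config} {Q : State → Prop} {δ δ' : ℝ}

theorem mono (h : Spec w T c Q δ) (hT : T ≤ T') (hδ : δ ≤ δ') : Spec w T' c Q δ' := by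
  obtain ⟨j, rfl⟩ := Nat.exists_eq_add_of_le hT
  have he := steps_add_of_halted h.halts j
  exact ⟨by rw [he]; exact h.halts,
    by rw [he]; exact h.fails.trans (ENNReal.ofReal_le_ofReal hδ)⟩

/-- The alternative `1 ≤ δ` makes a `Spec` with failure bound 1 a pure statement about running time.
-/
theorem halted {s : State} (h : Q s ∨ 1 ≤ δ) : Spec w T ([], s) Q δ := by
  constructor
  · intro c' hc'
    rw [steps_halted, PMF.mem_support_pure_iff] at hc'
    rw [hc']
  · rw [steps_halted, PMF.toOuterMeasure_pure_apply]
    split_ifs with hs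
    · rcases h with h | h
      · exact absurd h hs
      · simpa using h
    · exact zero_le

theorem of_steps_eq {c' : Config} (h : Spec w T c' Q δ) (he : steps w T' c = steps w T c') :
    Spec w T' c Q δ :=
  ⟨by rw [he]; exact h.halts, by rw [he]; exact h.fails⟩

theorem of_run {p : Stmt} {s : State} {k : List Stmt} {B : ℕ} {R : State → Prop}
    (hp : Run w p s B R) (h : ∀ s', R s' → Spec w T (k, s') Q δ) :
    Spec w (B + T) (p :: k, s) Q δ := by
  obtain ⟨t, ht, s', hs', hr⟩ := hp
  exact (of_steps_eq (h s' hs') (hr k T)).mono (by omega) le_rfl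

theorem seq {p q : Stmt} {s : State} {k : List Stmt} (h : Spec w T (p :: q :: k, s) Q δ) :
    Spec w (T + 1) (.seq p q :: k, s) Q δ :=
  of_steps_eq h (steps_succ_of_step_eq_pure rfl)

theorem loop_pos {p : Stmt} {e : Expr} {s : State} {k : List Stmt} (he : e.eval w s ≠ 0)
    (h : Spec w T (p :: .loop e p :: k, s) Q δ) : Spec w (T + 1) (.loop e p :: k, s) Q δ :=
  of_steps_eq h (steps_succ_of_step_eq_pure (by simp [step, he]))

theorem loop_zero {p : Stmt} {e : Expr} {s : State} {k : List Stmt} (he : e.eval w s = 0)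
    (h : Spec w T (k, s) Q δ) : Spec w (T + 1) (.loop e p :: k, s) Q δ :=
  of_steps_eq h (steps_succ_of_step_eq_pure (by simp [step, he]))

/-- Law of total probability: the failure bound before a uniform draw is the average of the bounds
for its outcomes. -/
theorem rand {x m : ℕ} {e : Expr} {s : State} {k : List Stmt} (he : e.eval w s = m)
    (δ : ℕ → ℝ) (hδ : ∀ r, 0 ≤ δ r) (h : ∀ r ≤ m, Spec w T (k, s.setReg x r) Q (δ r)) :
    Spec w (T + 1) (.rand x e :: k, s) Q ((∑ r ∈ Finset.range (m + 1), δ r) / (m + 1)) := by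
  subst he
  have key : steps w (T + 1) (.rand x e :: k, s) =
      (PMF.uniformOfFintype (Fin (e.eval w s + 1))).bind
        fun r => steps w T (k, s.setReg x r) := by
    rw [steps, step, PMF.bind_map]
    refine (PMF.bind_bind _ _ _).trans ?_
    congr 1
    funext r
    exact PMF.pure_bind _ _
  constructor
  · intro c' hc'
    rw [key, PMF.mem_support_bind_iff] at hc'
    obtain ⟨r, -, hr⟩ := hc'
    exact (h r (by omega)).halts c' hr
  · rw [key, PMF.toOuterMeasure_bind_apply, tsum_fintype]
    calc _ ≤ ∑ r : Fin (e.eval w s + 1), ENNReal.ofReal (δ r / (e.eval w s + 1)) := by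
          refine Finset.sum_le_sum fun r _ => ?_
          rw [PMF.uniformOfFintype_apply, Fintype.card_fin, div_eq_inv_mul,
            ENNReal.ofReal_mul (by positivity), ENNReal.ofReal_inv_of_pos (by positivity)]
          refine mul_le_mul' (le_of_eq ?_) (h r (by omega)).fails
          rw [show ((e.eval w s : ℝ) + 1) = ((e.eval w s + 1 : ℕ) : ℝ) by push_cast; rfl,
            ENNReal.ofReal_natCast]
      _ = _ := by
          rw [← ENNReal.ofReal_sum_of_nonneg fun r _ => div_nonneg (hδ _) (by positivity),
            ← Finset.sum_div, Finset.sum_range]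

theorem le_prob (h : Spec w T c Q δ) :
    1 - ENNReal.ofReal δ ≤ (steps w T c).toOuterMeasure {c' | Q c'.2} := by
  rw [tsub_le_iff_right]
  have h1 : (1 : ENNReal) = (steps w T c).toOuterMeasure Set.univ :=
    ((PMF.toOuterMeasure_apply_eq_one_iff _ _).2 (Set.subset_univ _)).symm
  rw [h1]
  refine le_trans ?_ (add_le_add le_rfl h.fails)
  refine le_trans (MeasureTheory.measure_mono ?_) (MeasureTheory.measure_union_le _ _)
  intro c' _
  exact Classical.em (Q c'.2)

end Spec

end WordRAM

/-! ### Changes of a predicate along a sequence -/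

section Changes

open Classical in
/-- The number of consecutive elements of `a :: l` that `y` separates. -/
noncomputable def changes {α : Type*} (y : α → Prop) : α → List α → ℕ
  | _, [] => 0
  | a, b :: l => (if y a ↔ y b then 0 else 1) + changes y b l

/-- The number of consecutive elements of `l`, arranged in a circle, that `y` separates. -/
noncomputable def cyclicChanges {α : Type*} (y : α → Prop) : List α → ℕ
  | [] => 0
  | a :: l => changes y a (l ++ [a])

variable {α : Type*} (y : α → Prop)

theorem changes_append_cons (a b : α) (l l' : List α) :
    changes y a (l ++ b :: l') = changes y a (l ++ [b]) + changes y b l' := by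
  induction l generalizing a with
  | nil => simp [changes]
  | cons c l ih => simp only [List.cons_append, changes, ih c]; omega

theorem changes_le_changes_append (a : α) (l l' : List α) :
    changes y a l ≤ changes y a (l ++ l') := by
  induction l generalizing a with
  | nil => simp [changes]
  | cons c l ih => simp only [List.cons_append, changes]; have := ih c; omega

/-- A triangle inequality: the last step may make a detour through `c`. -/
theorem changes_append_singleton_le (a b c : α) (l : List α) :
    changes y a (l ++ [b]) ≤ changes y a (l ++ [c]) + changes y c [b] := by
  induction l generalizing a with
  | nil =>
    simp only [List.nil_append, changes]
    by_cases y a <;> by_cases y b <;> by_cases y c <;> simp_all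
  | cons d l ih =>
    have := ih d
    simp only [List.cons_append, changes] at this ⊢
    omega

/-- The statement is set up for induction on the remaining heads `ws`: the walk stands at the head
`w`, still has to traverse the tail `t` of its block, and ends at an arbitrary `z`. -/
theorem changes_flatMap_le (f : α → List α) (w z : α) (t ws : List α) (hw : f w = w :: t)
    (h : ∀ v ∈ ws, ∃ t, f v = v :: t) :
    changes y w (t ++ (ws.flatMap f ++ [z])) ≤
      ((w :: ws).map fun v => cyclicChanges y (f v)).sum + changes y w (ws ++ [z]) := by
  induction ws generalizing w t with
  | nil =>
    have := changes_append_singleton_le y w z w t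
    simpa [hw, cyclicChanges] using this
  | cons v ws ih =>
    obtain ⟨t', ht'⟩ := h v (by simp)
    have h1 := ih v t' ht' fun u hu => h u (by simp [hu])
    have h2 := changes_append_singleton_le y w v w t
    rw [List.flatMap_cons, ht', List.append_assoc, List.cons_append, changes_append_cons,
      List.map_cons, List.sum_cons, hw]
    simp only [cyclicChanges, List.cons_append, changes] at h1 h2 ⊢
    omega

/-- Walk around each block back to its head, and from there step to the next head. These detours
only add changes to the walk along the concatenation. Counting cyclically is what makes the closed
tour of a block cost exactly its own count. -/
theorem cyclicChanges_flatMap_le (f : α → List α) (ws : List α)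
    (h : ∀ v ∈ ws, ∃ t, f v = v :: t) :
    cyclicChanges y (ws.flatMap f) ≤
      (ws.map fun v => cyclicChanges y (f v)).sum + cyclicChanges y ws := by
  cases ws with
  | nil => simp [cyclicChanges]
  | cons w ws =>
    obtain ⟨t, ht⟩ := h w (by simp)
    have := changes_flatMap_le y f w w t ws ht fun v hv => h v (by simp [hv])
    rw [List.flatMap_cons, ht, List.cons_append]
    simpa [cyclicChanges] using this

open Classical in
-- A changing step has an end where `y` differs from the constant `b`. An inner point is the end of
-- two steps, an extreme point of one.
theorem changes_append_singleton_le_countP (b : Prop) (a z : α) (l : List α) :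
    changes y a (l ++ [z]) ≤ (if y a ↔ b then 0 else 1) +
      2 * l.countP (fun u => ¬ (y u ↔ b)) + (if y z ↔ b then 0 else 1) := by
  induction l generalizing a with
  | nil =>
    simp only [List.nil_append, changes]
    by_cases y a <;> by_cases y z <;> by_cases b <;> simp_all
  | cons c l ih =>
    have := ih c
    simp only [List.cons_append, changes, List.countP_cons]
    by_cases y a <;> by_cases y c <;> by_cases b <;> simp_all <;> omega

open Classical in
theorem cyclicChanges_le_countP (b : Prop) (l : List α) :
    cyclicChanges y l ≤ 2 * l.countP fun u => ¬ (y u ↔ b) := by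
  cases l with
  | nil => simp [cyclicChanges]
  | cons a l =>
    have := changes_append_singleton_le_countP y b a a l
    simp only [cyclicChanges, List.countP_cons]
    by_cases y a <;> by_cases b <;> simp_all <;> omega

theorem cyclicChanges_le_length (l : List α) : cyclicChanges y l ≤ l.length := by
  cases l with
  | nil => simp [cyclicChanges]
  | cons a l =>
    suffices h : ∀ (l : List α) (a : α), changes y a l ≤ l.length by
      simpa [cyclicChanges] using h (l ++ [a]) a
    intro l
    induction l with
    | nil => simp [changes]
    | cons c l ih =>
      intro a
      have := ih c
      simp only [changes, List.length_cons]
      split_ifs <;> omega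

theorem countP_eq_sum_map (p : α → Bool) (l : List α) :
    l.countP p = (l.map fun u => if p u then 1 else 0).sum := by
  induction l with
  | nil => rfl
  | cons u l ih => rw [List.countP_cons, List.map_cons, List.sum_cons, ih, Nat.add_comm]

/-- The members of `V` have distinct colors, so the filtered sublists are disjoint parts of `U`. -/
theorem sum_filter_eq_le {β : Type*} [DecidableEq β] (g : α → β) (f : α → ℕ) (V U : List α)
    (hV : (V.map g).Nodup) :
    (V.map fun v => ((U.filter fun u => g u = g v).map f).sum).sum ≤ (U.map f).sum := by
  induction V generalizing U with
  | nil => simp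
  | cons v V ih =>
    rw [List.map_cons, List.nodup_cons] at hV
    have h1 : ∀ v' ∈ V, (U.filter fun u => g u = g v') =
        (U.filter fun u => ¬ g u = g v).filter fun u => g u = g v' := by
      intro v' hv'
      rw [List.filter_filter]
      refine List.filter_congr fun u _ => ?_
      have : g v' ≠ g v := fun h => hV.1 (h ▸ List.mem_map_of_mem hv')
      by_cases hu : g u = g v'
      · simp [hu, this]
      · simp [hu]
    have h2 := ih (U.filter fun u => ¬ g u = g v) hV.2
    have h4 : (V.map fun v' => ((U.filter fun u => g u = g v').map f).sum) = V.map fun v' =>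
        (((U.filter fun u => ¬ g u = g v).filter fun u => g u = g v').map f).sum :=
      List.map_congr_left fun v' hv' => by rw [h1 v' hv']
    rw [List.map_cons, List.sum_cons, h4]
    have h3 : ∀ U : List α, (U.map f).sum = ((U.filter fun u => g u = g v).map f).sum +
        ((U.filter fun u => ¬ g u = g v).map f).sum := by
      intro U
      induction U with
      | nil => simp
      | cons u U ih => by_cases hu : g u = g v <;> simp_all <;> omega
    rw [h3 U]
    omega

open Classical in
/-- Merging the blocks of a sequence `U` within the classes of a coloring `g`, one block for each
member of `V`. -/
theorem sum_cyclicChanges_merge_le {β : Type*} [DecidableEq β] (g : α → β) (f : α → List α)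
    (V U : List α) (hV : (V.map g).Nodup) (hf : ∀ v ∈ U, ∃ t, f v = v :: t) (b : α → Prop)
    (hb : ∀ v ∈ V, ∀ u ∈ U, g u = g v → (b u ↔ b v)) :
    (V.map fun v => cyclicChanges y ((U.filter fun u => g u = g v).flatMap f)).sum ≤
      (U.map fun u => cyclicChanges y (f u)).sum + 2 * U.countP fun u => ¬ (y u ↔ b u) := by
  have h1 : ∀ v ∈ V, cyclicChanges y ((U.filter fun u => g u = g v).flatMap f) ≤
      ((U.filter fun u => g u = g v).map fun u =>
        cyclicChanges y (f u) + 2 * if y u ↔ b u then 0 else 1).sum := by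
    intro v hv
    refine (cyclicChanges_flatMap_le y f _ fun u hu => hf u (List.mem_of_mem_filter hu)).trans ?_
    rw [List.sum_map_add]
    -- On the class of `v` the predicate `b` is constantly `b v`, so the circle of heads has at most
    -- two changes for each head where `y` and `b` disagree.
    refine Nat.add_le_add_left ((cyclicChanges_le_countP y (b v) _).trans (le_of_eq ?_)) _
    rw [List.sum_map_mul_left, countP_eq_sum_map]
    congr 1
    refine congrArg List.sum (List.map_congr_left fun u hu => ?_)
    rw [List.mem_filter] at hu
    have := hb v hv u hu.1 (by simpa using hu.2)
    by_cases y u <;> by_cases b v <;> simp_all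
  refine (List.sum_le_sum h1).trans ((sum_filter_eq_le g _ V U hV).trans (le_of_eq ?_))
  rw [List.sum_map_add, List.sum_map_mul_left, countP_eq_sum_map]
  congr 3
  refine List.map_congr_left fun u _ => ?_
  by_cases h : (y u ↔ b u) <;> simp [h]

end Changes

/-! ### Greedy intervals -/

section Greedy

open Classical in
/-- Cut a sequence into intervals, starting from its end: an interval is extended as long as it has
a common neighbor. -/
noncomputable def greedyIntervals {α : Type*} (E : α → α → Prop) : List α → List (List α)
  | [] => []
  | u :: l =>
    match greedyIntervals E l with
    | [] => [[u]]
    | c :: r => if ∃ z, ∀ v ∈ u :: c, E v z then (u :: c) :: r else [u] :: c :: r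

variable {α : Type*} (E : α → α → Prop)

theorem flatten_greedyIntervals (l : List α) : (greedyIntervals E l).flatten = l := by
  induction l with
  | nil => simp [greedyIntervals]
  | cons u l ih =>
    rw [greedyIntervals]
    split
    · next h => rw [h] at ih; simp [← ih]
    · next c r h =>
      rw [h] at ih
      split_ifs <;> simp [← ih]

theorem exists_greedyIntervals_cons (u : α) (l : List α) :
    ∃ c r, greedyIntervals E (u :: l) = (u :: c) :: r := by
  rw [greedyIntervals]
  split
  · exact ⟨[], [], rfl⟩
  · split_ifs
    · exact ⟨_, _, rfl⟩
    · exact ⟨[], _, rfl⟩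

theorem of_mem_greedyIntervals {l I : List α} (hI : I ∈ greedyIntervals E l) :
    (∃ u, I = [u]) ∨ ∃ z, ∀ v ∈ I, E v z := by
  induction l generalizing I with
  | nil => simp [greedyIntervals] at hI
  | cons u l ih =>
    rw [greedyIntervals] at hI
    split at hI
    · exact Or.inl ⟨u, by simpa using hI⟩
    · next c r h =>
      rw [h] at ih
      split_ifs at hI with hz
      · rcases List.mem_cons.1 hI with rfl | hI
        · exact Or.inr hz
        · exact ih (by simp [hI])
      · rcases List.mem_cons.1 hI with rfl | hI
        · exact Or.inl ⟨u, rfl⟩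
        · exact ih hI

/-- Here `a` and `a'` are the values of `y` at the new and the old first element, `P` and `Q` say
that `y` meets, respectively contains, the old first interval, `m'` counts the later intervals met,
and `m` the changes. This is the case where the first interval is extended. The next lemma treats a
newly opened interval, where `h0` expresses that extending was impossible. -/
theorem touched_join_le {a a' P Q : Prop} [Decidable P] [Decidable Q] [Decidable (a ∨ P)]
    [Decidable (a ∧ Q)] [Decidable (a ↔ a')] {m m' : ℕ} (hP : a' → P) (hQ : Q → a')
    (ih : m' + (if P then 1 else 0) ≤ m + if Q then 1 else 0) :
    m' + (if a ∨ P then 1 else 0) ≤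
      (if a ↔ a' then 0 else 1) + m + if a ∧ Q then 1 else 0 := by
  split_ifs at ih ⊢ <;> first | omega | (exfalso; clear ih; tauto)

theorem touched_new_le {a a' P Q : Prop} [Decidable P] [Decidable Q] [Decidable a]
    [Decidable (a ↔ a')] {m m' : ℕ} (hP : a' → P) (hQ : Q → a') (h0 : ¬ (a ∧ Q))
    (ih : m' + (if P then 1 else 0) ≤ m + if Q then 1 else 0) :
    m' + (if P then 1 else 0) + (if a then 1 else 0) ≤
      (if a ↔ a' then 0 else 1) + m + if a then 1 else 0 := by
  split_ifs at ih ⊢ <;> first | omega | (exfalso; clear ih; tauto)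

open Classical in
-- The last summand is a potential: an interval that is met but not yet paid for by a change must be
-- the first one and must lie inside `y`. If the next element also satisfies `y`, then the vertex
-- `z` with neighborhood `y` is a common neighbor, and the interval is extended instead of a new one
-- being opened.
theorem countP_greedyIntervals_le_of_eq_cons (y : α → Prop) (hy : ∃ z, ∀ v, y v ↔ E v z) (u : α)
    (l c : List α) (r : List (List α)) (h : greedyIntervals E (u :: l) = c :: r) :
    (greedyIntervals E (u :: l)).countP (fun I => ∃ v ∈ I, y v) ≤
      changes y u l + if ∀ v ∈ c, y v then 1 else 0 := by
  induction l generalizing u c r with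
  | nil =>
    simp only [greedyIntervals, List.cons.injEq] at h ⊢
    rw [← h.1]
    by_cases hu : y u <;> simp [hu, changes]
  | cons u' l ih =>
    obtain ⟨c', r', h'⟩ := exists_greedyIntervals_cons E u' l
    have ih := ih u' _ _ h'
    rw [greedyIntervals, h'] at h ⊢
    rw [h'] at ih
    obtain ⟨z, hz⟩ := hy
    have hP : y u' → ∃ v ∈ u' :: c', y v := fun h => ⟨u', by simp, h⟩
    have hQ : (∀ v ∈ u' :: c', y v) → y u' := fun h => h u' (by simp)
    by_cases hc : ∃ z, ∀ v ∈ u :: u' :: c', E v z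
    · simp only [if_pos hc] at h ⊢
      obtain ⟨rfl, rfl⟩ := List.cons.inj h
      simp only [List.countP_cons, changes, decide_eq_true_eq,
        List.exists_mem_cons_iff (l := u' :: c'),
        List.forall_mem_cons (l := u' :: c')] at ih ⊢
      exact touched_join_le hP hQ ih
    · simp only [if_neg hc] at h ⊢
      obtain ⟨rfl, rfl⟩ := List.cons.inj h
      have h0 : ¬ (y u ∧ ∀ v ∈ u' :: c', y v) := by
        rintro ⟨h1, h2⟩
        exact hc ⟨z, fun v hv => (hz v).1 ((List.forall_mem_cons.2 ⟨h1, h2⟩) v hv)⟩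
      simp only [List.countP_cons (l := r'), List.countP_cons (l := _ :: r'), changes,
        decide_eq_true_eq, List.mem_singleton, exists_eq_left, forall_eq] at ih ⊢
      exact touched_new_le hP hQ h0 ih

open Classical in
theorem countP_greedyIntervals_le (y : α → Prop) (hy : ∃ z, ∀ v, y v ↔ E v z) (l : List α) :
    (greedyIntervals E l).countP (fun I => ∃ v ∈ I, y v) ≤ cyclicChanges y l + 1 := by
  cases l with
  | nil => simp [greedyIntervals]
  | cons u l =>
    obtain ⟨c, r, h⟩ := exists_greedyIntervals_cons E u l
    refine (countP_greedyIntervals_le_of_eq_cons E y hy u l _ _ h).trans ?_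
    refine Nat.add_le_add (changes_le_changes_append y u l [u]) ?_
    split_ifs <;> simp

end Greedy

namespace WordRAM

/-! ### Memory that a program leaves unchanged -/

/-- The memories `s` and `s'` differ at most in the registers `R` and the arrays `A`. -/
structure Same (R A : List ℕ) (s s' : State) : Prop where
  reg : ∀ x, x ∉ R → s'.reg x = s.reg x
  arr : ∀ a, a ∉ A → s'.arr a = s.arr a

namespace Same

variable {R A R' A' : List ℕ} {s s' s'' : State}

theorem refl (R A : List ℕ) (s : State) : Same R A s s := ⟨fun _ _ => rfl, fun _ _ => rfl⟩

theorem trans (h : Same R A s s') (h' : Same R A s' s'') : Same R A s s'' :=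
  ⟨fun x hx => (h'.reg x hx).trans (h.reg x hx), fun a ha => (h'.arr a ha).trans (h.arr a ha)⟩

theorem mono (h : Same R A s s') (hR : R ⊆ R') (hA : A ⊆ A') : Same R' A' s s' :=
  ⟨fun x hx => h.reg x fun h => hx (hR h), fun a ha => h.arr a fun h => ha (hA h)⟩

theorem setReg (h : Same R A s s') {x : ℕ} (hx : x ∈ R) (v : ℕ) : Same R A s (s'.setReg x v) :=
  ⟨fun y hy => by rw [State.reg_setReg, if_neg (by rintro rfl; exact hy hx), h.reg y hy],
    fun a ha => h.arr a ha⟩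

theorem setCell (h : Same R A s s') {a : ℕ} (ha : a ∈ A) (i v : ℕ) :
    Same R A s (s'.setCell a i v) :=
  ⟨fun y hy => h.reg y hy,
    fun b hb => by rw [State.arr_setCell, if_neg (by rintro rfl; exact hb ha), h.arr b hb]⟩

end Same

theorem ite_mod_two_pow_eq_zero {w : ℕ} (hw : 1 < 2 ^ w) (P : Prop) [Decidable P] :
    ((if P then 1 else 0) % 2 ^ w = 0) ↔ ¬ P := by
  split_ifs with h <;> simp [h, Nat.mod_eq_of_lt hw]

/-- Degrees are differences of offsets, so the sum telescopes; this turns costs linear in the degree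
into total time O(n + m). -/
theorem sum_range_offset_le {off : ℕ → ℕ} {n : ℕ} (h0 : off 0 = 0)
    (h : ∀ i < n, off i ≤ off (i + 1)) (a b : ℕ) :
    ∑ i ∈ Finset.Ico 0 n, (a + b * (off (i + 1) - off i)) = a * n + b * off n := by
  induction n with
  | zero => simp [h0]
  | succ n ih =>
    rw [Finset.sum_Ico_succ_top (by omega), ih fun i hi => h i (by omega)]
    obtain ⟨d, hd⟩ := Nat.exists_eq_add_of_le (h n (by omega))
    rw [hd, Nat.add_sub_cancel_left]
    ring

/-! ### Graphs in memory -/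

/-- A graph on `{0, …, n - 1}` with the edge relation `E`, given by adjacency lists (the neighbors
of `i` are listed in `dat` from the position `off i` to the position `off (i + 1) - 1`), a rational
number `p / q`, and a word length `w`. -/
structure GraphData where
  (n p q w : ℕ)
  (off dat : ℕ → ℕ)
  (E : ℕ → ℕ → Prop)
  p_pos : 0 < p
  q_pos : 0 < q
  q_le_p : q ≤ p
  word : (n + p + q + 2) ^ 4 ≤ 2 ^ w
  off_zero : off 0 = 0
  off_mono : ∀ i < n, off i ≤ off (i + 1)
  off_le : off n ≤ n * n
  adj : ∀ i < n, ∀ z, E i z ↔ ∃ j, off i ≤ j ∧ j < off (i + 1) ∧ dat j = z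
  inj : ∀ i < n, ∀ j j', off i ≤ j → j < off (i + 1) → off i ≤ j' → j' < off (i + 1) →
    dat j = dat j' → j = j'
  lt : ∀ {x y}, E x y → y < n
  symm : ∀ {x y}, E x y → E y x
  traces : ∀ S T : Finset ℕ, S.Nonempty → (∀ x ∈ S, x < n) → (∀ x ∈ T, x < n) →
    (∀ x ∈ T, ∀ y ∈ T, (∀ r ∈ S, E x r ↔ E y r) → x = y) → q * T.card ≤ p * S.card

namespace GraphData

variable (X : GraphData)

/-- Room for all class numbers: at most `n` phases use up to `2 * (1 + n ^ 2)` numbers each, and the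
final merge up to `1 + n ^ 2` more. -/
theorem poly_lt : 2 * X.n ^ 3 + 2 * X.n ^ 2 + 4 * X.n + 10 < 2 ^ X.w := by
  have h1 := X.p_pos
  have h2 := X.q_pos
  have h3 : (X.n + 4) ^ 4 ≤ (X.n + X.p + X.q + 2) ^ 4 := Nat.pow_le_pow_left (by omega) 4
  refine lt_of_lt_of_le ?_ (h3.trans X.word)
  have : (X.n + 4) ^ 4 = X.n ^ 4 + 16 * X.n ^ 3 + 96 * X.n ^ 2 + 256 * X.n + 256 := by ring
  rw [this]
  nlinarith [Nat.zero_le (X.n ^ 4), Nat.zero_le (X.n ^ 3), Nat.zero_le (X.n ^ 2)]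

theorem n_lt : X.n + 10 < 2 ^ X.w := by
  have := X.poly_lt
  nlinarith [Nat.zero_le (X.n ^ 3), Nat.zero_le (X.n ^ 2)]

theorem off_lt : X.off X.n + X.n + 10 < 2 ^ X.w := by
  have := X.poly_lt
  have := X.off_le
  nlinarith [Nat.zero_le (X.n ^ 3), Nat.zero_le (X.n ^ 2)]

theorem off_le_off {i j : ℕ} (hij : i ≤ j) (hj : j ≤ X.n) : X.off i ≤ X.off j := by
  induction hij with
  | refl => rfl
  | step h ih => exact (ih (by omega)).trans (X.off_mono _ (by omega))

/-- The registers and arrays that hold the input. -/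
structure Loaded (s : State) : Prop where
  reg0 : s.reg 0 = X.n
  reg1 : s.reg 1 = X.p
  reg2 : s.reg 2 = X.q
  arr0 : s.arr 0 = X.off
  arr1 : s.arr 1 = X.dat

variable {X}

theorem Loaded.of_same {R A : List ℕ} {s s' : State} (h : X.Loaded s) (hs : Same R A s s')
    (h0 : 0 ∉ R := by decide) (h1 : 1 ∉ R := by decide) (h2 : 2 ∉ R := by decide)
    (h3 : 0 ∉ A := by decide) (h4 : 1 ∉ A := by decide) : X.Loaded s' :=
  ⟨(hs.reg 0 h0).trans h.reg0, (hs.reg 1 h1).trans h.reg1, (hs.reg 2 h2).trans h.reg2,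
    (hs.arr 0 h3).trans h.arr0, (hs.arr 1 h4).trans h.arr1⟩

end GraphData

/-! ### Partition refinement

Register 0 holds `n`, register 5 the first unused class, register 6 the current key. Array 3 holds
the keys by which vertices are marked, array 4 the classes of the vertices, and array 5 gives for a
class the class to which its elements are moved. -/

/-- Put all vertices into a new class. -/
def resetClasses : Stmt :=
  .seq (.assign 9 (.reg 5))
    (.seq (.assign 5 (.op .add (.reg 5) (.lit 1)))
      (.forLoop 7 (.lit 0) (.reg 0) (.store 4 (.reg 7) (.reg 9))))

/-- Move the neighbor at the position given by register 8. -/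
def moveNeighbor : Stmt :=
  .seq (.assign 10 (.cell 1 (.reg 8)))
    (.seq (.branch (.op .lt (.cell 5 (.cell 4 (.reg 10))) (.reg 9))
        (.seq (.store 5 (.cell 4 (.reg 10)) (.reg 5)) (.assign 5 (.op .add (.reg 5) (.lit 1))))
        .skip)
      (.store 4 (.reg 10) (.cell 5 (.cell 4 (.reg 10)))))

/-- Split all classes by the neighborhood of the vertex in register 7. -/
def splitClasses : Stmt :=
  .seq (.assign 9 (.reg 5))
    (.forLoop 8 (.cell 0 (.reg 7)) (.cell 0 (.op .add (.reg 7) (.lit 1))) moveNeighbor)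

/-- Compute the classes of vertices with equal traces on the marked set. -/
def refine : Stmt :=
  .seq resetClasses
    (.forLoop 7 (.lit 0) (.reg 0)
      (.branch (.op .eq (.cell 3 (.reg 7)) (.reg 6)) splitClasses .skip))

variable {X : GraphData}

theorem run_resetClasses {s : State} (hX : X.Loaded s) (h5 : s.reg 5 + 1 < 2 ^ X.w) :
    Run X.w resetClasses s (4 * X.n + 7) fun s' => Same [5, 7, 9] [4] s s' ∧
      s'.reg 5 = s.reg 5 + 1 ∧ ∀ x < X.n, s'.arr 4 x = s.reg 5 := by
  have hw := X.n_lt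
  have h1 : 1 % 2 ^ X.w = 1 := Nat.mod_eq_of_lt (by omega)
  refine (Run.seq (R := fun s' => s' = s.setReg 9 (s.reg 5)) (Run.assign rfl) fun s1 hs1 =>
    Run.seq (R := fun s' => s' = s1.setReg 5 (s.reg 5 + 1)) (Run.assign ?_) fun s2 hs2 =>
    (Run.forLoop (w := X.w) (fun j s' => Same [5, 7, 9] [4] s s' ∧ s'.reg 5 = s.reg 5 + 1 ∧
      s'.reg 9 = s.reg 5 ∧ ∀ x < j, s'.arr 4 x = s.reg 5) (fun _ => 1)
      (lo := 0) (hi := X.n) (Nat.zero_le _) (by omega) ?_ ?_ ?_ ?_)).mono ?_ ?_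
  · rw [hs1]
    simp [Expr.eval, Op.apply, h1, Nat.mod_eq_of_lt h5]
  · simp [Expr.eval]
  · rw [hs2, hs1]
    exact ⟨((((Same.refl _ _ _).setReg (by decide) _).setReg (by decide) _)).setReg (by decide) _,
      by simp⟩
  · rintro j s' ⟨hs, -⟩ -
    simp [Expr.eval, hs.reg 0 (by decide), hX.reg0]
  · rintro j - hj s' hj' ⟨hs, hc5, hc9, hc⟩
    refine Run.store ⟨hj', (hs.setCell (by decide) _ _).setReg (by decide) _, ?_, ?_,
      fun x hx => ?_⟩
    · simpa using hc5
    · simpa using hc9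
    simp only [Expr.eval, hj', hc9, State.arr_setReg, State.arr_setCell, if_true]
    rw [Function.update_apply]
    split_ifs with h
    · rfl
    · exact hc x (by omega)
  · simp; omega
  · rintro s' ⟨-, hs, hc5, -, hc⟩
    exact ⟨hs, hc5, hc⟩

/-- An entry of array 5 counts as set only if it is at least `m`, the first unused class at the
start of the call; stale entries are smaller and need no clearing. Neighbors of `i` move to the
target of their old class, and different old classes have different targets, so two vertices remain
together exactly if they were together and both or neither moved. -/
theorem run_splitClasses {s : State} (hX : X.Loaded s) {i : ℕ} (hi : i < X.n)
    (h7 : s.reg 7 = i) (h5 : s.reg 5 + (X.off (i + 1) - X.off i) < 2 ^ X.w)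
    (hnid : ∀ c, s.arr 5 c < s.reg 5) (hcls : ∀ x < X.n, s.arr 4 x < s.reg 5) :
    Run X.w splitClasses s (12 * (X.off (i + 1) - X.off i) + 5) fun s' =>
      Same [5, 8, 9, 10] [4, 5] s s' ∧ s.reg 5 ≤ s'.reg 5 ∧
      s'.reg 5 ≤ s.reg 5 + (X.off (i + 1) - X.off i) ∧ (∀ c, s'.arr 5 c < s'.reg 5) ∧
      (∀ x < X.n, s.arr 4 x ≤ s'.arr 4 x ∧ s'.arr 4 x < s'.reg 5) ∧
      ∀ x < X.n, ∀ y < X.n,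
        s'.arr 4 x = s'.arr 4 y ↔ s.arr 4 x = s.arr 4 y ∧ (X.E x i ↔ X.E y i) := by
  have hw := X.n_lt
  have h1 : 1 % 2 ^ X.w = 1 := Nat.mod_eq_of_lt (by omega)
  have hle := X.off_mono i hi
  have hlt := X.off_le_off (show i + 1 ≤ X.n by omega) le_rfl
  have hlt' := X.off_lt
  set m := s.reg 5 with hm
  set c0 := s.arr 4 with hc0
  have hi1 : (i + 1) % 2 ^ X.w = i + 1 := Nat.mod_eq_of_lt (by omega)
  refine (Run.seq (R := fun s' => s' = s.setReg 9 m) (Run.assign rfl) fun s1 hs1 =>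
    Run.forLoop (w := X.w) (fun j s' => Same [5, 8, 9, 10] [4, 5] s s' ∧ s'.reg 9 = m ∧
        m ≤ s'.reg 5 ∧ s'.reg 5 + X.off i ≤ m + j ∧ (∀ c, s'.arr 5 c < s'.reg 5) ∧
        (∀ c c', m ≤ s'.arr 5 c → s'.arr 5 c = s'.arr 5 c' → c = c') ∧
        (∀ z, (∃ j', X.off i ≤ j' ∧ j' < j ∧ X.dat j' = z) →
          m ≤ s'.arr 5 (c0 z) ∧ s'.arr 4 z = s'.arr 5 (c0 z)) ∧
        ∀ z, (¬ ∃ j', X.off i ≤ j' ∧ j' < j ∧ X.dat j' = z) → s'.arr 4 z = c0 z)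
      (fun _ => moveNeighbor.size) hle (by omega) ?_ ?_ ?_ ?_).mono ?_ ?_
  · simp [Expr.eval, hs1, h7, hX.arr0]
  · refine ⟨?_, ?_, ?_, ?_, ?_, ?_, ?_, ?_⟩
    · rw [hs1]
      exact ((Same.refl _ _ _).setReg (by decide) _).setReg (by decide) _
    · simp [hs1]
    · simp [hs1, hm]
    · simp [hs1, hm]
    · simpa [hs1] using hnid
    · intro c c' hc
      have := hnid c
      simp only [hs1, State.arr_setReg] at hc
      omega
    · rintro z ⟨j', h, h', -⟩
      omega
    · intro z _
      simp [hs1, hc0]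
  · rintro j s' ⟨hs, -⟩ -
    simp [Expr.eval, Op.apply, hs.reg 7 (by decide), hs.arr 0 (by decide), h7, hX.arr0, h1,
      hi1]
  · rintro j hj1 hj2 s' hj' ⟨hs, e9, hge, hub, hn, hinj, hZ, hnZ⟩
    refine Run.straight (by simp [moveNeighbor, Stmt.IsStraight]) ?_
    -- This is where adjacency lists without repetitions matter: a vertex met again would be moved a
    -- second time, out of its new class.
    have hnew : ¬ ∃ j', X.off i ≤ j' ∧ j' < j ∧ X.dat j' = X.dat j := by
      rintro ⟨j', h, h', he⟩
      have := X.inj i hi j' j h (by omega) hj1 hj2 he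
      omega
    have hz := hnZ _ hnew
    have hzn : X.dat j < X.n := X.lt ((X.adj i hi _).2 ⟨j, hj1, hj2, rfl⟩)
    have e1 : s'.arr 1 = X.dat := by rw [hs.arr 1 (by decide)]; exact hX.arr1
    have hub' : (s'.reg 5 + 1) % 2 ^ X.w = s'.reg 5 + 1 := Nat.mod_eq_of_lt (by omega)
    have hcz : c0 (X.dat j) < m := hcls _ hzn
    by_cases hcase : s'.arr 5 (c0 (X.dat j)) < m
    · have he : moveNeighbor.exec X.w s' = (((s'.setReg 10 (X.dat j)).setCell 5 (c0 (X.dat j))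
          (s'.reg 5)).setReg 5 (s'.reg 5 + 1)).setCell 4 (X.dat j) (s'.reg 5) := by
        simp only [moveNeighbor, Stmt.exec, Expr.eval, Op.apply, State.arr_setReg,
          State.arr_setCell, State.reg_setReg, State.reg_setCell, e1, hj', e9, hz, hcase, if_true,
          Nat.reduceEqDiff, if_false, h1, one_ne_zero, hub', Function.update_self]
      rw [he]
      refine ⟨by simpa using hj', ?_⟩
      refine ⟨(((((hs.setReg (by decide) _).setCell (by decide) _ _).setReg (by decide) _).setCell
        (by decide) _ _).setReg (by decide) _), ?_, ?_, ?_, ?_, ?_, ?_, ?_⟩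
      · simp [e9]
      · simp; omega
      · simp; omega
      · intro c
        simp [Function.update_apply]
        split_ifs
        · omega
        · have := hn c; omega
      · intro c c'
        simp only [State.arr_setReg, State.arr_setCell, if_true, Nat.reduceEqDiff, if_false,
          Function.update_apply]
        have := hn c
        have := hn c'
        split_ifs with h h'
        · intros; rw [h, h']
        · intros; omega
        · intros; omega
        · exact hinj c c'
      · rintro z ⟨j', h1', h2', h3⟩
        simp only [State.arr_setReg, State.arr_setCell, if_true, Nat.reduceEqDiff, if_false,
          Function.update_apply]
        by_cases hzz : z = X.dat j
        · simp [hzz, hge]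
        · have hzj : ∃ j', X.off i ≤ j' ∧ j' < j ∧ X.dat j' = z := by
            refine ⟨j', h1', ?_, h3⟩
            rcases Nat.lt_succ_iff_lt_or_eq.1 h2' with h | rfl
            · exact h
            · exact absurd h3.symm hzz
          have := hZ z hzj
          have hne : c0 z ≠ c0 (X.dat j) := by
            intro he
            rw [he] at this
            omega
          simp [hzz, hne, this]
      · intro z hz'
        have hzz : z ≠ X.dat j := fun h => hz' ⟨j, hj1, by omega, h.symm⟩
        simp only [State.arr_setReg, State.arr_setCell, if_true, Nat.reduceEqDiff, if_false,
          Function.update_apply, hzz]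
        exact hnZ z fun ⟨j', h, h', h''⟩ => hz' ⟨j', h, by omega, h''⟩
    · have he : moveNeighbor.exec X.w s' = (s'.setReg 10 (X.dat j)).setCell 4 (X.dat j)
          (s'.arr 5 (c0 (X.dat j))) := by
        simp only [moveNeighbor, Stmt.exec, Expr.eval, Op.apply, State.arr_setReg,
          State.reg_setReg, e1, hj', e9, hz, hcase, if_true, Nat.reduceEqDiff, if_false,
          Nat.zero_mod]
      rw [he]
      refine ⟨by simpa using hj', ?_⟩
      refine ⟨(((hs.setReg (by decide) _).setCell (by decide) _ _).setReg (by decide) _),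
        ?_, ?_, ?_, ?_, ?_, ?_, ?_⟩
      · simp [e9]
      · simp; omega
      · simp; omega
      · intro c
        simpa using hn c
      · intro c c'
        simpa using hinj c c'
      · rintro z ⟨j', h1', h2', h3⟩
        simp only [State.arr_setReg, State.arr_setCell, if_true, Nat.reduceEqDiff, if_false,
          Function.update_apply]
        by_cases hzz : z = X.dat j
        · simp [hzz]; omega
        · have hzj : ∃ j', X.off i ≤ j' ∧ j' < j ∧ X.dat j' = z := by
            refine ⟨j', h1', ?_, h3⟩
            rcases Nat.lt_succ_iff_lt_or_eq.1 h2' with h | rfl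
            · exact h
            · exact absurd h3.symm hzz
          have := hZ z hzj
          simp [hzz, this]
      · intro z hz'
        have hzz : z ≠ X.dat j := fun h => hz' ⟨j, hj1, by omega, h.symm⟩
        simp only [State.arr_setReg, State.arr_setCell, if_true, if_false,
          Function.update_apply, hzz]
        exact hnZ z fun ⟨j', h, h', h''⟩ => hz' ⟨j', h, by omega, h''⟩
  · simp [moveNeighbor, Stmt.size]; omega
  · rintro s' ⟨-, hs, -, hge, hub, hn, hinj, hZ, hnZ⟩
    have hE : ∀ x, (∃ j', X.off i ≤ j' ∧ j' < X.off (i + 1) ∧ X.dat j' = x) ↔ X.E x i :=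
      fun x => ⟨fun h => X.symm ((X.adj i hi x).2 h), fun h => (X.adj i hi x).1 (X.symm h)⟩
    simp only [hE] at hZ hnZ
    refine ⟨hs, hge, by omega, hn, fun x hx => ?_, fun x hx y hy => ?_⟩
    · have := hcls x hx
      by_cases h : X.E x i
      · have h1 := hZ x h
        have h2 := hn (c0 x)
        omega
      · have h1 := hnZ x h
        omega
    · have hcx := hcls x hx
      have hcy := hcls y hy
      by_cases h : X.E x i <;> by_cases h' : X.E y i
      · have h1 := hZ x h
        have h2 := hZ y h'
        rw [h1.2, h2.2]
        refine ⟨fun he => ⟨hinj _ _ h1.1 he, by simp [h, h']⟩, fun he => by rw [he.1]⟩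
      · have h1 := hZ x h
        have h2 := hnZ y h'
        simp only [h, h', iff_false, not_true, and_false]
        omega
      · have h1 := hnZ x h
        have h2 := hZ y h'
        simp only [h, h', iff_true, and_false, iff_false]
        omega
      · rw [hnZ x h, hnZ y h']
        simp [h, h']

/-- All vertices start in one class, and after round `j` the classes are the traces on the marked
vertices up to `j`. A split opens at most as many classes as the degree of the splitting vertex,
which bounds the growth of register 5. -/
theorem run_refine {s : State} (hX : X.Loaded s) (h5 : s.reg 5 + 1 + X.off X.n < 2 ^ X.w)
    (hnid : ∀ c, s.arr 5 c < s.reg 5) :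
    Run X.w refine s (13 * X.n + 12 * X.off X.n + 11) fun s' =>
      Same [5, 7, 8, 9, 10] [4, 5] s s' ∧ s.reg 5 ≤ s'.reg 5 ∧
      s'.reg 5 ≤ s.reg 5 + 1 + X.off X.n ∧ (∀ c, s'.arr 5 c < s'.reg 5) ∧
      (∀ x < X.n, s.reg 5 ≤ s'.arr 4 x ∧ s'.arr 4 x < s'.reg 5) ∧
      ∀ x < X.n, ∀ y < X.n, s'.arr 4 x = s'.arr 4 y ↔
        ∀ r < X.n, s.arr 3 r = s.reg 6 → (X.E x r ↔ X.E y r) := by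
  have hw := X.n_lt
  have h1 : 1 % 2 ^ X.w = 1 := Nat.mod_eq_of_lt (by omega)
  refine (Run.seq (run_resetClasses hX (by omega)) fun s1 ⟨hs1, h51, hc1⟩ =>
    Run.forLoop (w := X.w) (fun j s' => Same [5, 7, 8, 9, 10] [4, 5] s s' ∧ s.reg 5 + 1 ≤ s'.reg 5 ∧
      s'.reg 5 ≤ s.reg 5 + 1 + X.off j ∧ (∀ c, s'.arr 5 c < s'.reg 5) ∧
      (∀ x < X.n, s.reg 5 ≤ s'.arr 4 x ∧ s'.arr 4 x < s'.reg 5) ∧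
      ∀ x < X.n, ∀ y < X.n, s'.arr 4 x = s'.arr 4 y ↔
        ∀ r < j, s.arr 3 r = s.reg 6 → (X.E x r ↔ X.E y r))
      (fun i => 6 + 12 * (X.off (i + 1) - X.off i)) (lo := 0) (hi := X.n)
      (Nat.zero_le _) (by omega) ?_ ?_ ?_ ?_).mono ?_ ?_
  · simp [Expr.eval]
  · refine ⟨(hs1.mono (by decide) (by decide)).setReg (by decide) _, ?_, ?_, ?_, ?_, ?_⟩
    · simp [h51]
    · simp [h51]
    · intro c
      have := hnid c
      simp only [State.arr_setReg, hs1.arr 5 (by decide), State.reg_setReg, h51]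
      simp only [Nat.reduceEqDiff, if_false]
      omega
    · intro x hx
      simp [hc1 x hx, h51]
    · intro x hx y hy
      simp [hc1 x hx, hc1 y hy]
  · rintro j s' ⟨hs, -⟩ -
    simp [Expr.eval, hs.reg 0 (by decide), hX.reg0]
  · rintro j - hj s' hj' ⟨hs, hge, hub, hn, hcls, heq⟩
    have hX' : X.Loaded s' := hX.of_same hs
    have hoff := X.off_le_off (show j + 1 ≤ X.n by omega) le_rfl
    have hmono := X.off_mono j hj
    have hcond : (Expr.op Op.eq (.cell 3 (.reg 7)) (.reg 6)).eval X.w s' = 0 ↔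
        ¬ s.arr 3 j = s.reg 6 := by
      simp only [Expr.eval, Op.apply, hs.arr 3 (by decide), hs.reg 6 (by decide), hj']
      exact ite_mod_two_pow_eq_zero (by omega) _
    refine (Run.branch (B := 12 * (X.off (j + 1) - X.off j) + 5) (fun he => ?_)
      fun he => ?_).mono (by omega) fun _ h => h
    · have hm : s.arr 3 j = s.reg 6 := by
        by_contra h
        exact he (hcond.2 h)
      refine (run_splitClasses hX' hj hj' (by omega) hn fun x hx => (hcls x hx).2).weaken ?_
      rintro s2 ⟨hs2, hge2, hub2, hn2, hcls2, heq2⟩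
      refine ⟨by rw [hs2.reg 7 (by decide), hj'], (hs.trans (hs2.mono (by decide)
        (by decide))).setReg (by decide) _, ?_, ?_, ?_, ?_, ?_⟩
      · simp; omega
      · simp; omega
      · simpa using hn2
      · intro x hx
        have := hcls2 x hx
        have := hcls x hx
        simp
        omega
      · intro x hx y hy
        simp only [State.arr_setReg, heq2 x hx y hy, heq x hx y hy]
        constructor
        · rintro ⟨h, h'⟩ r hr hmr
          rcases Nat.lt_succ_iff_lt_or_eq.1 hr with hr | rfl
          · exact h r hr hmr
          · exact h'
        · intro h
          exact ⟨fun r hr => h r (by omega), h j (by omega) hm⟩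
    · have hm := hcond.1 he
      refine (Run.skip ?_).mono (B := 1) (by omega) fun _ h => h
      refine ⟨hj', hs.setReg (by decide) _, ?_, ?_, by simpa using hn, ?_, ?_⟩
      · simpa using hge
      · simp; omega
      · simpa using hcls
      · intro x hx y hy
        simp only [State.arr_setReg, heq x hx y hy]
        constructor
        · intro h r hr hmr
          rcases Nat.lt_succ_iff_lt_or_eq.1 hr with hr | rfl
          · exact h r hr hmr
          · exact absurd hmr hm
        · intro h r hr
          exact h r (by omega)
  · have := sum_range_offset_le X.off_zero X.off_mono 9 12
    simp only [show ∀ i, 6 + 12 * (X.off (i + 1) - X.off i) + 3 =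
      9 + 12 * (X.off (i + 1) - X.off i) by intro i; omega, this]
    omega
  · rintro s' ⟨-, hs, hge, hub, hn, hcls, heq⟩
    exact ⟨hs, by omega, hub, hn, hcls, heq⟩

/-! ### Representatives of the classes -/

/-- Mark one element of each class. -/
def markReps : Stmt :=
  .forLoop 7 (.lit 0) (.reg 0)
    (.branch (.op .eq (.cell 6 (.cell 4 (.reg 7))) (.lit 0))
      (.seq (.store 6 (.cell 4 (.reg 7)) (.lit 1)) (.store 3 (.reg 7) (.reg 6))) .skip)

/-- The class numbers are newer than everything recorded in array 6, so its cells are still zero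
there and can tell which classes already have a representative. Likewise the current key exceeds all
old marks, which therefore need no erasing. -/
theorem run_markReps {s : State} (hX : X.Loaded s)
    (hseen : ∀ x < X.n, s.arr 6 (s.arr 4 x) = 0) (hmark : ∀ v, s.arr 3 v < s.reg 6) :
    Run X.w markReps s (8 * X.n + 3) fun s' => Same [7] [3, 6] s s' ∧
      (∀ c, (∀ x < X.n, s.arr 4 x ≠ c) → s'.arr 6 c = s.arr 6 c) ∧
      (∀ v, s'.arr 3 v ≤ s.reg 6) ∧
      (∀ x < X.n, ∃ a < X.n, s'.arr 3 a = s.reg 6 ∧ s.arr 4 a = s.arr 4 x) ∧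
      ∀ a a', s'.arr 3 a = s.reg 6 → s'.arr 3 a' = s.reg 6 → s.arr 4 a = s.arr 4 a' → a = a' := by
  have hw := X.n_lt
  have h1 : 1 % 2 ^ X.w = 1 := Nat.mod_eq_of_lt (by omega)
  refine (Run.forLoop (w := X.w) (fun j s' => Same [7] [3, 6] s s' ∧
      (∀ c, (∀ x < j, s.arr 4 x ≠ c) → s'.arr 6 c = s.arr 6 c) ∧
      (∀ x < j, s'.arr 6 (s.arr 4 x) ≠ 0) ∧
      (∀ v, s'.arr 3 v ≤ s.reg 6) ∧ (∀ v, s'.arr 3 v = s.reg 6 → v < j) ∧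
      (∀ x < j, ∃ a < j, s'.arr 3 a = s.reg 6 ∧ s.arr 4 a = s.arr 4 x) ∧
      ∀ a a', s'.arr 3 a = s.reg 6 → s'.arr 3 a' = s.reg 6 → s.arr 4 a = s.arr 4 a' → a = a')
      (fun _ => 5) (lo := 0) (hi := X.n) (Nat.zero_le _) (by omega) ?_ ?_ ?_ ?_).mono ?_ ?_
  · simp [Expr.eval]
  · refine ⟨(Same.refl _ _ _).setReg (by decide) _, by simp, by simp, fun v => (hmark v).le,
      fun v hv => absurd hv (hmark v).ne, by simp, fun a a' ha => absurd ha (hmark a).ne⟩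
  · rintro j s' ⟨hs, -⟩ -
    simp [Expr.eval, hs.reg 0 (by decide), hX.reg0]
  · rintro j - hj s' hj' ⟨hs, hother, hsn, hle, hlt, hex, hinj⟩
    have hcond : (Expr.op Op.eq (.cell 6 (.cell 4 (.reg 7))) (.lit 0)).eval X.w s' = 0 ↔
        ¬ s'.arr 6 (s.arr 4 j) = 0 := by
      simp only [Expr.eval, Op.apply, hs.arr 4 (by decide), hj', Nat.zero_mod]
      exact ite_mod_two_pow_eq_zero (by omega) _
    refine (Run.branch (B := 3) (fun he => ?_) fun he => ?_).mono (by omega) fun _ h => h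
    · have h0 : s'.arr 6 (s.arr 4 j) = 0 := by
        by_contra h
        exact he (hcond.2 h)
      have hnew : ∀ x < j, s.arr 4 x ≠ s.arr 4 j := by
        intro x hx hxj
        exact hsn x hx (hxj ▸ h0)
      refine Run.straight (by simp [Stmt.IsStraight]) ?_
      simp only [Stmt.exec, Expr.eval, State.reg_setCell, hj', h1, hs.arr 4 (by decide),
        hs.reg 6 (by decide)]
      refine ⟨trivial, ((hs.setCell (by decide) _ _).setCell (by decide) _ _).setReg (by decide) _,
        ?_, ?_, ?_, ?_, ?_, ?_⟩
      · intro c hc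
        have := hother c fun x hx => hc x (by omega)
        have hcj : c ≠ s.arr 4 j := fun h => hc j (by omega) h.symm
        simpa [Function.update_apply, hcj] using this
      · intro x hx
        simp only [State.arr_setReg, State.arr_setCell, Nat.reduceEqDiff, if_false, if_true,
          Function.update_apply]
        split_ifs with h
        · exact one_ne_zero
        · refine hsn x ?_
          rcases Nat.lt_succ_iff_lt_or_eq.1 hx with hx | rfl
          · exact hx
          · exact absurd rfl h
      · intro v
        simp only [State.arr_setReg, State.arr_setCell, Nat.reduceEqDiff, if_false, if_true,
          Function.update_apply]
        split_ifs
        · rfl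
        · exact hle v
      · intro v
        simp only [State.arr_setReg, State.arr_setCell, Nat.reduceEqDiff, if_false, if_true,
          Function.update_apply]
        split_ifs with h
        · intro; omega
        · intro h'; have := hlt v h'; omega
      · intro x hx
        simp only [State.arr_setReg, State.arr_setCell, Nat.reduceEqDiff, if_false, if_true,
          Function.update_apply]
        rcases Nat.lt_succ_iff_lt_or_eq.1 hx with hx | rfl
        · obtain ⟨a, ha, ha', ha''⟩ := hex x hx
          exact ⟨a, by omega, by rw [if_neg (by omega)]; exact ha', ha''⟩
        · exact ⟨x, by omega, by simp, rfl⟩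
      · intro a a'
        simp only [State.arr_setReg, State.arr_setCell, Nat.reduceEqDiff, if_false, if_true,
          Function.update_apply]
        split_ifs with h h'
        · intros; omega
        · intro _ h3 h4
          exact absurd (h ▸ h4.symm) (hnew a' (hlt a' h3))
        · rename_i h'
          intro h3 _ h4
          exact absurd (h' ▸ h4) (hnew a (hlt a h3))
        · exact hinj a a'
    · have h0 := hcond.1 he
      refine (Run.skip ?_).mono (B := 1) (by omega) fun _ h => h
      have hold : ∃ x < j, s.arr 4 x = s.arr 4 j := by
        by_contra h
        push Not at h
        exact h0 ((hother _ h).trans (hseen j hj))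
      obtain ⟨x0, hx0, hx0'⟩ := hold
      refine ⟨hj', hs.setReg (by decide) _, ?_, ?_, hle, ?_, ?_, hinj⟩
      · exact fun c hc => hother c fun x hx => hc x (by omega)
      · intro x hx
        rcases Nat.lt_succ_iff_lt_or_eq.1 hx with hx | rfl
        · exact hsn x hx
        · exact h0
      · exact fun v hv => (hlt v hv).trans (by omega)
      · intro x hx
        rcases Nat.lt_succ_iff_lt_or_eq.1 hx with hx | rfl
        · obtain ⟨a, ha, ha'⟩ := hex x hx
          exact ⟨a, by omega, ha'⟩
        · obtain ⟨a, ha, ha', ha''⟩ := hex x0 hx0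
          exact ⟨a, by omega, ha', ha''.trans hx0'⟩
  · simp; omega
  · rintro s' ⟨-, hs, hother, -, hle, -, hex, hinj⟩
    exact ⟨hs, hother, hle, hex, hinj⟩

/-! ### Blocks -/

/-- `l` is the linked list that starts with `u`. -/
structure IsBlock (next tail : ℕ → ℕ) (u : ℕ) (l : List ℕ) : Prop where
  head : ∃ t, l = u :: t
  last : l.getLast? = some (tail u)
  chain : l.IsChain fun a b => next a = b

theorem IsBlock.mem_tail {next tail : ℕ → ℕ} {u : ℕ} {l : List ℕ} (h : IsBlock next tail u l) :
    tail u ∈ l := List.mem_of_getLast? h.last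

theorem isChain_update {next : ℕ → ℕ} {l : List ℕ} (h : l.IsChain fun a b => next a = b) {t : ℕ}
    (ht : t ∉ l) (u : ℕ) : l.IsChain fun a b => Function.update next t u a = b := by
  refine h.imp_of_mem_imp fun a b ha _ hab => ?_
  rwa [Function.update_of_ne (by rintro rfl; exact ht ha)]

/-- Only the pointer of the last element `t` is redirected, and `t` occurs nowhere else in the two
lists. -/
theorem isChain_append_update {next : ℕ → ℕ} {l l' : List ℕ} {t u : ℕ}
    (h : l.IsChain fun a b => next a = b) (ht : l.getLast? = some t) (hl : l.Nodup)
    (h' : (u :: l').IsChain fun a b => next a = b) (ht' : t ∉ u :: l') :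
    (l ++ u :: l').IsChain fun a b => Function.update next t u a = b := by
  induction l with
  | nil => simp at ht
  | cons x l ih =>
    cases l with
    | nil =>
      obtain rfl : x = t := by simpa using ht
      simp only [List.cons_append, List.nil_append, List.isChain_cons_cons]
      exact ⟨Function.update_self .., isChain_update h' ht' u⟩
    | cons y l =>
      rw [List.isChain_cons_cons] at h
      have hty : (y :: l).getLast? = some t := by simpa using ht
      have hxt : x ≠ t := by
        rintro rfl
        exact (List.nodup_cons.1 hl).1 (List.mem_of_getLast? hty)
      simp only [List.cons_append, List.isChain_cons_cons]
      exact ⟨by rw [Function.update_of_ne hxt]; exact h.1, ih h.2 hty (List.nodup_cons.1 hl).2⟩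

theorem eq_of_mem_of_nodup_flatMap {U : List ℕ} {f : ℕ → List ℕ} (h : (U.flatMap f).Nodup)
    {u u' a : ℕ} (hu : u ∈ U) (hu' : u' ∈ U) (ha : a ∈ f u) (ha' : a ∈ f u') : u = u' := by
  by_contra hne
  have : Std.Symm (Function.onFun List.Disjoint f) := ⟨fun a b h => List.Disjoint.symm h⟩
  exact (List.nodup_flatMap.1 h).2.forall hu hu' hne ha ha'

theorem nodup_of_nodup_flatMap {U : List ℕ} {f : ℕ → List ℕ} (h : (U.flatMap f).Nodup)
    (hf : ∀ u ∈ U, u ∈ f u) : U.Nodup := by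
  refine List.Pairwise.imp_of_mem ?_ (List.nodup_flatMap.1 h).2
  rintro a b ha hb hab rfl
  exact hab (hf a ha) (hf a ha)

/-- The memory holds a list `U` of vertices, and for each of them a linked list that starts with
it, so that each vertex is in exactly one of these lists. -/
structure HoldsBlocks (n : ℕ) (s : State) (U : List ℕ) (f : ℕ → List ℕ) : Prop where
  count : s.reg 3 = U.length
  data : ∀ (i : ℕ) (h : i < U.length), s.arr 2 i = U[i]
  block : ∀ u ∈ U, IsBlock (s.arr 7) (s.arr 8) u (f u)
  nodup : (U.flatMap f).Nodup
  mem : ∀ v, v ∈ U.flatMap f ↔ v < n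

namespace HoldsBlocks

variable {n : ℕ} {s s' : State} {U : List ℕ} {f : ℕ → List ℕ}

theorem self_mem (h : HoldsBlocks n s U f) {u : ℕ} (hu : u ∈ U) : u ∈ f u := by
  obtain ⟨t, ht⟩ := (h.block u hu).head
  simp [ht]

theorem lt (h : HoldsBlocks n s U f) {u : ℕ} (hu : u ∈ U) : u < n :=
  (h.mem u).1 (List.mem_flatMap.2 ⟨u, hu, h.self_mem hu⟩)

theorem nodup_heads (h : HoldsBlocks n s U f) : U.Nodup :=
  nodup_of_nodup_flatMap h.nodup fun _ hu => h.self_mem hu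

theorem length_le (h : HoldsBlocks n s U f) : U.length ≤ n := by
  have h1 : U ⊆ List.range n := fun u hu => List.mem_range.2 (h.lt hu)
  simpa using (h.nodup_heads.subperm h1).length_le

theorem of_same {R A : List ℕ} (h : HoldsBlocks n s U f) (hs : Same R A s s')
    (h3 : 3 ∉ R := by decide) (h2 : 2 ∉ A := by decide) (h7 : 7 ∉ A := by decide)
    (h8 : 8 ∉ A := by decide) : HoldsBlocks n s' U f := by
  refine ⟨(hs.reg 3 h3).trans h.count, ?_, ?_, h.nodup, h.mem⟩
  · rw [hs.arr 2 h2]; exact h.data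
  · rw [hs.arr 7 h7, hs.arr 8 h8]; exact h.block

end HoldsBlocks

/-- The concatenation of the blocks of all elements of `U` in the class of `v`. -/
def mergedBlock (g : ℕ → ℕ) (U : List ℕ) (f : ℕ → List ℕ) (v : ℕ) : List ℕ :=
  (U.filter fun u => g u = g v).flatMap f

theorem mem_mergedBlock {g : ℕ → ℕ} {U : List ℕ} {f : ℕ → List ℕ} {v a : ℕ} :
    a ∈ mergedBlock g U f v ↔ ∃ u ∈ U, g u = g v ∧ a ∈ f u := by
  simp [mergedBlock, and_assoc]

theorem mergedBlock_append (g : ℕ → ℕ) (U : List ℕ) (f : ℕ → List ℕ) (u v : ℕ) :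
    mergedBlock g (U ++ [u]) f v = mergedBlock g U f v ++ if g u = g v then f u else [] := by
  by_cases h : g u = g v <;> simp [mergedBlock, List.filter_append, h]

theorem mergedBlock_eq_nil {g : ℕ → ℕ} {U : List ℕ} {f : ℕ → List ℕ} {v : ℕ}
    (h : ∀ u ∈ U, g u ≠ g v) : mergedBlock g U f v = [] := by
  rw [mergedBlock, List.filter_eq_nil_iff.2 (by simpa using h), List.flatMap_nil]

/-- Merge the block of the vertex at the position given by register 7. -/
def mergeOne : Stmt :=
  .seq (.assign 10 (.cell 2 (.reg 7)))
    (.branch (.op .eq (.cell 6 (.cell 4 (.reg 10))) (.lit 0))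
      (.seq (.store 6 (.cell 4 (.reg 10)) (.op .add (.reg 10) (.lit 1)))
        (.seq (.store 2 (.reg 12) (.reg 10)) (.assign 12 (.op .add (.reg 12) (.lit 1)))))
      (.seq (.assign 11 (.op .sub (.cell 6 (.cell 4 (.reg 10))) (.lit 1)))
        (.seq (.store 7 (.cell 8 (.reg 11)) (.reg 10))
          (.store 8 (.reg 11) (.cell 8 (.reg 10))))))

/-- Merge the blocks in each class. -/
def merge : Stmt :=
  .seq (.assign 12 (.lit 0)) (.seq (.forLoop 7 (.lit 0) (.reg 3) mergeOne) (.assign 3 (.reg 12)))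

/-- The state of affairs when the blocks of the first `i` elements of `U` have been merged into
blocks that start with the elements of `V`. -/
structure Merging (s s' : State) (U : List ℕ) (f : ℕ → List ℕ) (i : ℕ) (V : List ℕ) : Prop where
  same : Same [7, 10, 11, 12] [2, 6, 7, 8] s s'
  count : s'.reg 12 = V.length
  le : V.length ≤ i
  data : ∀ (j : ℕ) (h : j < V.length), s'.arr 2 j = V[j]
  rest : ∀ j, i ≤ j → s'.arr 2 j = s.arr 2 j
  subset : ∀ v ∈ V, v ∈ U.take i
  nodup : (V.map (s.arr 4)).Nodup
  rep : ∀ u ∈ U.take i, ∃ v ∈ V, s.arr 4 v = s.arr 4 u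
  unseen : ∀ c, (∀ u ∈ U.take i, s.arr 4 u ≠ c) → s'.arr 6 c = s.arr 6 c
  seen : ∀ v ∈ V, s'.arr 6 (s.arr 4 v) = v + 1
  block : ∀ v ∈ V, IsBlock (s'.arr 7) (s'.arr 8) v (mergedBlock (s.arr 4) (U.take i) f v)
  blockRest : ∀ u ∈ U.drop i, IsBlock (s'.arr 7) (s'.arr 8) u (f u)

/-- If the class of `u` has no head yet, `u` becomes one; the list of heads is compacted in place,
which is safe because `V.length ≤ i`. Otherwise the last element of the block of `v` is made to
point to `u`, and `v` inherits the tail of `u`. Array 6 stores `v + 1`, so that zero means that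
there is no head. -/
theorem Merging.step {s s' : State} {U : List ℕ} {f : ℕ → List ℕ} {i : ℕ} {V : List ℕ}
    (hb : HoldsBlocks X.n s U f) (hseen : ∀ x < X.n, s.arr 6 (s.arr 4 x) = 0)
    (hi : i < U.length) (hi7 : s'.reg 7 = i) (h : Merging s s' U f i V) :
    ∃ V', (mergeOne.exec X.w s').reg 7 = i ∧
      Merging s ((mergeOne.exec X.w s').setReg 7 (i + 1)) U f (i + 1) V' := by
  have hw := X.n_lt
  have hlen := hb.length_le
  have h1 : 1 % 2 ^ X.w = 1 := Nat.mod_eq_of_lt (by omega)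
  set u := U[i] with hu
  have huU : u ∈ U := List.getElem_mem hi
  have hun : u < X.n := hb.lt huU
  have e2 : s'.arr 2 i = u := (h.rest i le_rfl).trans (hb.data i hi)
  have e4 : s'.arr 4 = s.arr 4 := h.same.arr 4 (by decide)
  have htake : U.take (i + 1) = U.take i ++ [u] := by
    rw [hu, List.take_append_getElem]
  have hdrop : U.drop i = u :: U.drop (i + 1) := List.drop_eq_getElem_cons hi
  have hunew : u ∉ U.take i := by
    have h2 := hb.nodup_heads
    rw [← List.take_append_drop i U, hdrop, List.nodup_append] at h2
    exact fun h => h2.2.2 u h u (by simp) rfl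
  have hud : u ∈ U.drop i := by simp [hdrop]
  have hu1 : (u + 1) % 2 ^ X.w = u + 1 := Nat.mod_eq_of_lt (by omega)
  have hsub : ∀ x ∈ U.take i, x ∈ U := fun x hx => List.mem_of_mem_take hx
  have hcount : (V.length + 1) % 2 ^ X.w = V.length + 1 :=
    Nat.mod_eq_of_lt (by have := h.le; omega)
  by_cases hcase : s'.arr 6 (s.arr 4 u) = 0
  · have hnew : ∀ v ∈ U.take i, s.arr 4 v ≠ s.arr 4 u := by
      intro v hv he
      obtain ⟨v', hv', he'⟩ := h.rep v hv
      have := h.seen v' hv'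
      rw [he', he, hcase] at this
      omega
    have he : mergeOne.exec X.w s' = (((s'.setReg 10 u).setCell 6 (s.arr 4 u) (u + 1)).setCell 2
        V.length u).setReg 12 (V.length + 1) := by
      simp only [mergeOne, Stmt.exec, Expr.eval, Op.apply, State.arr_setReg, State.arr_setCell,
        State.reg_setReg, State.reg_setCell, e2, e4, hi7, hcase, if_true, Nat.reduceEqDiff,
        if_false, h1, hu1, h.count, Nat.zero_mod, one_ne_zero, hcount]
    rw [he]
    refine ⟨V ++ [u], by simpa using hi7, ?_⟩
    constructor
    · exact ((((h.same.setReg (by decide) _).setCell (by decide) _ _).setCell (by decide)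
        _ _).setReg (by decide) _).setReg (by decide) _
    · simp
    · simpa using h.le
    · intro j hj
      simp only [State.arr_setReg, State.arr_setCell, if_true, Function.update_apply,
        Nat.reduceEqDiff, if_false]
      simp only [List.length_append, List.length_singleton] at hj
      split_ifs with hjV
      · simp [hjV]
      · rw [List.getElem_append_left (by omega)]
        exact h.data j (by omega)
    · intro j hj
      have := h.le
      simp only [State.arr_setReg, State.arr_setCell, if_true, Function.update_apply,
        Nat.reduceEqDiff, if_false]
      rw [if_neg (by omega)]
      exact h.rest j (by omega)
    · intro v hv
      rw [htake, List.mem_append]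
      rcases List.mem_append.1 hv with hv | hv
      · exact Or.inl (h.subset v hv)
      · exact Or.inr hv
    · rw [List.map_append, List.nodup_append]
      refine ⟨h.nodup, by simp, ?_⟩
      intro a ha b hb'
      obtain ⟨v, hv, rfl⟩ := List.mem_map.1 ha
      obtain rfl : b = s.arr 4 u := by simpa using hb'
      exact hnew v (h.subset v hv)
    · intro x hx
      rw [htake, List.mem_append] at hx
      rcases hx with hx | hx
      · obtain ⟨v, hv, hv'⟩ := h.rep x hx
        exact ⟨v, by simp [hv], hv'⟩
      · exact ⟨u, by simp, by rw [List.mem_singleton.1 hx]⟩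
    · intro c hc
      rw [htake] at hc
      have hcu : c ≠ s.arr 4 u := fun h => hc u (by simp) h.symm
      simpa [Function.update_apply, hcu] using
        h.unseen c fun x hx => hc x (by simp [hx])
    · intro v hv
      simp only [State.arr_setReg, State.arr_setCell, if_true, Function.update_apply,
        Nat.reduceEqDiff, if_false]
      rcases List.mem_append.1 hv with hv | hv
      · rw [if_neg (hnew v (h.subset v hv))]
        exact h.seen v hv
      · obtain rfl := List.mem_singleton.1 hv
        simp
    · intro v hv
      rw [htake, mergedBlock_append]
      simp only [State.arr_setReg, State.arr_setCell, Nat.reduceEqDiff, if_false]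
      rcases List.mem_append.1 hv with hv | hv
      · rw [if_neg (fun e => hnew v (h.subset v hv) e.symm), List.append_nil]
        exact h.block v hv
      · obtain rfl := List.mem_singleton.1 hv
        rw [mergedBlock_eq_nil hnew, if_pos rfl, List.nil_append]
        exact h.blockRest _ hud
    · intro x hx
      simp only [State.arr_setReg, State.arr_setCell, Nat.reduceEqDiff, if_false]
      exact h.blockRest x (by rw [hdrop]; simp [hx])
  · obtain ⟨x, hx, hxu⟩ : ∃ x ∈ U.take i, s.arr 4 x = s.arr 4 u := by
      by_contra hcon
      push Not at hcon
      exact hcase ((h.unseen _ hcon).trans (hseen u hun))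
    obtain ⟨v, hv, hvx⟩ := h.rep x hx
    have hvu : s.arr 4 v = s.arr 4 u := hvx.trans hxu
    have hvs : s'.arr 6 (s.arr 4 u) = v + 1 := hvu ▸ h.seen v hv
    have hv1 : v % 2 ^ X.w = v :=
      Nat.mod_eq_of_lt (by have := hb.lt (hsub v (h.subset v hv)); omega)
    have hne : v ≠ u := by
      rintro rfl
      exact hunew (h.subset _ hv)
    have he : mergeOne.exec X.w s' = (((s'.setReg 10 u).setReg 11 v).setCell 7 (s'.arr 8 v)
        u).setCell 8 v (s'.arr 8 u) := by
      simp only [mergeOne, Stmt.exec, Expr.eval, Op.apply, State.arr_setReg, State.arr_setCell,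
        State.reg_setReg, State.reg_setCell, e2, e4, hi7, hvs, if_true, Nat.reduceEqDiff,
        if_false, h1, Nat.zero_mod, Nat.add_sub_cancel, hv1, Nat.add_eq_zero_iff, one_ne_zero,
        and_false]
    rw [he]
    have hB := h.block v hv
    have hBu := h.blockRest u hud
    obtain ⟨x1, hx1, hx1v, hx1t⟩ := mem_mergedBlock.1 hB.mem_tail
    -- The original blocks are disjoint, so the redirected pointer belongs to the block of `x1`
    -- alone. Hence the other merged blocks and the unread blocks keep their links.
    have huniq : ∀ y ∈ U, s'.arr 8 v ∈ f y → y = x1 := fun y hy hyt =>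
      eq_of_mem_of_nodup_flatMap hb.nodup hy (hsub _ hx1) hyt hx1t
    have hrest : ∀ y ∈ U.drop i, s'.arr 8 v ∉ f y := by
      intro y hy hyt
      obtain rfl := huniq y (List.mem_of_mem_drop hy) hyt
      have h2 := hb.nodup_heads
      rw [← List.take_append_drop i U, List.nodup_append] at h2
      exact h2.2.2 y hx1 y hy rfl
    refine ⟨V, by simpa using hi7, ?_⟩
    constructor
    · exact (((((h.same.setReg (by decide) _).setReg (by decide) _).setCell (by decide) _ _).setCell
        (by decide) _ _)).setReg (by decide) _
    · simpa using h.count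
    · exact h.le.trans (Nat.le_succ i)
    · exact h.data
    · exact fun j hj => h.rest j (by omega)
    · intro y hy
      rw [htake]
      simp [h.subset y hy]
    · exact h.nodup
    · intro y hy
      rw [htake, List.mem_append] at hy
      rcases hy with hy | hy
      · exact h.rep y hy
      · exact ⟨v, hv, by rw [List.mem_singleton.1 hy, hvu]⟩
    · intro c hc
      rw [htake] at hc
      exact h.unseen c fun x hx => hc x (by simp [hx])
    · exact h.seen
    · intro y hy
      rw [htake, mergedBlock_append]
      simp only [State.arr_setReg, State.arr_setCell, Nat.reduceEqDiff, if_false, if_true]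
      by_cases hyv : y = v
      · subst hyv
        rw [if_pos hvu.symm]
        obtain ⟨t, ht⟩ := hBu.head
        obtain ⟨t', ht'⟩ := hB.head
        refine ⟨⟨t' ++ f u, by rw [ht', List.cons_append]⟩, ?_, ?_⟩
        · rw [List.getLast?_append, hBu.last, Function.update_self, Option.some_or]
        · rw [ht]
          refine isChain_append_update hB.chain hB.last ?_ (ht ▸ hBu.chain) (ht ▸ hrest u hud)
          exact List.Nodup.sublist
            (List.Sublist.flatMap (List.filter_sublist.trans (List.take_sublist _ _)) f) hb.nodup
      · have hcls : s.arr 4 y ≠ s.arr 4 v := by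
          intro e
          exact hyv (List.inj_on_of_nodup_map h.nodup hy hv e)
        rw [if_neg (fun e => hcls (e.symm.trans hvu.symm)), List.append_nil]
        have hBy := h.block y hy
        refine ⟨hBy.head, by rw [Function.update_of_ne hyv]; exact hBy.last,
          isChain_update hBy.chain ?_ _⟩
        intro hmem
        obtain ⟨z, hz, hzy, hzt⟩ := mem_mergedBlock.1 hmem
        obtain rfl := huniq z (hsub z hz) hzt
        exact hcls (hzy.symm.trans hx1v)
    · intro y hy
      have hy' : y ∈ U.drop i := by rw [hdrop]; simp [hy]
      simp only [State.arr_setReg, State.arr_setCell, Nat.reduceEqDiff, if_false, if_true]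
      have hBy := h.blockRest y hy'
      have hyv : y ≠ v := by
        rintro rfl
        exact hrest y hy' (by
          have h2 := hb.nodup_heads
          rw [← List.take_append_drop i U, List.nodup_append] at h2
          exact absurd rfl (h2.2.2 y (h.subset _ hv) y hy'))
      exact ⟨hBy.head, by rw [Function.update_of_ne hyv]; exact hBy.last,
        isChain_update hBy.chain (hrest y hy') _⟩

theorem run_merge {s : State} {U : List ℕ} {f : ℕ → List ℕ}
    (hb : HoldsBlocks X.n s U f) (hseen : ∀ x < X.n, s.arr 6 (s.arr 4 x) = 0) :
    Run X.w merge s (16 * X.n + 7) fun s' => Same [3, 7, 10, 11, 12] [2, 6, 7, 8] s s' ∧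
      (∀ c, (∀ x < X.n, s.arr 4 x ≠ c) → s'.arr 6 c = s.arr 6 c) ∧
      ∃ V, (∀ v ∈ V, v ∈ U) ∧ (V.map (s.arr 4)).Nodup ∧
        (∀ u ∈ U, ∃ v ∈ V, s.arr 4 v = s.arr 4 u) ∧
        HoldsBlocks X.n s' V (mergedBlock (s.arr 4) U f) := by
  have hw := X.n_lt
  have hlen := hb.length_le
  refine (Run.seq (R := fun s' => s' = s.setReg 12 0) (Run.assign (by simp [Expr.eval]))
    fun s1 hs1 => Run.seq (Run.forLoop (w := X.w) (fun i s' => ∃ V, Merging s s' U f i V)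
      (fun _ => mergeOne.size) (lo := 0) (hi := U.length) (Nat.zero_le _) (by omega) ?_ ?_ ?_ ?_)
    fun s2 hs2 => Run.assign ?_).mono ?_ fun _ h => h
  · simp [Expr.eval]
  · refine ⟨[], ?_⟩
    rw [hs1]
    constructor <;> try simp
    · exact ((Same.refl _ _ _).setReg (by decide) _).setReg (by decide) _
    · exact hb.block
  · rintro j s' ⟨V, h⟩ -
    simp [Expr.eval, h.same.reg 3 (by decide), hb.count]
  · rintro i - hi s' hi7 ⟨V, h⟩
    refine Run.straight (by simp [mergeOne, Stmt.IsStraight]) ?_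
    obtain ⟨V', h7, h'⟩ := h.step hb hseen hi hi7
    exact ⟨h7, V', h'⟩
  · obtain ⟨-, V, h⟩ := hs2
    have ht : U.take U.length = U := List.take_length
    have hsub := h.subset
    have hrep := h.rep
    have hblock := h.block
    have hun := h.unseen
    rw [ht] at hsub hrep hblock hun
    refine ⟨(h.same.mono (by decide) (by decide)).setReg (by decide) _, ?_, V, hsub, h.nodup,
      hrep, ?_⟩
    · exact fun c hc => hun c fun u hu => hc u (hb.lt hu)
    refine ⟨by simp [Expr.eval, h.count], h.data, hblock, ?_, ?_⟩
    · rw [List.nodup_flatMap]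
      constructor
      · intro v _
        exact List.Nodup.sublist (List.Sublist.flatMap List.filter_sublist f) hb.nodup
      · refine List.Pairwise.imp_of_mem ?_ (List.pairwise_map.1 h.nodup)
        intro v v' _ _ hne a ha ha'
        obtain ⟨x, hx, hxv, hxa⟩ := mem_mergedBlock.1 ha
        obtain ⟨y, hy, hyv, hya⟩ := mem_mergedBlock.1 ha'
        obtain rfl := eq_of_mem_of_nodup_flatMap hb.nodup hx hy hxa hya
        exact hne (hxv.symm.trans hyv)
    · intro a
      rw [← hb.mem a, List.mem_flatMap, List.mem_flatMap]
      constructor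
      · rintro ⟨v, hv, ha⟩
        obtain ⟨x, hx, -, hxa⟩ := mem_mergedBlock.1 ha
        exact ⟨x, hx, hxa⟩
      · rintro ⟨x, hx, hxa⟩
        obtain ⟨v, hv, hvx⟩ := hrep x hx
        exact ⟨v, hv, mem_mergedBlock.2 ⟨x, hx, hvx.symm, hxa⟩⟩
  · simp [mergeOne, Stmt.size]
    omega

/-! ### Contraction of a marked set -/

/-- The bookkeeping of the program is in order: classes below `F` and keys up to `K` may be in use,
and array 10 is still empty. -/
structure Working (X : GraphData) (F K : ℕ) (s : State) : Prop where
  loaded : X.Loaded s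
  fresh_pos : 0 < s.reg 5
  fresh_le : s.reg 5 ≤ F
  target : ∀ c, s.arr 5 c < s.reg 5
  seen : ∀ c, s.reg 5 ≤ c → s.arr 6 c = 0
  key_le : s.reg 6 ≤ K
  mark_le : ∀ v, s.arr 3 v ≤ s.reg 6
  run_start : ∀ z, s.arr 9 z = 0
  run_end : ∀ z, s.arr 10 z = 0

theorem Working.mono {F F' K K' : ℕ} {s : State} (h : Working X F K s) (hF : F ≤ F')
    (hK : K ≤ K') : Working X F' K' s :=
  { h with fresh_le := h.fresh_le.trans hF, key_le := h.key_le.trans hK }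

/-- Compute the classes of vertices with equal traces on the marked set, and merge the blocks in
each class. -/
def refineMerge : Stmt := .seq refine merge

theorem run_refineMerge {F K : ℕ} {s : State} {U : List ℕ} {f : ℕ → List ℕ}
    (hs : Working X F K s) (hb : HoldsBlocks X.n s U f) (hF : F + 1 + X.off X.n < 2 ^ X.w) :
    Run X.w refineMerge s (29 * X.n + 12 * X.off X.n + 19) fun s' =>
      Working X (F + 1 + X.off X.n) K s' ∧ ∃ (V : List ℕ) (g : ℕ → ℕ), (∀ v ∈ V, v ∈ U) ∧
        (V.map g).Nodup ∧ (∀ u ∈ U, ∃ v ∈ V, g v = g u) ∧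
        (∀ x < X.n, ∀ y < X.n, g x = g y ↔
          ∀ r < X.n, s.arr 3 r = s.reg 6 → (X.E x r ↔ X.E y r)) ∧
        HoldsBlocks X.n s' V (mergedBlock g U f) := by
  have hle := hs.fresh_le
  refine (Run.seq (run_refine hs.loaded (by omega) hs.target)
    fun s1 ⟨hs1, hge, hub, hn, hcls, heq⟩ =>
    (run_merge (hb.of_same hs1) fun x hx => ?_).weaken ?_).mono (by omega) fun _ h => h
  · rw [hs1.arr 6 (by decide)]
    exact hs.seen _ (hcls x hx).1
  · rintro s2 ⟨hs2, hseen, V, hV, hnd, hrep, hb2⟩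
    refine ⟨?_, V, s1.arr 4, hV, hnd, hrep, heq, hb2⟩
    have e5 := hs2.reg 5 (by decide)
    have hpos := hs.fresh_pos
    refine ⟨(hs.loaded.of_same hs1).of_same hs2, by omega, by omega, ?_, ?_, ?_, ?_, ?_, ?_⟩
    · rw [hs2.arr 5 (by decide), e5]; exact hn
    · intro c hc
      rw [hseen c fun x hx h => by have := (hcls x hx).2; omega, hs1.arr 6 (by decide)]
      exact hs.seen c (by omega)
    · rw [hs2.reg 6 (by decide), hs1.reg 6 (by decide)]; exact hs.key_le
    · rw [hs2.reg 6 (by decide), hs1.reg 6 (by decide), hs2.arr 3 (by decide),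
        hs1.arr 3 (by decide)]
      exact hs.mark_le
    · rw [hs2.arr 9 (by decide), hs1.arr 9 (by decide)]; exact hs.run_start
    · rw [hs2.arr 10 (by decide), hs1.arr 10 (by decide)]; exact hs.run_end

/-- Given a marked set, mark instead one vertex for each trace on this set, and merge blocks
according to the traces on the newly marked set. -/
def contract : Stmt :=
  .seq refine (.seq (.assign 6 (.op .add (.reg 6) (.lit 1))) (.seq markReps refineMerge))

/-- The linear bound is used twice: the representatives `A` have distinct traces on `M`, and the new
heads `V` have distinct traces on `A`. The classes of `g` are traces on `A`, so by symmetry of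
adjacency the neighborhood of each `a ∈ A` is constant on every class; for `x` take the
representative of its trace on `M`. -/
theorem run_contract {F K : ℕ} {s : State} {U : List ℕ} {f : ℕ → List ℕ} {M : Finset ℕ}
    (hs : Working X F K s) (hb : HoldsBlocks X.n s U f)
    (hF : F + 2 * (1 + X.off X.n) < 2 ^ X.w) (hK : K + 1 < 2 ^ X.w)
    (hM : ∀ v, s.arr 3 v = s.reg 6 ↔ v ∈ M) (hMn : ∀ v ∈ M, v < X.n) (hM0 : M.Nonempty) :
    Run X.w contract s (50 * X.n + 24 * X.off X.n + 40) fun s' =>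
      Working X (F + 2 * (1 + X.off X.n)) (K + 1) s' ∧ ∃ (V : List ℕ) (g : ℕ → ℕ),
        (∀ v ∈ V, v ∈ U) ∧ (V.map g).Nodup ∧ X.q * X.q * V.length ≤ X.p * X.p * M.card ∧
        (∀ x < X.n, ∃ a < X.n, (∀ r ∈ M, X.E x r ↔ X.E a r) ∧
          ∀ u < X.n, ∀ v < X.n, g u = g v → (X.E a u ↔ X.E a v)) ∧
        HoldsBlocks X.n s' V (mergedBlock g U f) := by
  have hle := hs.fresh_le
  have hw := X.n_lt
  have h1 : 1 % 2 ^ X.w = 1 := Nat.mod_eq_of_lt (by omega)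
  refine (Run.seq (run_refine hs.loaded (by omega) hs.target)
    fun s1 ⟨hs1, hge, hub, hn, hcls, heq⟩ =>
    Run.seq (R := fun s' => s' = s1.setReg 6 (s.reg 6 + 1)) (Run.assign ?_) fun s2 hs2 =>
    Run.seq (run_markReps (X := X) ?_ ?_ ?_) fun s3 ⟨hs3, hother, hle3, hex, hinj⟩ =>
    (run_refineMerge (F := F + 1 + X.off X.n) (K := K + 1) ?_ ((hb.of_same
      (R := [5, 6, 7, 8, 9, 10]) (A := [3, 4, 5, 6]) ?_)) (by omega)).weaken ?_).mono (by omega) fun _ h => h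
  · have := hs.key_le
    have : (s.reg 6 + 1) % 2 ^ X.w = s.reg 6 + 1 := Nat.mod_eq_of_lt (by omega)
    simp [Expr.eval, Op.apply, hs1.reg 6 (by decide), h1, this]
  · rw [hs2]
    exact hs.loaded.of_same (((hs1.mono (R' := [5, 6, 7, 8, 9, 10]) (by decide)
      (List.Subset.refl _))).setReg (by decide) _)
  · intro x hx
    rw [hs2]
    simp only [State.arr_setReg, hs1.arr 6 (by decide)]
    exact hs.seen _ (hcls x hx).1
  · intro v
    have := hs.mark_le v
    rw [hs2]
    simp [hs1.arr 3 (by decide)]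
    omega
  all_goals
    have hs12 : Same [5, 6, 7, 8, 9, 10] [4, 5] s s2 := by
      rw [hs2]
      exact (hs1.mono (by decide) (List.Subset.refl _)).setReg (by decide) _
    have hs13 : Same [5, 6, 7, 8, 9, 10] [3, 4, 5, 6] s s3 :=
      (hs12.mono (List.Subset.refl _) (by decide)).trans (hs3.mono (by decide) (by decide))
    have e4 : s2.arr 4 = s1.arr 4 := by rw [hs2]; rfl
    have e6 : s2.reg 6 = s.reg 6 + 1 := by rw [hs2]; simp
    have e6' : s3.reg 6 = s.reg 6 + 1 := by rw [hs3.reg 6 (by decide), e6]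
  · have e5 : s3.reg 5 = s1.reg 5 := by rw [hs3.reg 5 (by decide), hs2]; simp
    have hpos := hs.fresh_pos
    refine ⟨hs.loaded.of_same hs13, by omega, by omega, ?_, ?_, ?_, ?_, ?_, ?_⟩
    · rw [hs3.arr 5 (by decide), e5, hs2]; exact hn
    · intro c hc
      rw [hother c fun x hx h => by have := (hcls x hx).2; rw [e4] at h; omega,
        hs12.arr 6 (by decide)]
      exact hs.seen c (by omega)
    · rw [e6']; exact Nat.succ_le_succ hs.key_le
    · rw [e6', ← e6]; exact hle3
    · rw [hs13.arr 9 (by decide)]; exact hs.run_start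
    · rw [hs13.arr 10 (by decide)]; exact hs.run_end
  · exact hs13
  · rintro s4 ⟨hs4, V, g, hV, hnd, hrep, hg, hb4⟩
    refine ⟨hs4.mono (by omega) le_rfl, V, g, hV, hnd, ?_, ?_, hb4⟩
    · set A : Finset ℕ := (Finset.range X.n).filter fun a => s3.arr 3 a = s3.reg 6 with hA
      have hAn : ∀ a ∈ A, a < X.n := fun a ha => Finset.mem_range.1 (Finset.mem_filter.1 ha).1
      have hAm : ∀ a ∈ A, s3.arr 3 a = s2.reg 6 := fun a ha => by
        rw [e6, ← e6']; exact (Finset.mem_filter.1 ha).2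
      have h2 : X.q * A.card ≤ X.p * M.card := by
        refine X.traces M A hM0 hMn hAn fun x hx y hy hxy => ?_
        refine hinj x y (hAm x hx) (hAm y hy) ?_
        rw [e4, heq x (hAn x hx) y (hAn y hy)]
        exact fun r _ hr => hxy r ((hM r).1 hr)
      have hA0 : A.Nonempty := by
        obtain ⟨r, hr⟩ := hM0
        obtain ⟨a, ha, ha', -⟩ := hex r (hMn r hr)
        exact ⟨a, Finset.mem_filter.2 ⟨Finset.mem_range.2 ha, by rw [ha', e6, e6']⟩⟩
      have hVn : ∀ v ∈ V.toFinset, v < X.n := fun v hv => hb4.lt (List.mem_toFinset.1 hv)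
      have h3 : X.q * V.toFinset.card ≤ X.p * A.card := by
        refine X.traces A V.toFinset hA0 hAn hVn fun x hx y hy hxy => ?_
        refine List.inj_on_of_nodup_map hnd (List.mem_toFinset.1 hx) (List.mem_toFinset.1 hy) ?_
        rw [hg x (hVn x hx) y (hVn y hy)]
        exact fun r hr hr' => hxy r (Finset.mem_filter.2 ⟨Finset.mem_range.2 hr, hr'⟩)
      rw [List.toFinset_card_of_nodup hb4.nodup_heads] at h3
      calc X.q * X.q * V.length = X.q * (X.q * V.length) := by ring
        _ ≤ X.q * (X.p * A.card) := Nat.mul_le_mul_left _ h3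
        _ = X.p * (X.q * A.card) := by ring
        _ ≤ X.p * (X.p * M.card) := Nat.mul_le_mul_left _ h2
        _ = _ := by ring
    · intro x hx
      obtain ⟨a, ha, ham, hax⟩ := hex x hx
      refine ⟨a, ha, ?_, ?_⟩
      · rw [e4, heq a ha x hx] at hax
        exact fun r hr => (hax r (hMn r hr) ((hM r).2 hr)).symm
      · intro u hu v hv huv
        have := (hg u hu v hv).1 huv a ha (by rw [ham, e6, e6'])
        exact ⟨fun h => X.symm (this.1 (X.symm h)), fun h => X.symm (this.2 (X.symm h))⟩

/-! ### Random samples -/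

/-- Mark a random element of the list of vertices. -/
def sampleOne : Stmt :=
  .seq (.rand 10 (.op .sub (.reg 3) (.lit 1))) (.store 3 (.cell 2 (.reg 10)) (.reg 6))

/-- Mark as many random elements of the list of vertices as register 4 says. -/
def sampleLoop : Stmt :=
  .loop (.op .lt (.reg 7) (.reg 4)) (.seq sampleOne (.assign 7 (.op .add (.reg 7) (.lit 1))))

/-- After `j` random choices, the elements of `M` have been marked. -/
structure Sampled (s s' : State) (U : List ℕ) (j : ℕ) (M : Finset ℕ) : Prop where
  same : Same [7, 10] [3] s s'
  round : s'.reg 7 = j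
  mark : ∀ v, s'.arr 3 v = s.reg 6 ↔ v ∈ M
  mark_le : ∀ v, s'.arr 3 v ≤ s.reg 6
  mem : ∀ v ∈ M, v ∈ U
  card_le : M.card ≤ j
  nonempty : 0 < j → M.Nonempty

/-- Here `φ j M` bounds the failure probability when the first `j` draws have produced `M`. Its
average over the next draw does not exceed its present value, so its value before the first draw
bounds the overall failure. Draws may repeat, so only an upper bound on the size of `M` is kept. -/
theorem spec_sampleLoop {s : State} {U : List ℕ} {f : ℕ → List ℕ} {k T : ℕ} {K : List Stmt}
    {Q : State → Prop} (hb : HoldsBlocks X.n s U f) (hU : 0 < U.length) (h4 : s.reg 4 = k)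
    (hk : k < 2 ^ X.w) (φ : ℕ → Finset ℕ → ℝ) (hφ : ∀ j M, 0 ≤ φ j M)
    (hmart : ∀ j < k, ∀ M,
      (∑ r ∈ Finset.range U.length, φ (j + 1) (insert (U.getD r 0) M)) / U.length ≤ φ j M)
    (hend : ∀ s' M, Sampled s s' U k M → Spec X.w T (K, s') Q (φ k M)) {j : ℕ} (hj : j ≤ k)
    {s' : State} {M : Finset ℕ} (hs' : Sampled s s' U j M) :
    Spec X.w (T + 6 * (k - j) + 1) (sampleLoop :: K, s') Q (φ j M) := by
  have hw := X.n_lt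
  have hlen := hb.length_le
  have h1 : 1 % 2 ^ X.w = 1 := Nat.mod_eq_of_lt (by omega)
  induction hj using Nat.decreasingInduction generalizing s' M with
  | self =>
    refine (Spec.loop_zero ?_ (hend s' M hs')).mono (by omega) le_rfl
    simp [Expr.eval, Op.apply, hs'.round, hs'.same.reg 4 (by decide), h4]
  | of_succ j hj ih =>
    have e3 : s'.reg 3 = U.length := (hs'.same.reg 3 (by decide)).trans hb.count
    have hm : (Expr.op Op.sub (.reg 3) (.lit 1)).eval X.w s' = U.length - 1 := by
      simp only [Expr.eval, Op.apply, e3, h1]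
      exact Nat.mod_eq_of_lt (by omega)
    refine (Spec.loop_pos ?_ (Spec.seq (Spec.seq (Spec.rand hm
      (fun r => φ (j + 1) (insert (U.getD r 0) M)) (fun r => hφ _ _) fun r hr =>
      Spec.of_run (R := fun s2 => s2 = (s'.setReg 10 r).setCell 3 (U.getD r 0) (s.reg 6))
        (Run.store ?_) fun s2 hs2 => Spec.of_run (R := fun s3 => s3 = s2.setReg 7 (j + 1))
        (Run.assign ?_) fun s3 hs3 => ih (s' := s3) ?_)))).mono ?_ ?_
    · simp [Expr.eval, Op.apply, hs'.round, hs'.same.reg 4 (by decide), h4, hj, h1]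
    · have hr' : r < U.length := by omega
      simp [Expr.eval, hs'.same.arr 2 (by decide), hs'.same.reg 6 (by decide), hb.data r hr', hr']
    · have : (j + 1) % 2 ^ X.w = j + 1 := Nat.mod_eq_of_lt (by omega)
      simp [Expr.eval, Op.apply, hs2, hs'.round, h1, this]
    · have hr' : r < U.length := by omega
      rw [hs3, hs2]
      refine ⟨((hs'.same.setReg (by decide) _).setCell (by decide) _ _).setReg (by decide) _,
        by simp, ?_, ?_, ?_, ?_, fun _ => Finset.insert_nonempty _ _⟩
      · intro v
        simp only [State.arr_setReg, State.arr_setCell, if_true, Function.update_apply,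
          Finset.mem_insert, ← hs'.mark v]
        split_ifs with h
        · exact iff_of_true rfl (Or.inl h)
        · exact ⟨Or.inr, fun h' => h'.resolve_left h⟩
      · intro v
        simp only [State.arr_setReg, State.arr_setCell, if_true, Function.update_apply]
        split_ifs
        · rfl
        · exact hs'.mark_le v
      · intro v hv
        rcases Finset.mem_insert.1 hv with rfl | hv
        · rw [List.getD_eq_getElem _ _ hr']
          exact List.getElem_mem hr'
        · exact hs'.mem v hv
      · exact (Finset.card_insert_le _ _).trans (Nat.succ_le_succ hs'.card_le)
    · omega
    · refine le_trans (le_of_eq ?_) (hmart j hj M)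
      rw [Nat.sub_add_cancel hU]
      congr 1
      rw [← Nat.cast_add_one, Nat.sub_add_cancel hU]

section Martingale

variable (E : ℕ → ℕ → Prop) (U : List ℕ) (n k : ℕ) (t : ℝ)

open Classical in
/-- The number of elements of `U` on which the neighborhoods of `x` and `a` differ. -/
noncomputable def discrepancy (x a : ℕ) : ℕ := U.countP fun u => ¬ (E x u ↔ E a u)

open Classical in
/-- The expected number of pairs of vertices of discrepancy more than `t` that a random sample of
`k` elements does not distinguish, if the first `j` random choices gave the set `M`. -/
noncomputable def expectedBad (j : ℕ) (M : Finset ℕ) : ℝ :=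
  ∑ xa ∈ Finset.range n ×ˢ Finset.range n,
    if t < discrepancy E U xa.1 xa.2 ∧ ∀ r ∈ M, E xa.1 r ↔ E xa.2 r then
      (1 - (discrepancy E U xa.1 xa.2 : ℝ) / U.length) ^ (k - j) else 0

theorem discrepancy_le (x a : ℕ) : discrepancy E U x a ≤ U.length := List.countP_le_length

theorem one_sub_discrepancy_div_nonneg (x a : ℕ) :
    0 ≤ 1 - (discrepancy E U x a : ℝ) / U.length := by
  rw [sub_nonneg]
  exact div_le_one_of_le₀ (by exact_mod_cast discrepancy_le E U x a) (Nat.cast_nonneg _)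

theorem expectedBad_nonneg (j : ℕ) (M : Finset ℕ) : 0 ≤ expectedBad E U n k t j M := by
  refine Finset.sum_nonneg fun xa _ => ?_
  split_ifs
  · exact pow_nonneg (one_sub_discrepancy_div_nonneg E U _ _) _
  · exact le_rfl

open Classical in
theorem sum_agree_eq (x a : ℕ) :
    (∑ r ∈ Finset.range U.length, if E x (U.getD r 0) ↔ E a (U.getD r 0) then (1 : ℝ) else 0) =
      U.length - discrepancy E U x a := by
  induction U with
  | nil => simp [discrepancy]
  | cons u U ih =>
    rw [List.length_cons, Finset.sum_range_succ']
    simp only [List.getD_cons_succ, List.getD_cons_zero, ih, discrepancy, List.countP_cons]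
    by_cases h : E x u ↔ E a u <;> (simp [h]; try ring)

/-- A pair that is still undistinguished survives a uniform draw with probability 1 - d/N, the
factor that the smaller exponent has lost. A distinguished pair contributes zero from then on. -/
theorem expectedBad_step (hU : 0 < U.length) {j : ℕ} (hj : j < k) (M : Finset ℕ) :
    (∑ r ∈ Finset.range U.length, expectedBad E U n k t (j + 1) (insert (U.getD r 0) M)) /
      U.length ≤ expectedBad E U n k t j M := by
  classical
  have hU' : (0 : ℝ) < U.length := by exact_mod_cast hU
  unfold expectedBad
  rw [Finset.sum_comm, Finset.sum_div]
  refine Finset.sum_le_sum fun xa _ => ?_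
  by_cases h : t < discrepancy E U xa.1 xa.2 ∧ ∀ r ∈ M, E xa.1 r ↔ E xa.2 r
  · rw [if_pos h]
    have h1 : ∀ r, (if t < discrepancy E U xa.1 xa.2 ∧
        ∀ v ∈ insert (U.getD r 0) M, E xa.1 v ↔ E xa.2 v then
          (1 - (discrepancy E U xa.1 xa.2 : ℝ) / U.length) ^ (k - (j + 1)) else 0) =
        (1 - (discrepancy E U xa.1 xa.2 : ℝ) / U.length) ^ (k - (j + 1)) *
          if E xa.1 (U.getD r 0) ↔ E xa.2 (U.getD r 0) then 1 else 0 := by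
      intro r
      rw [mul_ite, mul_one, mul_zero]
      refine if_congr ?_ rfl rfl
      rw [Finset.forall_mem_insert]
      tauto
    simp only [h1]
    rw [← Finset.mul_sum, sum_agree_eq, show k - j = k - (j + 1) + 1 by omega, pow_succ,
      mul_div_assoc, sub_div, div_self hU'.ne']
  · rw [if_neg h]
    refine le_of_eq ?_
    rw [Finset.sum_eq_zero, zero_div]
    intro r _
    rw [if_neg]
    rintro ⟨h1, h2⟩
    exact h ⟨h1, fun v hv => h2 v (Finset.mem_insert_of_mem hv)⟩

/-- After the last draw the exponent is zero, so each surviving bad pair counts fully. -/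
theorem one_le_expectedBad {M : Finset ℕ} {x a : ℕ} (hx : x < n) (ha : a < n)
    (ht : t < discrepancy E U x a) (hM : ∀ r ∈ M, E x r ↔ E a r) :
    1 ≤ expectedBad E U n k t k M := by
  classical
  unfold expectedBad
  refine le_trans (le_of_eq ?_) (Finset.single_le_sum (f := fun xa : ℕ × ℕ =>
    if t < discrepancy E U xa.1 xa.2 ∧ ∀ r ∈ M, E xa.1 r ↔ E xa.2 r then
      (1 - (discrepancy E U xa.1 xa.2 : ℝ) / U.length) ^ (k - k) else 0) (fun xa _ => ?_)
      (show (x, a) ∈ _ by simp [hx, ha]))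
  · rw [if_pos ⟨ht, hM⟩, Nat.sub_self, pow_zero]
  · split_ifs <;> simp

theorem expectedBad_zero_le {ε : ℝ} (hε0 : 0 ≤ ε) (hn : 0 < n)
    (hε : ∀ d : ℕ, d ≤ U.length → t < d → (n : ℝ) * n * (1 - (d : ℝ) / U.length) ^ k ≤ ε)
    (M : Finset ℕ) : expectedBad E U n k t 0 M ≤ ε := by
  classical
  have hn' : (0 : ℝ) < n := by exact_mod_cast hn
  have h1 : ∀ xa ∈ Finset.range n ×ˢ Finset.range n,
      (if t < discrepancy E U xa.1 xa.2 ∧ ∀ r ∈ M, E xa.1 r ↔ E xa.2 r then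
      (1 - (discrepancy E U xa.1 xa.2 : ℝ) / U.length) ^ (k - 0) else 0) ≤ ε / (n * n) := by
    intro xa _
    split_ifs with h
    · rw [le_div_iff₀ (by positivity), mul_comm]
      exact hε _ (discrepancy_le E U _ _) h.1
    · positivity
  refine (Finset.sum_le_card_nsmul _ _ _ h1).trans (le_of_eq ?_)
  rw [Finset.card_product, Finset.card_range, nsmul_eq_mul]
  push_cast
  field_simp

end Martingale

/-! ### The phases -/

/-- The size of the sample for a list of `N` vertices. -/
def GraphData.rate (X : GraphData) (N : ℕ) : ℕ := N * X.q * X.q / (2 * X.p * X.p)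

/-- The size of the sample for the current list of vertices. -/
def rateExpr : Expr :=
  .op .div (.op .mul (.op .mul (.reg 3) (.reg 2)) (.reg 2))
    (.op .mul (.op .mul (.lit 2) (.reg 1)) (.reg 1))

theorem mul_mul_lt_two_pow {a b c m w : ℕ} (ha : a ≤ m) (hb : b ≤ m) (hc : c ≤ m) (hm : 2 ≤ m)
    (h : m ^ 4 ≤ 2 ^ w) : a * b * c < 2 ^ w := by
  have h1 : a * b * c ≤ m * m * m := Nat.mul_le_mul (Nat.mul_le_mul ha hb) hc
  have h2 : 0 < m * m * m := by positivity
  have h3 : m ^ 4 = m * m * m * m := by ring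
  nlinarith

theorem GraphData.rate_le (X : GraphData) (N : ℕ) : X.rate N ≤ N := by
  refine Nat.div_le_of_le_mul ?_
  have h := X.q_le_p
  calc N * X.q * X.q = X.q * X.q * N := by ring
    _ ≤ X.p * X.p * N := Nat.mul_le_mul_right _ (Nat.mul_le_mul h h)
    _ ≤ 2 * X.p * X.p * N := Nat.mul_le_mul_right _ (by nlinarith)

theorem eval_rateExpr {s : State} {N : ℕ} (hs : X.Loaded s) (h3 : s.reg 3 = N) (hN : N ≤ X.n) :
    rateExpr.eval X.w s = X.rate N := by
  have hw := X.n_lt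
  have h2 : 2 % 2 ^ X.w = 2 := Nat.mod_eq_of_lt (by omega)
  have hp := X.p_pos
  have hq := X.q_pos
  set m := X.n + X.p + X.q + 2 with hm
  have e1 : N * X.q * X.q < 2 ^ X.w :=
    mul_mul_lt_two_pow (m := m) (by omega) (by omega) (by omega) (by omega) X.word
  have e2 : N * X.q < 2 ^ X.w := by
    simpa using mul_mul_lt_two_pow (m := m) (a := N) (b := X.q) (c := 1) (by omega) (by omega)
      (by omega) (by omega) X.word
  have e3 : 2 * X.p * X.p < 2 ^ X.w :=
    mul_mul_lt_two_pow (m := m) (by omega) (by omega) (by omega) (by omega) X.word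
  have e4 : 2 * X.p < 2 ^ X.w := by
    simpa using mul_mul_lt_two_pow (m := m) (a := 2) (b := X.p) (c := 1) (by omega) (by omega)
      (by omega) (by omega) X.word
  have e5 : N * X.q * X.q / (2 * X.p * X.p) < 2 ^ X.w := (Nat.div_le_self _ _).trans_lt e1
  simp only [rateExpr, Expr.eval, Op.apply, h3, hs.reg1, hs.reg2, h2, Nat.mod_eq_of_lt e1,
    Nat.mod_eq_of_lt e2, Nat.mod_eq_of_lt e3, Nat.mod_eq_of_lt e4, Nat.mod_eq_of_lt e5,
    GraphData.rate]

/-- The memory after `i` phases. -/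
structure PhaseInv (X : GraphData) (i : ℕ) (s : State) (U : List ℕ) (f : ℕ → List ℕ) : Prop where
  working : Working X (1 + 2 * i * (1 + X.off X.n)) (2 * i) s
  blocks : HoldsBlocks X.n s U f
  size : U.length * 2 ^ i ≤ X.n
  le : i ≤ X.n

/-- After `i` phases, each neighborhood has few changes in the blocks. -/
def LowCrossing (X : GraphData) (t : ℝ) (i : ℕ) (U : List ℕ) (f : ℕ → List ℕ) : Prop :=
  ∀ x < X.n, ((U.map fun u => cyclicChanges (X.E x) (f u)).sum : ℝ) ≤ 2 * t * i

/-- One phase: draw a random sample and contract it. -/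
def phase : Stmt :=
  .seq (.assign 4 rateExpr)
    (.seq (.assign 6 (.op .add (.reg 6) (.lit 1)))
      (.seq (.assign 7 (.lit 0)) (.seq sampleLoop contract)))

/-- The neighborhood of `a` is constant on the classes and differs from that of `x` on at most `t`
heads, so merging adds at most `2 * t` changes. -/
theorem LowCrossing.merge {t : ℝ} {i : ℕ} {U V : List ℕ} {f : ℕ → List ℕ} {s : State}
    (h : LowCrossing X t i U f) (hb : HoldsBlocks X.n s U f) {g : ℕ → ℕ} (hV : ∀ v ∈ V, v ∈ U)
    (hnd : (V.map g).Nodup)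
    (hx : ∀ x < X.n, ∃ a < X.n, (discrepancy X.E U x a : ℝ) ≤ t ∧
      ∀ u < X.n, ∀ v < X.n, g u = g v → (X.E a u ↔ X.E a v)) :
    LowCrossing X t (i + 1) V (mergedBlock g U f) := by
  classical
  intro x hxn
  obtain ⟨a, ha, hd, hg⟩ := hx x hxn
  have h1 := sum_cyclicChanges_merge_le (X.E x) g f V U hnd (fun u hu => (hb.block u hu).head)
    (X.E a) fun v hv u hu huv => hg u (hb.lt hu) v (hb.lt (hV v hv)) huv
  have h2 : ((V.map fun v => cyclicChanges (X.E x) (mergedBlock g U f v)).sum : ℝ) ≤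
      (U.map fun u => cyclicChanges (X.E x) (f u)).sum + 2 * discrepancy X.E U x a := by
    have h3 : discrepancy X.E U x a = U.countP fun u => ¬ (X.E x u ↔ X.E a u) := by
      unfold discrepancy
      congr!
    rw [h3]
    exact_mod_cast h1
  have h3 := h x hxn
  rw [Nat.cast_add_one]
  linarith

/-- Two bounds are carried along. The one with failure probability 1 concerns time only and is
needed because even a run with a bad sample must halt in time. The other adds the chance `ε` of a
bad sample to the failure probability `δ` of the remaining program. -/
theorem spec_phase {t ε δ : ℝ} {i T : ℕ} {s : State} {U : List ℕ} {f : ℕ → List ℕ}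
    {K : List Stmt} {Q : State → Prop} (h : PhaseInv X i s U f) (hk : 8 ≤ X.rate U.length)
    (hε0 : 0 ≤ ε) (hδ0 : 0 ≤ δ)
    (hε : ∀ d : ℕ, d ≤ U.length → t < d →
      (X.n : ℝ) * X.n * (1 - (d : ℝ) / U.length) ^ X.rate U.length ≤ ε)
    (hend : ∀ s' V f', PhaseInv X (i + 1) s' V f' → Spec X.w T (K, s') Q 1 ∧
      (LowCrossing X t (i + 1) V f' → Spec X.w T (K, s') Q δ)) :
    Spec X.w (T + (56 * X.n + 24 * X.off X.n + 60)) (phase :: K, s) Q 1 ∧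
      (LowCrossing X t i U f →
        Spec X.w (T + (56 * X.n + 24 * X.off X.n + 60)) (phase :: K, s) Q (ε + δ)) := by
  classical
  have hw := X.n_lt
  have h1 : 1 % 2 ^ X.w = 1 := Nat.mod_eq_of_lt (by omega)
  have hN : U.length ≤ X.n := h.blocks.length_le
  have hkN := X.rate_le U.length
  set k := X.rate U.length with hkdef
  have hU : 0 < U.length := by omega
  -- At least 8 blocks are left, so `i < 2 ^ i ≤ n`. This bounds the number of phases, and with it
  -- the class numbers and keys, on every run.
  have hin : i + 1 ≤ X.n := by
    have h2 := h.size
    have h3 : i < 2 ^ i := Nat.lt_two_pow_self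
    nlinarith
  have hkey := h.working.key_le
  have hbound : 1 + 2 * (i + 1) * (1 + X.off X.n) < 2 ^ X.w := by
    refine lt_of_le_of_lt ?_ X.poly_lt
    have h2 : (i + 1) * (1 + X.off X.n) ≤ X.n * (1 + X.n * X.n) :=
      Nat.mul_le_mul hin (Nat.add_le_add_left X.off_le 1)
    have h3 : X.n ^ 3 = X.n * (X.n * X.n) := by ring
    rw [h3]
    nlinarith
  have hkeylt : s.reg 6 + 1 < 2 ^ X.w := by
    have := X.off_lt
    nlinarith
  have main : ∀ (φ : ℕ → Finset ℕ → ℝ), (∀ j M, 0 ≤ φ j M) →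
      (∀ j < k, ∀ M, (∑ r ∈ Finset.range U.length, φ (j + 1) (insert (U.getD r 0) M)) /
        U.length ≤ φ j M) →
      (∀ M, 1 ≤ φ k M ∨ (δ ≤ φ k M ∧ LowCrossing X t i U f ∧ ∀ x < X.n, ∀ a < X.n,
        (∀ r ∈ M, X.E x r ↔ X.E a r) → (discrepancy X.E U x a : ℝ) ≤ t)) →
      Spec X.w (T + (56 * X.n + 24 * X.off X.n + 60)) (phase :: K, s) Q (φ 0 ∅) := by
    intro φ hφ hmart hgood
    refine (Spec.seq (Spec.of_run (R := fun s' => s' = s.setReg 4 k) (Run.assign ?_)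
      fun s1 hs1 => Spec.seq (Spec.of_run (R := fun s' => s' = s1.setReg 6 (s.reg 6 + 1))
      (Run.assign ?_) fun s2 hs2 => Spec.seq (Spec.of_run (R := fun s' => s' = s2.setReg 7 0)
      (Run.assign ?_) fun s3 hs3 => Spec.seq (spec_sampleLoop (X := X) (s := s3) (j := 0)
      (f := f) (k := k) (T := 50 * X.n + 24 * X.off X.n + 40 + T) ?_ hU ?_ (by omega) φ hφ hmart
      ?_ (Nat.zero_le _) ?_))))).mono (by omega) le_rfl
    · rw [eval_rateExpr h.working.loaded h.blocks.count hN]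
    · rw [hs1]
      simp [Expr.eval, Op.apply, h1, Nat.mod_eq_of_lt hkeylt]
    · simp [Expr.eval]
    all_goals
      have hs03 : Same [4, 6, 7] [] s s3 := by
        rw [hs3, hs2, hs1]
        exact (((Same.refl _ _ _).setReg (by decide) _).setReg (by decide) _).setReg (by decide) _
      have e6 : s3.reg 6 = s.reg 6 + 1 := by rw [hs3, hs2]; simp
    · exact h.blocks.of_same hs03
    · rw [hs3, hs2, hs1]; simp
    · intro s' M hM
      have hs0 : Same [4, 6, 7, 10] [3] s s' :=
        (hs03.mono (by decide) (by decide)).trans (hM.same.mono (by decide) (by decide))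
      have e5' : s'.reg 5 = s.reg 5 := hs0.reg 5 (by decide)
      have e6' : s'.reg 6 = s.reg 6 + 1 := (hM.same.reg 6 (by decide)).trans e6
      have hwork : Working X (1 + 2 * i * (1 + X.off X.n)) (2 * i + 1) s' := by
        refine ⟨h.working.loaded.of_same hs0, ?_, ?_, ?_, ?_, by omega, ?_, ?_, ?_⟩
        · rw [e5']; exact h.working.fresh_pos
        · rw [e5']; exact h.working.fresh_le
        · rw [e5', hs0.arr 5 (by decide)]; exact h.working.target
        · rw [e5', hs0.arr 6 (by decide)]; exact h.working.seen
        · rw [e6', ← e6]; exact hM.mark_le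
        · rw [hs0.arr 9 (by decide)]; exact h.working.run_start
        · rw [hs0.arr 10 (by decide)]; exact h.working.run_end
      refine Spec.of_run (run_contract (M := M) hwork (h.blocks.of_same hs0) ?_ ?_ ?_ ?_ ?_) ?_
      · rw [show 1 + 2 * i * (1 + X.off X.n) + 2 * (1 + X.off X.n) =
          1 + 2 * (i + 1) * (1 + X.off X.n) by ring]
        exact hbound
      · nlinarith
      · rw [e6', ← e6]; exact hM.mark
      · exact fun v hv => h.blocks.lt (hM.mem v hv)
      · exact hM.nonempty (by omega)
      · rintro s4 ⟨hs4, V, g, hV, hnd, hcard, hx, hb4⟩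
        -- The factor 2 in the denominator of the sampling rate is there to halve the number of
        -- blocks.
        have hV2 : 2 * V.length ≤ U.length := by
          have h2 : k * (2 * X.p * X.p) ≤ U.length * X.q * X.q := Nat.div_mul_le_self _ _
          have h3 : X.p * X.p * M.card ≤ X.p * X.p * k := Nat.mul_le_mul_left _ hM.card_le
          have h4 : 0 < X.q * X.q := Nat.mul_pos X.q_pos X.q_pos
          refine (Nat.mul_le_mul_left_iff h4).1 ?_
          calc X.q * X.q * (2 * V.length) = 2 * (X.q * X.q * V.length) := by ring
            _ ≤ 2 * (X.p * X.p * k) := Nat.mul_le_mul_left _ (hcard.trans h3)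
            _ = k * (2 * X.p * X.p) := by ring
            _ ≤ U.length * X.q * X.q := h2
            _ = _ := by ring
        have hinv : PhaseInv X (i + 1) s4 V (mergedBlock g U f) := by
          refine ⟨hs4.mono (le_of_eq (by ring)) (by omega), hb4, ?_, hin⟩
          calc V.length * 2 ^ (i + 1) = 2 * V.length * 2 ^ i := by ring
            _ ≤ U.length * 2 ^ i := Nat.mul_le_mul_right _ hV2
            _ ≤ X.n := h.size
        obtain ⟨hS1, hS2⟩ := hend s4 V _ hinv
        rcases hgood M with hM1 | ⟨hM1, hlow, hd⟩
        · exact hS1.mono le_rfl hM1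
        · refine (hS2 (hlow.merge h.blocks hV hnd fun x hxn => ?_)).mono le_rfl hM1
          obtain ⟨a, ha, hax, hga⟩ := hx x hxn
          exact ⟨a, ha, hd x hxn a ha hax, hga⟩
    · refine ⟨Same.refl _ _ _, by rw [hs3]; simp, ?_, ?_, by simp, by simp, by simp⟩
      · intro v
        have := h.working.mark_le v
        rw [hs03.arr 3 (by decide), e6]
        simp
        omega
      · intro v
        have := h.working.mark_le v
        rw [hs03.arr 3 (by decide), e6]
        omega
  have hUR : (U.length : ℝ) ≠ 0 := by positivity
  -- The constant potential 1 gives halting; the expected number of surviving bad pairs, plus `δ`,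
  -- gives the probability bound.
  refine ⟨main (fun _ _ => 1) (by simp) (by simp [hUR]) (by simp), fun hlow => ?_⟩
  refine (main (fun j M => expectedBad X.E U X.n k t j M + δ) ?_ ?_ ?_).mono le_rfl ?_
  · exact fun j M => add_nonneg (expectedBad_nonneg _ _ _ _ _ _ _) hδ0
  · intro j hj M
    rw [Finset.sum_add_distrib, add_div]
    refine add_le_add (expectedBad_step _ _ _ _ _ hU hj M) (le_of_eq ?_)
    simp [hUR]
  · intro M
    by_cases hg : ∀ x < X.n, ∀ a < X.n,
        (∀ r ∈ M, X.E x r ↔ X.E a r) → (discrepancy X.E U x a : ℝ) ≤ t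
    · exact Or.inr ⟨le_add_of_nonneg_left (expectedBad_nonneg _ _ _ _ _ _ _), hlow, hg⟩
    · push Not at hg
      obtain ⟨x, hx, a, ha, hM, hd⟩ := hg
      left
      have := one_le_expectedBad X.E U X.n k t hx ha hd hM
      linarith
  · exact add_le_add_left (expectedBad_zero_le X.E U X.n k t hε0 (by omega) hε ∅) δ

/-- All phases. -/
def phases : Stmt := .loop (.op .lt (.lit 7) rateExpr) phase

theorem spec_phases {t ε : ℝ} {L i T : ℕ} {s : State} {U : List ℕ} {f : ℕ → List ℕ}
    {K : List Stmt} {Q : State → Prop} (hL : X.n < 2 ^ (L + 1)) (hε0 : 0 ≤ ε)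
    (hε : ∀ N d : ℕ, N ≤ X.n → d ≤ N → t < d → 8 ≤ X.rate N →
      (X.n : ℝ) * X.n * (1 - (d : ℝ) / N) ^ X.rate N ≤ ε)
    (hend : ∀ i s' V f', i ≤ L → PhaseInv X i s' V f' → X.rate V.length < 8 →
      Spec X.w T (K, s') Q 1 ∧ (LowCrossing X t i V f' → Spec X.w T (K, s') Q 0))
    (hi : i ≤ L) (h : PhaseInv X i s U f) :
    Spec X.w (T + (L - i) * (56 * X.n + 24 * X.off X.n + 61) + 1) (phases :: K, s) Q 1 ∧
      (LowCrossing X t i U f →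
        Spec X.w (T + (L - i) * (56 * X.n + 24 * X.off X.n + 61) + 1) (phases :: K, s) Q
          (ε * (L - i : ℕ))) := by
  have hw := X.n_lt
  have h7 : 7 % 2 ^ X.w = 7 := Nat.mod_eq_of_lt (by omega)
  have h1 : 1 % 2 ^ X.w = 1 := Nat.mod_eq_of_lt (by omega)
  have final : ∀ i s U f, i ≤ L → PhaseInv X i s U f → X.rate U.length < 8 →
      Spec X.w (T + (L - i) * (56 * X.n + 24 * X.off X.n + 61) + 1) (phases :: K, s) Q 1 ∧
      (LowCrossing X t i U f →
        Spec X.w (T + (L - i) * (56 * X.n + 24 * X.off X.n + 61) + 1) (phases :: K, s) Q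
          (ε * (L - i : ℕ))) := by
    intro i s U f hi h hk
    have he : (Expr.op Op.lt (.lit 7) rateExpr).eval X.w s = 0 := by
      simp only [Expr.eval, Op.apply,
        eval_rateExpr h.working.loaded h.blocks.count h.blocks.length_le, h7]
      rw [if_neg (by omega), Nat.zero_mod]
    obtain ⟨hS1, hS2⟩ := hend i s U f hi h hk
    refine ⟨(Spec.loop_zero he hS1).mono (by omega) le_rfl, fun hlow => ?_⟩
    exact (Spec.loop_zero he (hS2 hlow)).mono (by omega) (by positivity)
  induction hi using Nat.decreasingInduction generalizing s U f with
  | self =>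
    -- Since the number of blocks times `2 ^ L` is at most `n < 2 ^ (L + 1)`, at most one block is
    -- left, too few for another phase.
    refine final L s U f le_rfl h ?_
    by_contra hk
    have h2 := h.size
    have h3 := X.rate_le U.length
    have h4 : 8 * 2 ^ L ≤ U.length * 2 ^ L := Nat.mul_le_mul_right _ (by omega)
    rw [pow_succ] at hL
    omega
  | of_succ i hi ih =>
    by_cases hk : X.rate U.length < 8
    · exact final i s U f hi.le h hk
    · have he : (Expr.op Op.lt (.lit 7) rateExpr).eval X.w s ≠ 0 := by
        simp only [Expr.eval, Op.apply,
          eval_rateExpr h.working.loaded h.blocks.count h.blocks.length_le, h7]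
        rw [if_pos (by omega), h1]
        exact one_ne_zero
      have hLi : (L - i : ℕ) = (L - (i + 1)) + 1 := by omega
      obtain ⟨hS1, hS2⟩ := spec_phase (t := t) (ε := ε) (δ := ε * (L - (i + 1) : ℕ)) h (by omega)
        hε0 (by positivity) (fun d hd htd => hε _ d h.blocks.length_le hd htd (by omega))
        fun s' V f' h' => ih h'
      rw [hLi, Nat.succ_mul]
      refine ⟨(Spec.loop_pos he hS1).mono (by omega) le_rfl, fun hlow => ?_⟩
      refine (Spec.loop_pos he (hS2 hlow)).mono (by omega) (le_of_eq ?_)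
      push_cast
      ring

/-! ### Merging all remaining blocks -/

/-- Merge all blocks into one. -/
def finish : Stmt := .seq (.assign 6 (.op .add (.reg 6) (.lit 1))) refineMerge

/-- The memory holds a linked list of all vertices. -/
structure HoldsOrder (X : GraphData) (s : State) (ord : List ℕ) : Prop where
  loaded : X.Loaded s
  run_start : ∀ z, s.arr 9 z = 0
  run_end : ∀ z, s.arr 10 z = 0
  nodup : ord.Nodup
  mem : ∀ v, v ∈ ord ↔ v < X.n
  head : ∀ a l, ord = a :: l → s.arr 2 0 = a
  chain : ord.IsChain fun a b => s.arr 7 a = b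

/-- With the increased key no vertex is marked. All traces are empty, so there is a single class,
and its blocks are joined in the order of `U`. -/
theorem run_finish {i : ℕ} {s : State} {U : List ℕ} {f : ℕ → List ℕ}
    (h : PhaseInv X i s U f) :
    Run X.w finish s (29 * X.n + 12 * X.off X.n + 21) fun s' =>
      HoldsOrder X s' (U.flatMap f) := by
  have hw := X.n_lt
  have h1 : 1 % 2 ^ X.w = 1 := Nat.mod_eq_of_lt (by omega)
  have hkey := h.working.key_le
  have hi := h.le
  have hF : 1 + 2 * i * (1 + X.off X.n) + 1 + X.off X.n < 2 ^ X.w := by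
    refine lt_of_le_of_lt ?_ X.poly_lt
    have h2 : i * (1 + X.off X.n) ≤ X.n * (1 + X.n * X.n) :=
      Nat.mul_le_mul hi (Nat.add_le_add_left X.off_le 1)
    have h3 : X.n ^ 3 = X.n * (X.n * X.n) := by ring
    have h4 := X.off_le
    rw [h3]
    nlinarith
  have hkeylt : s.reg 6 + 1 < 2 ^ X.w := by
    have := X.poly_lt
    nlinarith [Nat.zero_le (X.n ^ 3), Nat.zero_le (X.n ^ 2)]
  refine (Run.seq (R := fun s' => s' = s.setReg 6 (s.reg 6 + 1)) (Run.assign ?_) fun s1 hs1 =>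
    (run_refineMerge (F := 1 + 2 * i * (1 + X.off X.n)) (K := 2 * i + 1) ?_
      (h.blocks.of_same (R := [6]) (A := []) ?_) hF).weaken ?_).mono (by omega) fun _ h => h
  · simp [Expr.eval, Op.apply, h1, Nat.mod_eq_of_lt hkeylt]
  all_goals
    have hs01 : Same [6] [] s s1 := by
      rw [hs1]
      exact (Same.refl _ _ _).setReg (by decide) _
    have e6 : s1.reg 6 = s.reg 6 + 1 := by rw [hs1]; simp
  · refine ⟨h.working.loaded.of_same hs01, ?_, ?_, ?_, ?_, by omega, ?_, ?_, ?_⟩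
    · rw [hs01.reg 5 (by decide)]; exact h.working.fresh_pos
    · rw [hs01.reg 5 (by decide)]; exact h.working.fresh_le
    · rw [hs01.reg 5 (by decide), hs01.arr 5 (by decide)]; exact h.working.target
    · rw [hs01.reg 5 (by decide), hs01.arr 6 (by decide)]; exact h.working.seen
    · rw [e6, hs01.arr 3 (by decide)]
      exact fun v => (h.working.mark_le v).trans (Nat.le_succ _)
    · rw [hs01.arr 9 (by decide)]; exact h.working.run_start
    · rw [hs01.arr 10 (by decide)]; exact h.working.run_end
  · exact hs01
  · rintro s' ⟨hs', V, g, hV, hnd, hrep, hg, hb⟩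
    have hgc : ∀ x < X.n, ∀ y < X.n, g x = g y := by
      intro x hx y hy
      rw [hg x hx y hy]
      intro r _ hr
      have := h.working.mark_le r
      rw [e6, hs01.arr 3 (by decide)] at hr
      omega
    have hVblock : ∀ v ∈ V, mergedBlock g U f v = U.flatMap f := by
      intro v hv
      rw [mergedBlock, List.filter_eq_self.2]
      intro u hu
      simpa using hgc u (h.blocks.lt hu) v (hb.lt hv)
    refine ⟨hs'.loaded, hs'.run_start, hs'.run_end, h.blocks.nodup, h.blocks.mem, ?_, ?_⟩
    · intro a l hal
      cases V with
      | nil =>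
        cases U with
        | nil => simp at hal
        | cons u U => simpa using hrep u (by simp)
      | cons v V =>
        obtain ⟨t, ht⟩ := (hb.block v (by simp)).head
        rw [hVblock v (by simp), hal] at ht
        rw [hb.data 0 (by simp)]
        simpa using (List.cons.inj ht).1.symm
    · cases V with
      | nil =>
        cases U with
        | nil => simp
        | cons u U => simpa using hrep u (by simp)
      | cons v V =>
        rw [← hVblock v (by simp)]
        exact (hb.block v (by simp)).chain

/-! ### Stored lists -/

/-- The array `a` starts with the list `l`. -/
def Stores (a : ℕ → ℕ) (l : List ℕ) : Prop := ∀ (j : ℕ) (h : j < l.length), a j = l[j]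

theorem Stores.append_singleton {a : ℕ → ℕ} {l : List ℕ} (h : Stores a l) (v : ℕ) :
    Stores (Function.update a l.length v) (l ++ [v]) := by
  intro j hj
  rw [Function.update_apply]
  simp only [List.length_append, List.length_singleton] at hj
  split_ifs with hjl
  · simp [hjl]
  · rw [List.getElem_append_left (by omega)]
    exact h j (by omega)

/-! ### Computing the clusters -/

/-- Update the runs of the neighbor at the position given by register 8. -/
def scanOne : Stmt :=
  .seq (.assign 10 (.cell 1 (.reg 8)))
    (.seq (.branch (.op .eq (.cell 10 (.reg 10)) (.reg 7)) .skip (.store 9 (.reg 10) (.reg 7)))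
      (.seq (.store 10 (.reg 10) (.op .add (.reg 7) (.lit 1)))
        (.branch (.op .lt (.cell 9 (.reg 10)) (.reg 15)) (.assign 16 (.lit 1)) .skip)))

/-- Update the runs of all neighbors of the vertex in register 17, and find out whether the current
interval can be extended by this vertex. -/
def scan : Stmt :=
  .seq (.assign 16 (.lit 0))
    (.forLoop 8 (.cell 0 (.reg 17)) (.cell 0 (.op .add (.reg 17) (.lit 1))) scanOne)

/-- Arrays 9 and 10 hold, for each `z`, the start and the end of the latest run of consecutive
vertices adjacent to `z`. Meeting `z` at position `i` prolongs a run that ends at `i` and otherwise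
starts a new one. Register 15 is one more than the start of the current interval, so the strict
comparison asks whether the run covers that interval. -/
theorem run_scan {s : State} (hX : X.Loaded s) {u i : ℕ} (hu : u < X.n) (h17 : s.reg 17 = u)
    (h7 : s.reg 7 = i) (hi : i < X.n) :
    Run X.w scan s (15 * (X.off (u + 1) - X.off u) + 5) fun s' =>
      Same [8, 10, 16] [9, 10] s s' ∧
      (∀ z, X.E u z → s'.arr 10 z = i + 1 ∧
        s'.arr 9 z = if s.arr 10 z = i then s.arr 9 z else i) ∧
      (∀ z, ¬ X.E u z → s'.arr 10 z = s.arr 10 z) ∧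
      (s'.reg 16 = 0 ↔ ¬ ∃ z, X.E u z ∧ s'.arr 9 z < s.reg 15) := by
  have hw := X.n_lt
  have h1 : 1 % 2 ^ X.w = 1 := Nat.mod_eq_of_lt (by omega)
  have hle := X.off_mono u hu
  have hlt := X.off_le_off (show u + 1 ≤ X.n by omega) le_rfl
  have hlt' := X.off_lt
  have hu1 : (u + 1) % 2 ^ X.w = u + 1 := Nat.mod_eq_of_lt (by omega)
  have hi1 : (i + 1) % 2 ^ X.w = i + 1 := Nat.mod_eq_of_lt (by omega)
  refine (Run.seq (R := fun s' => s' = s.setReg 16 0) (Run.assign (by simp [Expr.eval]))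
    fun s1 hs1 => Run.forLoop (w := X.w) (fun j s' => Same [8, 10, 16] [9, 10] s s' ∧
      (∀ z, (∃ j', X.off u ≤ j' ∧ j' < j ∧ X.dat j' = z) → s'.arr 10 z = i + 1 ∧
        s'.arr 9 z = if s.arr 10 z = i then s.arr 9 z else i) ∧
      (∀ z, (¬ ∃ j', X.off u ≤ j' ∧ j' < j ∧ X.dat j' = z) →
        s'.arr 10 z = s.arr 10 z ∧ s'.arr 9 z = s.arr 9 z) ∧
      (s'.reg 16 = 0 ↔ ¬ ∃ z, (∃ j', X.off u ≤ j' ∧ j' < j ∧ X.dat j' = z) ∧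
        s'.arr 9 z < s.reg 15))
      (fun _ => scanOne.size) hle (by omega) ?_ ?_ ?_ ?_).mono ?_ ?_
  · simp [Expr.eval, hs1, h17, hX.arr0]
  · rw [hs1]
    have hno : ∀ z, ¬ ∃ j', X.off u ≤ j' ∧ j' < X.off u ∧ X.dat j' = z := by
      rintro z ⟨j', h, h', -⟩
      omega
    refine ⟨((Same.refl _ _ _).setReg (by decide) _).setReg (by decide) _,
      fun z hz => absurd hz (hno z), by simp, ?_⟩
    simp only [hno, false_and, exists_false, not_false_iff, iff_true]
    simp
  · rintro j s' ⟨hs, -⟩ -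
    simp [Expr.eval, Op.apply, hs.reg 17 (by decide), hs.arr 0 (by decide), h17, hX.arr0, h1, hu1]
  · rintro j hj1 hj2 s' hj' ⟨hs, hZ, hnZ, hf⟩
    refine Run.straight (by simp [scanOne, Stmt.IsStraight]) ?_
    have hnew : ¬ ∃ j', X.off u ≤ j' ∧ j' < j ∧ X.dat j' = X.dat j := by
      rintro ⟨j', h, h', he⟩
      have := X.inj u hu j' j h (by omega) hj1 hj2 he
      omega
    have e1 : s'.arr 1 = X.dat := by rw [hs.arr 1 (by decide)]; exact hX.arr1
    have e7 : s'.reg 7 = i := by rw [hs.reg 7 (by decide), h7]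
    have e15 : s'.reg 15 = s.reg 15 := hs.reg 15 (by decide)
    obtain ⟨hz10, hz9⟩ := hnZ _ hnew
    set z0 := X.dat j with hz0
    set b := if s.arr 10 z0 = i then s.arr 9 z0 else i with hb
    have he : ∃ s2 : State, (scanOne.exec X.w s' = s2) ∧ Same [8, 10, 16] [9, 10] s s2 ∧
        s2.reg 8 = j ∧ s2.arr 10 = Function.update (s'.arr 10) z0 (i + 1) ∧
        s2.arr 9 = Function.update (s'.arr 9) z0 b ∧
        s2.reg 16 = if b < s.reg 15 then 1 else s'.reg 16 := by
      refine ⟨_, rfl, ?_⟩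
      by_cases hc : s.arr 10 z0 = i <;> by_cases hd : b < s.reg 15 <;>
        simp only [hb, hc, if_true, if_false] at hd <;>
        simp only [scanOne, Stmt.exec, Expr.eval, Op.apply, State.arr_setReg, State.arr_setCell,
          State.reg_setReg, State.reg_setCell, e1, hj', e7, e15, ← hz0, hz10, hz9, hc, hd, hb, h1,
          hi1, if_true, if_false, one_ne_zero, Nat.reduceEqDiff, Nat.zero_mod,
          Function.update_self] <;>
        refine ⟨?_, ?_⟩
      · exact (((hs.setReg (by decide) _).setCell (by decide) _ _).setReg (by decide) _)
      · simp [← hz9]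
      · exact ((hs.setReg (by decide) _).setCell (by decide) _ _)
      · simp [← hz9]
      · exact ((((hs.setReg (by decide) _).setCell (by decide) _ _).setCell (by decide) _ _).setReg
          (by decide) _)
      · simp
      · exact (((hs.setReg (by decide) _).setCell (by decide) _ _).setCell (by decide) _ _)
      · simp
    obtain ⟨s2, he, hs2, h8, h10, h9, h16⟩ := he
    rw [he]
    have hiff : ∀ z, (∃ j', X.off u ≤ j' ∧ j' < j + 1 ∧ X.dat j' = z) ↔
        z = z0 ∨ ∃ j', X.off u ≤ j' ∧ j' < j ∧ X.dat j' = z := by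
      intro z
      constructor
      · rintro ⟨j', h, h', h''⟩
        rcases Nat.lt_succ_iff_lt_or_eq.1 h' with h' | rfl
        · exact Or.inr ⟨j', h, h', h''⟩
        · exact Or.inl h''.symm
      · rintro (rfl | ⟨j', h, h', h''⟩)
        · exact ⟨j, hj1, by omega, rfl⟩
        · exact ⟨j', h, by omega, h''⟩
    refine ⟨h8, hs2.setReg (by decide) _, ?_, ?_, ?_⟩
    · intro z hz
      simp only [State.arr_setReg, h10, h9, Function.update_apply]
      by_cases hzz : z = z0
      · simp [hzz, hb]
      · simp only [hzz, if_false]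
        exact hZ z (((hiff z).1 hz).resolve_left hzz)
    · intro z hz
      rw [hiff, not_or] at hz
      simp only [State.arr_setReg, h10, h9, Function.update_apply, hz.1, if_false]
      exact hnZ z hz.2
    · simp only [hiff, State.arr_setReg, State.reg_setReg, Nat.reduceEqDiff, if_false, h9, h16]
      by_cases hd : b < s.reg 15
      · rw [if_pos hd]
        refine iff_of_false one_ne_zero (not_not.2 ⟨z0, Or.inl rfl, ?_⟩)
        rwa [Function.update_self]
      · rw [if_neg hd, hf, not_iff_not]
        constructor
        · rintro ⟨z, hz, hz'⟩
          have hzz : z ≠ z0 := by rintro rfl; exact hnew hz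
          exact ⟨z, Or.inr hz, by rwa [Function.update_of_ne hzz]⟩
        · rintro ⟨z, rfl | hz, hz'⟩
          · rw [Function.update_self] at hz'
            exact absurd hz' hd
          · have hzz : z ≠ z0 := by rintro rfl; exact hnew hz
            rw [Function.update_of_ne hzz] at hz'
            exact ⟨z, hz, hz'⟩
  · simp [scanOne, Stmt.size]; omega
  · rintro s' ⟨-, hs, hZ, hnZ, hf⟩
    simp only [← X.adj u hu] at hZ hnZ hf
    exact ⟨hs, hZ, fun z hz => (hnZ z hz).1, hf⟩

/-- The closed neighborhood of `u`, as a list. -/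
def GraphData.closedNbrs (X : GraphData) (u : ℕ) : List ℕ :=
  u :: (List.range' (X.off u) (X.off (u + 1) - X.off u)).map X.dat

/-- Append the vertex in register 17 and its neighbors to the output. -/
def emit : Stmt :=
  .seq (.store 12 (.reg 14) (.reg 17))
    (.seq (.assign 14 (.op .add (.reg 14) (.lit 1)))
      (.forLoop 8 (.cell 0 (.reg 17)) (.cell 0 (.op .add (.reg 17) (.lit 1)))
        (.seq (.store 12 (.reg 14) (.cell 1 (.reg 8)))
          (.assign 14 (.op .add (.reg 14) (.lit 1))))))

theorem run_emit {s : State} (hX : X.Loaded s) {u : ℕ} (hu : u < X.n) (h17 : s.reg 17 = u)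
    {l : List ℕ} (hl : Stores (s.arr 12) l) (h14 : s.reg 14 = l.length)
    (hlen : (l ++ X.closedNbrs u).length < 2 ^ X.w) :
    Run X.w emit s (6 * (X.off (u + 1) - X.off u) + 7) fun s' =>
      Same [8, 14] [12] s s' ∧ Stores (s'.arr 12) (l ++ X.closedNbrs u) ∧
      s'.reg 14 = (l ++ X.closedNbrs u).length := by
  have hw := X.n_lt
  have h1 : 1 % 2 ^ X.w = 1 := Nat.mod_eq_of_lt (by omega)
  have hle := X.off_mono u hu
  have hlt := X.off_le_off (show u + 1 ≤ X.n by omega) le_rfl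
  have hlt' := X.off_lt
  have hu1 : (u + 1) % 2 ^ X.w = u + 1 := Nat.mod_eq_of_lt (by omega)
  have hlen' : l.length + 1 + (X.off (u + 1) - X.off u) < 2 ^ X.w := by
    simp [GraphData.closedNbrs] at hlen
    omega
  have hl1 : (l.length + 1) % 2 ^ X.w = l.length + 1 := Nat.mod_eq_of_lt (by omega)
  set part := fun j => l ++ u :: (List.range' (X.off u) (j - X.off u)).map X.dat with hpart
  have hpl : ∀ j, (part j).length = l.length + 1 + (j - X.off u) := by
    intro j
    simp [hpart]
    omega
  refine (Run.seq (R := fun s' => s' = s.setCell 12 l.length u) (Run.store ?_)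
    fun s1 hs1 => Run.seq (R := fun s' => s' = s1.setReg 14 (l.length + 1)) (Run.assign ?_)
    fun s2 hs2 => Run.forLoop (w := X.w) (fun j s' => Same [8, 14] [12] s s' ∧
      Stores (s'.arr 12) (part j) ∧ s'.reg 14 = (part j).length)
      (fun _ => 3) hle (by omega) ?_ ?_ ?_ ?_).mono ?_ ?_
  · simp [Expr.eval, h14, h17]
  · rw [hs1]
    simp [Expr.eval, Op.apply, h14, h1, hl1]
  · simp [Expr.eval, hs2, hs1, h17, hX.arr0]
  · rw [hs2, hs1]
    refine ⟨(((Same.refl _ _ _).setCell (by decide) _ _).setReg (by decide) _).setReg (by decide) _,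
      ?_, ?_⟩
    · simpa [hpart] using hl.append_singleton u
    · simp [hpart]
  · rintro j s' ⟨hs, -⟩ -
    simp [Expr.eval, Op.apply, hs.reg 17 (by decide), hs.arr 0 (by decide), h17, hX.arr0, h1, hu1]
  · rintro j hj1 hj2 s' hj' ⟨hs, hst, h14'⟩
    refine Run.straight (p := .seq _ _) (by simp [Stmt.IsStraight]) ?_
    have e1 : s'.arr 1 = X.dat := by rw [hs.arr 1 (by decide)]; exact hX.arr1
    have hp1 : ((part j).length + 1) % 2 ^ X.w = (part j).length + 1 :=
      Nat.mod_eq_of_lt (by rw [hpl]; omega)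
    have hsucc : part (j + 1) = part j ++ [X.dat j] := by
      have h2 : j + 1 - X.off u = (j - X.off u) + 1 := by omega
      have h3 : X.off u + (j - X.off u) = j := by omega
      simp only [hpart, h2, List.range'_concat, List.map_append, Nat.one_mul, h3]
      simp
    simp only [Stmt.exec, Expr.eval, Op.apply, State.reg_setCell, h14', hj', e1, h1, hp1]
    refine ⟨by simpa using hj', ((hs.setCell (by decide) _ _).setReg (by decide) _).setReg
      (by decide) _, ?_, ?_⟩
    · rw [hsucc]
      exact hst.append_singleton _
    · simp [hsucc]
  · simp
    omega
  · rintro s' ⟨-, h⟩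
    exact h

/-- The sets that the program outputs if it has computed the linear order `ord`. -/
noncomputable def GraphData.outputSets (X : GraphData) (ord : List ℕ) : List (List ℕ) :=
  (greedyIntervals X.E ord.reverse).reverse.map fun c => c.reverse.flatMap X.closedNbrs

/-- The program reads the order forwards, whereas `greedyIntervals` cuts from the end; the reversals
cancel. Where the cuts fall has no influence on the data written, only on the offsets. -/
theorem flatten_outputSets (ord : List ℕ) :
    (X.outputSets ord).flatten = ord.flatMap X.closedNbrs := by
  have h : ∀ L : List (List ℕ), (L.map fun c => c.reverse.flatMap X.closedNbrs).flatten =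
      (L.map List.reverse).flatten.flatMap X.closedNbrs := by
    intro L
    induction L with
    | nil => simp
    | cons c L ih =>
      rw [List.map_cons, List.flatten_cons, ih, List.map_cons, List.flatten_cons,
        List.flatMap_append]
  rw [GraphData.outputSets, h, List.map_reverse, ← List.reverse_flatten, flatten_greedyIntervals,
    List.reverse_reverse]

theorem greedyIntervals_cons_of_exists {E : ℕ → ℕ → Prop} {u : ℕ} {l c : List ℕ}
    {r : List (List ℕ)} (h : greedyIntervals E l = c :: r) (hc : ∃ z, ∀ v ∈ u :: c, E v z) :
    greedyIntervals E (u :: l) = (u :: c) :: r := by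
  rw [greedyIntervals, h]
  exact if_pos hc

theorem greedyIntervals_cons_of_forall {E : ℕ → ℕ → Prop} {u : ℕ} {l : List ℕ}
    (h : ∀ c r, greedyIntervals E l = c :: r → ¬ ∃ z, ∀ v ∈ u :: c, E v z) :
    greedyIntervals E (u :: l) = [u] :: greedyIntervals E l := by
  rw [greedyIntervals]
  split
  · next h' => rw [h']
  · next c r h' => rw [if_neg (h c r h'), h']

theorem HoldsOrder.perm {s : State} {ord : List ℕ} (h : HoldsOrder X s ord) :
    ord.Perm (List.range X.n) :=
  (List.perm_ext_iff_of_nodup h.nodup List.nodup_range).2 fun v => by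
    rw [h.mem, List.mem_range]

theorem HoldsOrder.length_eq {s : State} {ord : List ℕ} (h : HoldsOrder X s ord) :
    ord.length = X.n := by
  rw [h.perm.length_eq, List.length_range]

theorem HoldsOrder.length_flatMap {s : State} {ord : List ℕ} (h : HoldsOrder X s ord) :
    (ord.flatMap X.closedNbrs).length = X.n + X.off X.n := by
  rw [(h.perm.flatMap_right X.closedNbrs).length_eq]
  have : ∀ m ≤ X.n, ((List.range m).flatMap X.closedNbrs).length = m + X.off m := by
    intro m hm
    induction m with
    | zero => simp [X.off_zero]
    | succ m ih =>
      have h1 := X.off_mono m hm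
      rw [List.range_succ, List.flatMap_append, List.length_append, ih (by omega)]
      simp [GraphData.closedNbrs]
      omega
  exact this _ le_rfl

/-- Start a new interval unless the current one can be extended. -/
def newInterval : Stmt :=
  .branch (.op .eq (.reg 16) (.lit 0))
    (.seq (.store 11 (.reg 13) (.reg 14))
      (.seq (.assign 13 (.op .add (.reg 13) (.lit 1)))
        (.assign 15 (.op .add (.reg 7) (.lit 1))))) .skip

/-- Process the vertex in register 17. -/
def outputOne : Stmt := .seq scan (.seq newInterval (.seq emit (.assign 17 (.cell 7 (.reg 17)))))

/-- The memory after the first `i` vertices of `ord` have been processed. -/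
structure Emitting (X : GraphData) (ord : List ℕ) (i : ℕ) (s : State) : Prop where
  loaded : X.Loaded s
  chain : ord.IsChain fun a b => s.arr 7 a = b
  current : ∀ h : i < ord.length, s.reg 17 = ord[i]
  run_end : ∀ z, s.arr 10 z ≤ i
  run_start : ∀ z, s.arr 10 z = i → s.arr 9 z ≤ i
  runs : ∀ z, ∀ a < i, (s.arr 10 z = i ∧ s.arr 9 z ≤ a) ↔ ∀ v ∈ (ord.take i).drop a, X.E v z
  start : (i = 0 ∧ s.reg 15 = 0) ∨ ∃ c r, greedyIntervals X.E (ord.take i).reverse = c :: r ∧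
    0 < c.length ∧ s.reg 15 = i - c.length + 1
  count : s.reg 13 = (X.outputSets (ord.take i)).length
  offset : ∀ k < (X.outputSets (ord.take i)).length,
    s.arr 11 k = ((X.outputSets (ord.take i)).take k).flatten.length
  pos : s.reg 14 = (X.outputSets (ord.take i)).flatten.length
  stores : Stores (s.arr 12) (X.outputSets (ord.take i)).flatten

theorem length_outputSets_le (l : List ℕ) : (X.outputSets l).length ≤ l.length := by
  rw [GraphData.outputSets, List.length_map, List.length_reverse, ← List.length_reverse (as := l)]
  generalize l.reverse = l
  induction l with
  | nil => simp [greedyIntervals]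
  | cons u l ih =>
    rw [greedyIntervals]
    split
    · simp
    · next h =>
      rw [h] at ih
      split_ifs <;> simp at ih ⊢ <;> omega

/-- The current interval consists of the last `c.length` vertices read, which translates the greedy
cuts into positions in the order. -/
theorem drop_take_eq_reverse {E : ℕ → ℕ → Prop} {ord c : List ℕ} {i : ℕ} {r : List (List ℕ)}
    (hi : i ≤ ord.length) (h : greedyIntervals E (ord.take i).reverse = c :: r) :
    c.length ≤ i ∧ (ord.take i).drop (i - c.length) = c.reverse := by
  have h1 := flatten_greedyIntervals E (ord.take i).reverse
  rw [h, List.flatten_cons] at h1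
  have h2 : ord.take i = r.flatten.reverse ++ c.reverse := by
    rw [← List.reverse_append, h1, List.reverse_reverse]
  have h3 : i = r.flatten.length + c.length := by
    have := congrArg List.length h2
    simpa [hi] using this
  refine ⟨by omega, ?_⟩
  rw [h2, show i - c.length = r.flatten.reverse.length by rw [List.length_reverse]; omega,
    List.drop_left]

/-- By the invariant `runs`, a vertex `z` is adjacent to everything from position `a` on exactly if
its run is still current and starts no later than `a`. Hence one pass over the neighbors of `u`
decides whether the interval can be extended. -/
theorem run_outputOne {s0 s : State} {ord : List ℕ} (h0 : HoldsOrder X s0 ord) {i : ℕ}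
    (hi : i < X.n) (h7 : s.reg 7 = i) (h : Emitting X ord i s) {u : ℕ} (hu : u = s.reg 17) :
    Run X.w outputOne s (21 * (X.off (u + 1) - X.off u) + 24) fun s' =>
      s'.reg 7 = i ∧ Emitting X ord (i + 1) (s'.setReg 7 (i + 1)) := by
  have hw := X.n_lt
  have h1 : 1 % 2 ^ X.w = 1 := Nat.mod_eq_of_lt (by omega)
  have hlen := h0.length_eq
  have hio : i < ord.length := by omega
  have huo : u = ord[i] := hu.trans (h.current hio)
  have hun : u < X.n := (h0.mem u).1 (huo ▸ List.getElem_mem hio)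
  have htake : ord.take (i + 1) = ord.take i ++ [u] := by rw [huo, List.take_append_getElem]
  have hrev : (ord.take (i + 1)).reverse = u :: (ord.take i).reverse := by
    rw [htake, List.reverse_append]; rfl
  have hi1 : (i + 1) % 2 ^ X.w = i + 1 := Nat.mod_eq_of_lt (by omega)
  set S := X.outputSets (ord.take i) with hS
  have hSlen : S.length ≤ i := (length_outputSets_le _).trans (by simp)
  have hS1 : (S.length + 1) % 2 ^ X.w = S.length + 1 := Nat.mod_eq_of_lt (by omega)
  have hflat : S.flatten ++ X.closedNbrs u = (ord.take (i + 1)).flatMap X.closedNbrs := by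
    rw [hS, flatten_outputSets, htake, List.flatMap_append]
    simp
  have hflatlen : (S.flatten ++ X.closedNbrs u).length < 2 ^ X.w := by
    rw [hflat]
    have h2 := ((List.take_sublist (i + 1) ord).flatMap X.closedNbrs).length_le
    rw [h0.length_flatMap] at h2
    have := X.off_lt
    omega
  have hflat' : (X.outputSets (ord.take (i + 1))).flatten = S.flatten ++ X.closedNbrs u := by
    rw [flatten_outputSets, hflat]
  refine (Run.seq (run_scan h.loaded hun hu.symm h7 hi) fun s1 ⟨hs1, hE1, hE2, hf⟩ =>
    Run.seq (R := fun s' => Same [13, 15] [11] s1 s' ∧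
      s'.reg 13 = (X.outputSets (ord.take (i + 1))).length ∧
      (∀ k < (X.outputSets (ord.take (i + 1))).length, s'.arr 11 k =
        ((X.outputSets (ord.take (i + 1))).take k).flatten.length) ∧
      ∃ c r, greedyIntervals X.E (ord.take (i + 1)).reverse = c :: r ∧
        0 < c.length ∧ s'.reg 15 = i + 1 - c.length + 1)
      (Run.straight (by simp [newInterval, Stmt.IsStraight]) ?_) fun s2 ⟨hs2, hc2, ho2, hst2⟩ =>
    Run.seq (run_emit (s := s2) (u := u) (l := S.flatten) ?_ hun ?_ ?_ ?_ hflatlen)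
      fun s3 ⟨hs3, hst3, hp3⟩ => Run.assign ?_).mono ?_ fun _ h => h
  · have e7 : s1.reg 7 = i := (hs1.reg 7 (by decide)).trans h7
    have e13 : s1.reg 13 = S.length := (hs1.reg 13 (by decide)).trans h.count
    have e14 : s1.reg 14 = S.flatten.length := (hs1.reg 14 (by decide)).trans h.pos
    have hfound : (∃ z, X.E u z ∧ s1.arr 9 z < s.reg 15) ↔
        ∃ c r, greedyIntervals X.E (ord.take i).reverse = c :: r ∧
          ∃ z, ∀ v ∈ u :: c, X.E v z := by
      -- Before the first vertex, register 15 is zero and no run start is smaller, so an interval is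
      -- opened.
      rcases h.start with ⟨hi0, h15⟩ | ⟨c, r, hcr, hc0, h15⟩
      · subst hi0
        simp [h15, greedyIntervals]
      · obtain ⟨hci, hdrop⟩ := drop_take_eq_reverse hio.le hcr
        have hz : ∀ z, X.E u z → (s1.arr 9 z < s.reg 15 ↔ ∀ v ∈ c, X.E v z) := by
          intro z hz
          have h2 := h.runs z (i - c.length) (by omega)
          rw [hdrop] at h2
          simp only [List.mem_reverse] at h2
          rw [← h2, (hE1 z hz).2, h15]
          split_ifs with h3
          · simp only [h3, true_and]
            omega
          · simp only [h3, false_and, iff_false]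
            omega
        constructor
        · rintro ⟨z, hz1, hz2⟩
          exact ⟨c, r, hcr, z, List.forall_mem_cons.2 ⟨hz1, (hz z hz1).1 hz2⟩⟩
        · rintro ⟨c', r', hcr', z, hz'⟩
          obtain ⟨rfl, rfl⟩ := List.cons.inj (hcr.symm.trans hcr')
          rw [List.forall_mem_cons] at hz'
          exact ⟨z, hz'.1, (hz z hz'.1).2 hz'.2⟩
    by_cases hcase : s1.reg 16 = 0
    · have he : newInterval.exec X.w s1 = ((s1.setCell 11 S.length S.flatten.length).setReg 13
          (S.length + 1)).setReg 15 (i + 1) := by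
        simp only [newInterval, Stmt.exec, Expr.eval, Op.apply, State.reg_setReg,
          State.reg_setCell, hcase, e13, e14, e7, if_true, if_false, Nat.reduceEqDiff, h1, hS1, hi1,
          one_ne_zero, Nat.zero_mod]
      have hno := hf.1 hcase
      rw [hfound] at hno
      have hg := greedyIntervals_cons_of_forall (E := X.E) (u := u) (l := (ord.take i).reverse)
        fun c r hcr hz => hno ⟨c, r, hcr, hz⟩
      have hS' : X.outputSets (ord.take (i + 1)) = S ++ [X.closedNbrs u] := by
        rw [GraphData.outputSets, hrev, hg, hS, GraphData.outputSets]
        simp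
      rw [he, hS']
      refine ⟨((((Same.refl _ _ _).setCell (by decide) _ _).setReg (by decide) _).setReg
        (by decide) _), by simp, ?_, [u], greedyIntervals X.E (ord.take i).reverse, ?_, by simp,
        by simp⟩
      · intro k hk
        simp only [List.length_append, List.length_singleton] at hk
        simp only [State.arr_setReg, State.arr_setCell, if_true, Function.update_apply]
        rw [List.take_append_of_le_length (by omega)]
        split_ifs with hkS
        · rw [hkS, List.take_length]
        · rw [hs1.arr 11 (by decide)]
          exact h.offset k (by rw [← hS]; omega)
      · rw [hrev, hg]
    · have he : newInterval.exec X.w s1 = s1 := by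
        simp only [newInterval, Stmt.exec, Expr.eval, Op.apply, hcase, if_true, if_false,
          Nat.zero_mod]
      have hyes := not_not.1 (mt hf.2 hcase)
      rw [hfound] at hyes
      obtain ⟨c, r, hcr, hz⟩ := hyes
      have hg := greedyIntervals_cons_of_exists hcr hz
      have hSr : S = (r.reverse.map fun c => c.reverse.flatMap X.closedNbrs) ++
          [c.reverse.flatMap X.closedNbrs] := by
        rw [hS, GraphData.outputSets, hcr]
        simp
      have hS' : X.outputSets (ord.take (i + 1)) =
          (r.reverse.map fun c => c.reverse.flatMap X.closedNbrs) ++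
          [(u :: c).reverse.flatMap X.closedNbrs] := by
        rw [GraphData.outputSets, hrev, hg]
        simp
      obtain ⟨hci, -⟩ := drop_take_eq_reverse hio.le hcr
      rw [he, hS']
      refine ⟨Same.refl _ _ _, by rw [e13, hSr]; simp, ?_, u :: c, r, by rw [hrev, hg], by simp,
        ?_⟩
      · intro k hk
        rw [List.length_append, List.length_singleton] at hk
        rw [List.take_append_of_le_length (by omega), hs1.arr 11 (by decide), h.offset k
          (by rw [← hS, hSr]; simpa using hk), ← hS, hSr,
          List.take_append_of_le_length (by omega)]
      · rw [hs1.reg 15 (by decide)]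
        rcases h.start with ⟨hi0, -⟩ | ⟨c', r', hcr', hc0, h15⟩
        · subst hi0
          simp [greedyIntervals] at hcr
        · obtain ⟨rfl, rfl⟩ := List.cons.inj (hcr.symm.trans hcr')
          rw [h15, List.length_cons]
          omega
  · exact (h.loaded.of_same hs1).of_same hs2
  · rw [hs2.reg 17 (by decide), hs1.reg 17 (by decide), hu]
  · rw [hs2.arr 12 (by decide), hs1.arr 12 (by decide)]
    exact h.stores
  · rw [hs2.reg 14 (by decide), hs1.reg 14 (by decide)]
    exact h.pos
  · have e17 : s3.reg 17 = u := by
      rw [hs3.reg 17 (by decide), hs2.reg 17 (by decide), hs1.reg 17 (by decide), hu]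
    have ea7 : s3.arr 7 = s.arr 7 := by
      rw [hs3.arr 7 (by decide), hs2.arr 7 (by decide), hs1.arr 7 (by decide)]
    have ea9 : s3.arr 9 = s1.arr 9 := by rw [hs3.arr 9 (by decide), hs2.arr 9 (by decide)]
    have ea10 : s3.arr 10 = s1.arr 10 := by rw [hs3.arr 10 (by decide), hs2.arr 10 (by decide)]
    have hend : ∀ z, ¬ X.E u z → s1.arr 10 z ≤ i := fun z hz => by
      rw [hE2 z hz]; exact h.run_end z
    refine ⟨?_, ?_, ?_, ?_, ?_, ?_, ?_, ?_, ?_, ?_, ?_, ?_⟩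
    · simp [hs3.reg 7 (by decide), hs2.reg 7 (by decide), hs1.reg 7 (by decide), h7]
    · have hl := ((h.loaded.of_same hs1).of_same hs2).of_same hs3
      exact ⟨by simpa using hl.reg0, by simpa using hl.reg1, by simpa using hl.reg2, hl.arr0,
        hl.arr1⟩
    · simpa [ea7] using h.chain
    · intro hi'
      have h2 := List.isChain_iff_getElem.1 h.chain i hi'
      simp only [State.reg_setReg, Nat.reduceEqDiff, if_false, if_true, Expr.eval, e17, ea7]
      rw [huo]
      exact h2
    · intro z
      simp only [State.arr_setReg, ea10]
      by_cases hz : X.E u z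
      · exact (hE1 z hz).1.le
      · exact (hend z hz).trans (Nat.le_succ i)
    · intro z
      simp only [State.arr_setReg, ea10, ea9]
      by_cases hz : X.E u z
      · intro _
        rw [(hE1 z hz).2]
        split_ifs with h3
        · exact (h.run_start z h3).trans (Nat.le_succ i)
        · exact Nat.le_succ i
      · intro h3
        have := hend z hz
        omega
    · intro z a ha
      have hd : (ord.take (i + 1)).drop a = (ord.take i).drop a ++ [u] := by
        rw [htake, List.drop_append_of_le_length (by simp; omega)]
      simp only [State.arr_setReg, ea10, ea9, hd, List.forall_mem_append, List.forall_mem_singleton]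
      by_cases hz : X.E u z
      · rw [(hE1 z hz).1, (hE1 z hz).2]
        simp only [hz, and_true, true_and]
        rcases Nat.lt_succ_iff_lt_or_eq.1 ha with ha | rfl
        · rw [← h.runs z a ha]
          split_ifs with h3
          · simp [h3]
          · simp only [h3, false_and, iff_false]
            omega
        · rw [List.drop_of_length_le (by simp)]
          simp only [List.not_mem_nil, false_implies, implies_true, iff_true]
          split_ifs with h3
          · exact h.run_start z h3
          · exact le_rfl
      · have := hend z hz
        simp only [hz, and_false, iff_false, not_and]
        omega
    · right
      obtain ⟨c, r, hcr, hc0, h15⟩ := hst2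
      exact ⟨c, r, hcr, hc0, by simpa [hs3.reg 15 (by decide)] using h15⟩
    · simpa [hs3.reg 13 (by decide)] using hc2
    · simpa [hs3.arr 11 (by decide)] using ho2
    · rw [hflat']
      simpa using hp3
    · rw [hflat']
      simpa using hst3
  · simp [newInterval, Stmt.size]
    omega

/-- Compute the clusters. -/
def outputLoop : Stmt :=
  .seq (.assign 17 (.cell 2 (.lit 0)))
    (.seq (.assign 13 (.lit 0)) (.seq (.assign 14 (.lit 0)) (.seq (.assign 15 (.lit 0))
      (.forLoop 7 (.lit 0) (.reg 0) outputOne))))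

theorem run_outputLoop {s : State} {ord : List ℕ} (h : HoldsOrder X s ord) :
    Run X.w outputLoop s (27 * X.n + 21 * X.off X.n + 11) fun s' => Emitting X ord X.n s' := by
  have hw := X.n_lt
  have hlen := h.length_eq
  set deg : ℕ → ℕ := fun u => 21 * (X.off (u + 1) - X.off u) + 24 with hdeg
  refine (Run.seq (R := fun s' => s' = s.setReg 17 (s.arr 2 0)) (Run.assign (by simp [Expr.eval]))
    fun s1 hs1 => Run.seq (R := fun s' => s' = s1.setReg 13 0) (Run.assign (by simp [Expr.eval]))
    fun s2 hs2 => Run.seq (R := fun s' => s' = s2.setReg 14 0) (Run.assign (by simp [Expr.eval]))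
    fun s3 hs3 => Run.seq (R := fun s' => s' = s3.setReg 15 0) (Run.assign (by simp [Expr.eval]))
    fun s4 hs4 => Run.forLoop (w := X.w) (fun j s' => Emitting X ord j s')
      (fun i => deg (ord.getD i 0)) (lo := 0) (hi := X.n) (Nat.zero_le _) (by omega) ?_ ?_ ?_
      ?_).mono ?_ fun _ h => h.2
  · simp [Expr.eval]
  · have hs : Same [7, 13, 14, 15, 17] [] s (s4.setReg 7 0) := by
      rw [hs4, hs3, hs2, hs1]
      exact (((((Same.refl _ _ _).setReg (by decide) _).setReg (by decide) _).setReg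
        (by decide) _).setReg (by decide) _).setReg (by decide) _
    refine ⟨h.loaded.of_same hs, ?_, ?_, ?_, ?_, by simp, Or.inl ⟨rfl, by simp [hs4]⟩, ?_, ?_, ?_,
      ?_⟩
    · rw [hs.arr 7 (by decide)]; exact h.chain
    · intro h0
      cases ord with
      | nil => simp at h0
      | cons a l => simp [hs4, hs3, hs2, hs1, h.head a l rfl]
    · rw [hs.arr 10 (by decide)]; exact fun z => (h.run_end z).le
    · rw [hs.arr 9 (by decide)]; exact fun z _ => (h.run_start z).le
    · simp [GraphData.outputSets, greedyIntervals, hs4, hs3, hs2]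
    · simp [GraphData.outputSets, greedyIntervals]
    · simp [GraphData.outputSets, greedyIntervals, hs4, hs3]
    · simp [GraphData.outputSets, greedyIntervals, Stores]
  · rintro j s' hs -
    simp [Expr.eval, hs.loaded.reg0]
  · rintro j - hj s' hj' hs
    refine run_outputOne h hj hj' hs ?_
    have hjo : j < ord.length := by omega
    rw [hs.current hjo, List.getD_eq_getElem _ _ hjo]
  · have h1 : ∀ (F : ℕ → ℕ) (l : List ℕ),
        ∑ i ∈ Finset.Ico 0 l.length, F (l.getD i 0) = (l.map F).sum := by
      intro F l
      rw [← Finset.range_eq_Ico]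
      induction l with
      | nil => simp
      | cons a l ih =>
        rw [List.length_cons, Finset.sum_range_succ', List.map_cons, List.sum_cons, ← ih,
          Nat.add_comm]
        simp
    have h2 := sum_range_offset_le X.off_zero X.off_mono 27 21
    have h3 := h1 (fun u => deg u + 3) ord
    rw [(h.perm.map _).sum_eq, ← h1, List.length_range, hlen] at h3
    have h4 : ∀ i ∈ Finset.Ico 0 X.n, deg ((List.range X.n).getD i 0) + 3 =
        27 + 21 * (X.off (i + 1) - X.off i) := by
      intro i hi
      have hi' : i < X.n := (Finset.mem_Ico.1 hi).2
      rw [List.getD_eq_getElem _ _ (by simpa using hi'), List.getElem_range]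
      simp only [hdeg]
      omega
    rw [Finset.sum_congr rfl h4, h2] at h3
    rw [h3]
    omega

/-- Move the clusters to the arrays for the output. -/
def copyOutput : Stmt :=
  .seq (.store 11 (.reg 13) (.reg 14))
    (.seq (.forLoop 7 (.lit 0) (.op .add (.reg 13) (.lit 1))
        (.store 0 (.reg 7) (.cell 11 (.reg 7))))
      (.seq (.forLoop 7 (.lit 0) (.reg 14) (.store 1 (.reg 7) (.cell 12 (.reg 7))))
        (.assign 0 (.reg 13))))

/-- The adjacency lists are no longer needed, so their arrays can be overwritten. The additional
offset closes the last list. -/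
theorem run_copyOutput {s0 s : State} {ord : List ℕ} (h0 : HoldsOrder X s0 ord)
    (h : Emitting X ord X.n s) :
    Run X.w copyOutput s (8 * X.n + 4 * X.off X.n + 15) fun s' => Holds s' (X.outputSets ord) := by
  have hw := X.n_lt
  have hlt := X.off_lt
  have h1 : 1 % 2 ^ X.w = 1 := Nat.mod_eq_of_lt (by omega)
  have ht : ord.take X.n = ord := by rw [← h0.length_eq, List.take_length]
  have hcount := h.count
  have hoff := h.offset
  have hpos := h.pos
  have hst := h.stores
  rw [ht] at hcount hoff hpos hst
  have hfl : (X.outputSets ord).flatten.length = X.n + X.off X.n := by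
    rw [flatten_outputSets, h0.length_flatMap]
  have hSl : (X.outputSets ord).length ≤ X.n :=
    (length_outputSets_le ord).trans h0.length_eq.le
  set S := X.outputSets ord with hS
  have hS1 : (S.length + 1) % 2 ^ X.w = S.length + 1 := Nat.mod_eq_of_lt (by omega)
  refine (Run.seq (R := fun s' => s' = s.setCell 11 S.length S.flatten.length) (Run.store ?_)
    fun s1 hs1 => Run.seq (R := fun s' => Same [7] [0, 11] s s' ∧
      ∀ k < S.length + 1, s'.arr 0 k = (S.take k).flatten.length)
    ((Run.forLoop (w := X.w) (fun j s' => Same [7] [0, 11] s s' ∧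
      (∀ k ≤ S.length, s'.arr 11 k = (S.take k).flatten.length) ∧
      ∀ k < j, s'.arr 0 k = (S.take k).flatten.length) (fun _ => 1)
      (lo := 0) (hi := S.length + 1) (Nat.zero_le _) (by omega) ?_ ?_ ?_ ?_).weaken ?_)
    fun s2 ⟨hs2, ho2⟩ => Run.seq (R := fun s' => Same [7] [0, 1, 11] s s' ∧
      (∀ k < S.length + 1, s'.arr 0 k = (S.take k).flatten.length) ∧
      ∀ k (h : k < S.flatten.length), s'.arr 1 k = S.flatten[k])
    ((Run.forLoop (w := X.w) (fun j s' => Same [7] [0, 1, 11] s s' ∧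
      (∀ k < S.length + 1, s'.arr 0 k = (S.take k).flatten.length) ∧
      ∀ k (h : k < S.flatten.length), k < j → s'.arr 1 k = S.flatten[k]) (fun _ => 1)
      (lo := 0) (hi := S.flatten.length) (Nat.zero_le _) (by omega) ?_ ?_ ?_ ?_).weaken ?_)
    fun s3 ⟨hs3, ho3, hd3⟩ => Run.assign ?_).mono ?_ fun _ h => h
  · simp [Expr.eval, hcount, hpos]
  · simp [Expr.eval]
  · rw [hs1]
    refine ⟨((Same.refl _ _ _).setCell (by decide) _ _).setReg (by decide) _, ?_, by simp⟩
    intro k hk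
    simp only [State.arr_setReg, State.arr_setCell, if_true, Function.update_apply]
    split_ifs with hkS
    · rw [hkS, List.take_length]
    · exact hoff k (by omega)
  · rintro j s' ⟨hs, -⟩ -
    simp [Expr.eval, Op.apply, hs.reg 13 (by decide), hcount, h1, hS1]
  · rintro j - hj s' hj' ⟨hs, h11, h0'⟩
    refine Run.store ⟨hj', (hs.setCell (by decide) _ _).setReg (by decide) _, ?_, ?_⟩
    · simpa using h11
    · intro k hk
      simp only [Expr.eval, hj', State.arr_setReg, State.arr_setCell, if_true,
        Function.update_apply]
      split_ifs with hkj
      · rw [hkj]; exact h11 j (by omega)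
      · exact h0' k (by omega)
  · rintro s' ⟨-, hs, -, h0'⟩
    exact ⟨hs, h0'⟩
  · simp [Expr.eval]
  · refine ⟨(hs2.mono (by decide) (by decide)).setReg (by decide) _, by simpa using ho2, by simp⟩
  · rintro j s' ⟨hs, -⟩ -
    simp [Expr.eval, hs.reg 14 (by decide), hpos]
  · rintro j - hj s' hj' ⟨hs, h0', h1'⟩
    refine Run.store ⟨hj', (hs.setCell (by decide) _ _).setReg (by decide) _, ?_, ?_⟩
    · simpa using h0'
    · intro k hk hkj
      simp only [Expr.eval, hj', State.arr_setReg, State.arr_setCell, if_true,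
        Function.update_apply]
      split_ifs with hkj'
      · subst hkj'
        rw [hs.arr 12 (by decide)]
        exact hst k hk
      · exact h1' k hk (by omega)
  · rintro s' ⟨-, hs, h0', h1'⟩
    exact ⟨hs, h0', fun k hk => h1' k hk hk⟩
  · simp only [Finset.sum_const, Nat.card_Ico, smul_eq_mul]
    omega
  · refine ⟨?_, fun i hi => ?_, fun j hj => ?_⟩
    · simp [Expr.eval, hs3.reg 13 (by decide), hcount]
    · exact ho3 i (by omega)
    · exact hd3 j hj

end WordRAM

/-! ### Reversal of a circular sequence -/

theorem changes_singleton_comm {α : Type*} (y : α → Prop) (a b : α) :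
    changes y a [b] = changes y b [a] := by
  by_cases h : y a <;> by_cases h' : y b <;> simp [changes, h, h']

theorem changes_append_singleton {α : Type*} (y : α → Prop) (a b : α) (l : List α) :
    changes y a (l ++ [b]) = changes y b (l.reverse ++ [a]) := by
  induction l generalizing a b with
  | nil => exact changes_singleton_comm y a b
  | cons c l ih =>
    have h := changes_append_cons y b c l.reverse [a]
    have h' := changes_append_cons y a c [] (l ++ [b])
    rw [List.reverse_cons, List.append_assoc, List.singleton_append, h, ← ih,
      changes_singleton_comm y c a, Nat.add_comm]
    exact h'

/-- Needed because the greedy cuts are analyzed on the reversed order. -/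
theorem cyclicChanges_reverse {α : Type*} (y : α → Prop) (l : List α) :
    cyclicChanges y l.reverse = cyclicChanges y l := by
  rcases l with _ | ⟨a, l⟩
  · rfl
  rcases List.eq_nil_or_concat' l with rfl | ⟨r, b, rfl⟩
  · rfl
  have h := changes_append_cons y b a r.reverse [b]
  have h' := changes_append_cons y a b r [a]
  rw [← changes_append_singleton y a b r, changes_singleton_comm y a b] at h
  simp only [cyclicChanges, List.reverse_cons, List.reverse_append, List.reverse_nil,
    List.nil_append, List.cons_append, List.append_assoc]
  exact h.trans h'.symm

/-! ### Initialization and the complete algorithm -/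

namespace WordRAM

variable {X : GraphData}

/-- Make each vertex a block. -/
def initBlocks : Stmt :=
  .seq (.assign 3 (.reg 0)) (.seq (.assign 5 (.lit 1))
    (.forLoop 7 (.lit 0) (.reg 0) (.seq (.store 2 (.reg 7) (.reg 7)) (.store 8 (.reg 7) (.reg 7)))))

/-- Register 5 starts at 1, so that the zeros in array 5 count as stale. The pointers in array 7
need no initial values, as a block of one vertex has no links. -/
theorem run_initBlocks {s : State} (hX : X.Loaded s) (h6 : s.reg 6 = 0) (h3 : ∀ v, s.arr 3 v = 0)
    (h5 : ∀ v, s.arr 5 v = 0) (ha6 : ∀ v, s.arr 6 v = 0) (h9 : ∀ v, s.arr 9 v = 0)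
    (h10 : ∀ v, s.arr 10 v = 0) :
    Run X.w initBlocks s (6 * X.n + 7) fun s' =>
      PhaseInv X 0 s' (List.range X.n) fun u => [u] := by
  have hw := X.n_lt
  have h1 : 1 % 2 ^ X.w = 1 := Nat.mod_eq_of_lt (by omega)
  refine (Run.seq (R := fun s' => s' = s.setReg 3 X.n) (Run.assign (by simp [Expr.eval, hX.reg0]))
    fun s1 hs1 => Run.seq (R := fun s' => s' = s1.setReg 5 1) (Run.assign (by simp [Expr.eval, h1]))
    fun s2 hs2 => Run.forLoop (w := X.w) (fun j s' => Same [3, 5, 7] [2, 8] s s' ∧ s'.reg 3 = X.n ∧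
      s'.reg 5 = 1 ∧ ∀ x < j, s'.arr 2 x = x ∧ s'.arr 8 x = x) (fun _ => 3)
      (lo := 0) (hi := X.n) (Nat.zero_le _) (by omega) ?_ ?_ ?_ ?_).mono ?_ ?_
  · simp [Expr.eval]
  · rw [hs2, hs1]
    exact ⟨((((Same.refl _ _ _).setReg (by decide) _).setReg (by decide) _)).setReg (by decide) _,
      by simp⟩
  · rintro j s' ⟨hs, -⟩ -
    simp [Expr.eval, hs.reg 0 (by decide), hX.reg0]
  · rintro j - hj s' hj' ⟨hs, hc3, hc5, hc⟩
    refine (Run.straight (by simp [Stmt.IsStraight]) ?_).mono (B := 3) le_rfl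
      fun _ h => h
    refine ⟨by simpa [Stmt.exec] using hj', ((hs.setCell (by decide) _ _).setCell (by decide)
      _ _).setReg (by decide) _, by simpa [Stmt.exec] using hc3, by simpa [Stmt.exec] using hc5,
      fun x hx => ?_⟩
    simp only [Stmt.exec, Expr.eval, hj', State.arr_setReg, State.arr_setCell, State.reg_setCell,
      if_true, Nat.reduceEqDiff, if_false, Function.update_apply]
    split_ifs with h
    · exact ⟨h.symm, h.symm⟩
    · exact hc x (by omega)
  · simp; omega
  · rintro s' ⟨-, hs, hc3, hc5, hc⟩
    have e6 := hs.reg 6 (by decide)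
    refine ⟨⟨hX.of_same hs, by omega, by omega, ?_, ?_, by omega, ?_, ?_, ?_⟩, ⟨?_, ?_, ?_, ?_, ?_⟩,
      ?_, Nat.zero_le _⟩
    · intro c; rw [hs.arr 5 (by decide), h5, hc5]; omega
    · intro c _; rw [hs.arr 6 (by decide), ha6]
    · intro c; rw [hs.arr 3 (by decide), h3]; omega
    · intro c; rw [hs.arr 9 (by decide), h9]
    · intro c; rw [hs.arr 10 (by decide), h10]
    · simp [hc3]
    · intro i h
      rw [List.length_range] at h
      simp [(hc i h).1]
    · intro u hu
      exact ⟨⟨[], rfl⟩, by simp [(hc u (List.mem_range.1 hu)).2], List.isChain_singleton _⟩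
    · simpa using List.nodup_range
    · simp
    · simp

/-- The whole algorithm. -/
def coverProgram : Stmt :=
  .seq initBlocks (.seq phases (.seq finish (.seq outputLoop copyOutput)))

/-- The phases contribute at most `2 * t * L` changes and fail with probability at most `ε` each.
Joining the last `N` blocks adds at most one change per head, hence `hC`. -/
theorem spec_coverProgram {t ε C : ℝ} {L : ℕ} {s : State} {Q : State → Prop}
    (hs : Run X.w initBlocks s (6 * X.n + 7) fun s' =>
      PhaseInv X 0 s' (List.range X.n) fun u => [u])
    (ht : 0 ≤ t) (hL : X.n < 2 ^ (L + 1)) (hε0 : 0 ≤ ε)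
    (hε : ∀ N d : ℕ, N ≤ X.n → d ≤ N → t < d → 8 ≤ X.rate N →
      (X.n : ℝ) * X.n * (1 - (d : ℝ) / N) ^ X.rate N ≤ ε)
    (hC : ∀ N : ℕ, N ≤ X.n → X.rate N < 8 → 2 * t * L + N ≤ C)
    (hQ : ∀ ord s', ord.Nodup → (∀ v, v ∈ ord ↔ v < X.n) →
      (∀ x < X.n, (cyclicChanges (X.E x) ord : ℝ) ≤ C) → Holds s' (X.outputSets ord) → Q s') :
    Spec X.w ((L + 2) * (70 * X.n + 40 * X.off X.n + 70)) ([coverProgram], s) Q (ε * L) := by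
  have hfin : ∀ i s' V f', PhaseInv X i s' V f' →
      Run X.w (.seq finish (.seq outputLoop copyOutput)) s' (64 * X.n + 37 * X.off X.n + 49)
        fun s'' => Holds s'' (X.outputSets (V.flatMap f')) ∧ (V.flatMap f').Nodup ∧
          ∀ v, v ∈ V.flatMap f' ↔ v < X.n := by
    intro i s' V f' h
    refine (Run.seq (run_finish h) fun s1 h1 => Run.seq (run_outputLoop h1) fun s2 h2 =>
      (run_copyOutput h1 h2).weaken fun s3 h3 => ⟨h3, h.blocks.nodup, h.blocks.mem⟩).mono
      (by omega) fun _ h => h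
  have hend : ∀ i s' V f', i ≤ L → PhaseInv X i s' V f' → X.rate V.length < 8 →
      Spec X.w (64 * X.n + 37 * X.off X.n + 49 + 0)
        ([.seq finish (.seq outputLoop copyOutput)], s') Q 1 ∧ (LowCrossing X t i V f' →
      Spec X.w (64 * X.n + 37 * X.off X.n + 49 + 0)
        ([.seq finish (.seq outputLoop copyOutput)], s') Q 0) := by
    intro i s' V f' hi h hr
    refine ⟨.of_run (hfin i s' V f' h) fun s'' _ => .halted (.inr le_rfl), fun hlow =>
      .of_run (hfin i s' V f' h) fun s'' ⟨hH, hnd, hmem⟩ => .halted (.inl (hQ _ _ hnd hmem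
        (fun x hx => ?_) hH))⟩
    have h1 := cyclicChanges_flatMap_le (X.E x) f' V fun v hv => (h.blocks.block v hv).head
    have h2 := cyclicChanges_le_length (X.E x) V
    have h3 : (cyclicChanges (X.E x) (V.flatMap f') : ℝ) ≤
        (V.map fun u => cyclicChanges (X.E x) (f' u)).sum + V.length := by
      exact_mod_cast h1.trans (by omega)
    have h4 := hlow x hx
    have h5 : 2 * t * i ≤ 2 * t * L := by
      have : (i : ℝ) ≤ L := by exact_mod_cast hi
      gcongr
    linarith [hC V.length h.blocks.length_le hr]
  refine (Spec.seq (Spec.of_run hs fun s1 h1 => Spec.seq ((spec_phases hL hε0 hε hend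
    (Nat.zero_le _) h1).2 ?_))).mono ?_ le_rfl
  · intro x _
    simp [cyclicChanges, changes]
  · simp only [Nat.sub_zero]
    nlinarith [Nat.zero_le (L * X.n), Nat.zero_le (L * X.off X.n)]

end WordRAM

/-! ### Clusters from intervals -/

/-- Two walks of length at most 2 meet at the hub `z`. The middle vertex `v` must lie in `C`,
because the diameter is that of the induced subgraph. The quantifier over `a` only exempts the empty
set, which has no hub. -/
theorem isCompactNeighborhoodCover_of_hub {V : Type*} {G : SimpleGraph V} {𝒦 : Finset (Finset V)}
    (hcov : ∀ v : V, ∃ C ∈ 𝒦, v ∈ C ∧ ∀ u : V, G.Adj v u → u ∈ C)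
    (hhub : ∀ C ∈ 𝒦, ∀ a ∈ C, ∃ z ∈ C, ∀ x ∈ C, ∃ v ∈ C,
      (G.Adj x v ∨ x = v) ∧ (G.Adj v z ∨ v = z)) :
    IsCompactNeighborhoodCover G 𝒦 := by
  refine ⟨hcov, fun C hC => SimpleGraph.ediam_le_of_edist_le fun ⟨x, hx⟩ ⟨y, hy⟩ => ?_⟩
  obtain ⟨z, hz, h⟩ := hhub C hC x hx
  have key : ∀ x (hx : x ∈ C), (G.induce (C : Set V)).edist ⟨x, hx⟩ ⟨z, hz⟩ ≤ 2 := by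
    intro x hx
    obtain ⟨v, hv, h1, h2⟩ := h x hx
    have h1' : (G.induce (C : Set V)).edist ⟨x, hx⟩ ⟨v, hv⟩ ≤ 1 :=
      SimpleGraph.edist_le_one_iff_adj_or_eq.2 (by simpa using h1)
    have h2' : (G.induce (C : Set V)).edist ⟨v, hv⟩ ⟨z, hz⟩ ≤ 1 :=
      SimpleGraph.edist_le_one_iff_adj_or_eq.2 (by simpa using h2)
    calc _ ≤ _ := SimpleGraph.edist_triangle
      _ ≤ 1 + 1 := add_le_add h1' h2'
      _ = 2 := one_add_one_eq_two
  calc _ ≤ _ := SimpleGraph.edist_triangle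
    _ ≤ 2 + 2 := add_le_add (key x hx) (by rw [SimpleGraph.edist_comm]; exact key y hy)
    _ = 4 := by norm_num

namespace WordRAM

variable {X : GraphData}

theorem mem_closedNbrs {u x : ℕ} (hu : u < X.n) : x ∈ X.closedNbrs u ↔ x = u ∨ X.E u x := by
  have := X.off_mono u hu
  rw [X.adj u hu]
  simp only [GraphData.closedNbrs, List.mem_cons, List.mem_map, List.mem_range'_1, and_assoc]
  refine or_congr Iff.rfl (exists_congr fun j => ?_)
  rw [Nat.add_sub_cancel' this]

theorem countP_mem_le_one {l : List (List ℕ)} (h : l.flatten.Nodup) (v : ℕ) :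
    l.countP (fun c => v ∈ c) ≤ 1 := by
  have h1 := List.nodup_iff_count_le_one.1 h v
  rw [List.count_flatten] at h1
  refine le_trans ?_ h1
  clear h h1
  induction l with
  | nil => simp
  | cons c l ih =>
    rw [List.countP_cons, List.map_cons, List.sum_cons, Nat.add_comm]
    refine Nat.add_le_add ?_ ih
    split_ifs with hc
    · exact List.count_pos_iff.2 (by simpa using hc)
    · simp

/-- The hub is a common neighbor of the interval, or its only vertex. The summand 2 consists of one
for the interval that contains `v` itself and one for the excess of intervals met by N(v) over
changes. The bound by `n` serves very small graphs. -/
theorem exists_cover (G : SimpleGraph (Fin X.n)) (hE : ∀ x y : Fin X.n, X.E x y ↔ G.Adj x y)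
    {ord : List ℕ} {s : State} (hnd : ord.Nodup) (hmem : ∀ v, v ∈ ord ↔ v < X.n)
    (hs : Holds s (X.outputSets ord)) :
    ∃ 𝒦 : Finset (Finset (Fin X.n)), OutputsFamily s 𝒦 ∧ IsCompactNeighborhoodCover G 𝒦 ∧
      overlap 𝒦 ≤ X.n ∧
      ∀ v : Fin X.n, (𝒦.filter fun C => v ∈ C).card ≤ cyclicChanges (X.E v) ord + 2 := by
  classical
  set I := greedyIntervals X.E ord.reverse with hI
  have hflat : I.flatten = ord.reverse := flatten_greedyIntervals _ _
  have hmemI : ∀ c ∈ I, ∀ u ∈ c, u < X.n := fun c hc u hu => (hmem u).1 (by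
    rw [← List.mem_reverse, ← hflat]
    exact List.mem_flatten.2 ⟨c, hc, hu⟩)
  have hmemc : ∀ c ∈ I, ∀ x, x ∈ c.reverse.flatMap X.closedNbrs ↔ ∃ u ∈ c, x = u ∨ X.E u x := by
    intro c hc x
    simp only [List.mem_flatMap, List.mem_reverse]
    exact exists_congr fun u => and_congr_right fun hu => mem_closedNbrs (hmemI c hc u hu)
  obtain ⟨M, hM⟩ : ∃ M : List (List (Fin X.n)), M.map (List.map Fin.val) = X.outputSets ord := by
    refine CanLift.prf (coe := List.map (List.map (Fin.val (n := X.n)))) (X.outputSets ord) ?_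
    intro l hl x hx
    obtain ⟨c, hc, rfl⟩ := List.mem_map.1 hl
    rw [List.mem_reverse] at hc
    obtain ⟨u, hu, rfl | hux⟩ := (hmemc c hc x).1 hx
    · exact hmemI c hc _ hu
    · exact X.lt hux
  have hmM : ∀ m ∈ M, ∃ c ∈ I, ∀ x, x ∈ m ↔ ∃ u ∈ c, x = u ∨ X.E u x := by
    intro m hm
    have h1 : m.map Fin.val ∈ X.outputSets ord := hM ▸ List.mem_map_of_mem hm
    obtain ⟨c, hc, h2⟩ := List.mem_map.1 h1
    rw [List.mem_reverse] at hc
    refine ⟨c, hc, fun x => ?_⟩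
    rw [← hmemc c hc, h2]
    simp [Fin.val_inj]
  have hcM : ∀ c ∈ I, ∃ m ∈ M, ∀ x, x ∈ m ↔ ∃ u ∈ c, x = u ∨ X.E u x := by
    intro c hc
    have h1 : c.reverse.flatMap X.closedNbrs ∈ X.outputSets ord :=
      List.mem_map.2 ⟨c, List.mem_reverse.2 hc, rfl⟩
    rw [← hM] at h1
    obtain ⟨m, hm, h2⟩ := List.mem_map.1 h1
    refine ⟨m, hm, fun x => ?_⟩
    rw [← hmemc c hc, ← h2]
    simp [Fin.val_inj]
  have hcount : ∀ v : Fin X.n, (((M.map List.toFinset).toFinset).filter fun C => v ∈ C).card ≤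
      I.countP fun c => ∃ u ∈ c, (v : ℕ) = u ∨ X.E u v := by
    intro v
    have h1 : (((M.map List.toFinset).toFinset).filter fun C => v ∈ C).card ≤
        M.countP fun m => (v : ℕ) ∈ m.map Fin.val := by
      have h2 := List.toFinset_card_le ((M.map List.toFinset).filter fun C => v ∈ C)
      rw [List.toFinset_filter, ← List.countP_eq_length_filter, List.countP_map] at h2
      simpa [Function.comp_def, Fin.val_inj] using h2
    have h2 : M.countP (fun m => (v : ℕ) ∈ m.map Fin.val) =
        (X.outputSets ord).countP fun l => (v : ℕ) ∈ l := by
      rw [← hM, List.countP_map]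
      rfl
    rw [h2, GraphData.outputSets, List.countP_map, List.countP_reverse] at h1
    refine h1.trans (le_of_eq (List.countP_congr fun c hc => ?_))
    simpa using hmemc c hc v
  refine ⟨(M.map List.toFinset).toFinset, ⟨M, by rwa [hM], by simp⟩,
    isCompactNeighborhoodCover_of_hub (fun v => ?_) ?_, ?_, fun v => ?_⟩
  · have hv : (v : ℕ) ∈ I.flatten := by
      rw [hflat, List.mem_reverse, hmem]
      exact v.2
    obtain ⟨c, hc, hvc⟩ := List.mem_flatten.1 hv
    obtain ⟨m, hm, h⟩ := hcM c hc
    refine ⟨m.toFinset, by simpa using ⟨m, hm, rfl⟩, ?_, fun u hu => ?_⟩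
    · rw [List.mem_toFinset, h]
      exact ⟨v, hvc, .inl rfl⟩
    · rw [List.mem_toFinset, h]
      exact ⟨v, hvc, .inr ((hE _ _).2 hu)⟩
  · intro C hC a ha
    obtain ⟨m, hm, rfl⟩ : ∃ m ∈ M, m.toFinset = C := by simpa using hC
    obtain ⟨c, hc, h⟩ := hmM m hm
    simp only [List.mem_toFinset, h] at ha ⊢
    have hx : ∀ x : Fin X.n, ∀ u (hu : u ∈ c), ((x : ℕ) = u ∨ X.E u x) →
        G.Adj x ⟨u, hmemI c hc u hu⟩ ∨ x = ⟨u, hmemI c hc u hu⟩ := by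
      rintro x u hu (h | h)
      · exact .inr (Fin.ext h)
      · exact .inl ((hE x ⟨u, _⟩).1 (X.symm h))
    rcases of_mem_greedyIntervals X.E hc with ⟨u, rfl⟩ | ⟨z, hz⟩
    · have hu : u ∈ [u] := by simp
      refine ⟨⟨u, hmemI _ hc u hu⟩, ⟨u, hu, .inl rfl⟩, fun x ⟨u', hu', hxu⟩ => ?_⟩
      obtain rfl := List.mem_singleton.1 hu'
      exact ⟨⟨u', hmemI _ hc u' hu⟩, ⟨u', hu, .inl rfl⟩, hx x u' hu hxu, .inr rfl⟩
    · obtain ⟨u, hu, -⟩ := ha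
      refine ⟨⟨z, X.lt (hz u hu)⟩, ⟨u, hu, .inr (hz u hu)⟩, fun x ⟨u', hu', hxu⟩ => ?_⟩
      exact ⟨⟨u', hmemI _ hc u' hu'⟩, ⟨u', hu', .inl rfl⟩, hx x u' hu' hxu,
        .inl ((hE ⟨u', _⟩ ⟨z, _⟩).1 (hz u' hu'))⟩
  · refine Finset.sup_le fun v _ => ((Finset.card_filter_le _ _).trans
      (List.toFinset_card_le _)).trans ?_
    have h1 := congrArg List.length hM
    rw [List.length_map] at h1
    rw [List.length_map, h1]
    refine (length_outputSets_le ord).trans ?_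
    have h2 : ord ⊆ List.range X.n := fun v hv => List.mem_range.2 ((hmem v).1 hv)
    simpa using (hnd.subperm h2).length_le
  · refine (hcount v).trans ?_
    have h1 : I.countP (fun c => ∃ u ∈ c, X.E v u) ≤ cyclicChanges (X.E v) ord + 1 := by
      rw [← cyclicChanges_reverse]
      convert countP_greedyIntervals_le X.E (X.E v) ⟨v, fun u => ⟨X.symm, X.symm⟩⟩ ord.reverse
    have h2 := countP_mem_le_one (l := I) (by rw [hflat]; exact List.nodup_reverse.2 hnd) v
    have h3 : I.countP (fun c => ∃ u ∈ c, (v : ℕ) = u ∨ X.E u v) ≤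
        I.countP (fun c => ∃ u ∈ c, X.E v u) + I.countP (fun c => (v : ℕ) ∈ c) := by
      generalize I = l
      induction l with
      | nil => simp
      | cons c l ih =>
        simp only [List.countP_cons]
        have h4 : (∃ u ∈ c, (v : ℕ) = u ∨ X.E u v) → (∃ u ∈ c, X.E v u) ∨ (v : ℕ) ∈ c := by
          rintro ⟨u, hu, rfl | h⟩
          · exact .inr hu
          · exact .inl ⟨u, hu, X.symm h⟩
        by_cases h5 : ∃ u ∈ c, (v : ℕ) = u ∨ X.E u v
        · rcases h4 h5 with h | h <;> simp only [h5, h, decide_true, if_true] <;> omega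
        · simp only [h5, decide_false, Bool.false_eq_true, if_false]
          omega
    omega

end WordRAM

/-! ### From the input format to `GraphData` -/

theorem flatten_take_succ {α : Type*} (L : List (List α)) {i : ℕ} (hi : i < L.length) :
    (L.take (i + 1)).flatten = (L.take i).flatten ++ L[i] := by
  rw [← List.take_append_getElem hi, List.flatten_append, List.flatten_singleton]

theorem getD_flatten {α : Type*} (L : List (List α)) {i k : ℕ} (hi : i < L.length)
    (hk : k < L[i].length) (a : α) :
    L.flatten.getD ((L.take i).flatten.length + k) a = L[i][k] := by
  have h : L.flatten = (L.take i).flatten ++ (L[i] ++ (L.drop (i + 1)).flatten) := by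
    rw [← List.append_assoc, ← flatten_take_succ L hi, ← List.flatten_append,
      List.take_append_drop]
  rw [h, List.getD_append_right _ _ _ _ (by omega), Nat.add_sub_cancel_left,
    List.getD_append _ _ _ _ hk, List.getD_eq_getElem _ _ hk]

namespace WordRAM

variable {n : ℕ} {G : SimpleGraph (Fin n)} {adj : Fin n → List (Fin n)}

theorem graphInput_arr_zero (adj : Fin n → List (Fin n)) (c : ℚ) {i : ℕ} (hi : i ≤ n) :
    (graphInput adj c).arr 0 i =
      ((List.ofFn fun v => (adj v).map Fin.val).take i).flatten.length := by
  simp [graphInput, inputState, hi]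

theorem graphInput_arr_zero_succ (adj : Fin n → List (Fin n)) (c : ℚ) (i : Fin n) :
    (graphInput adj c).arr 0 (i + 1) = (graphInput adj c).arr 0 i + (adj i).length := by
  rw [graphInput_arr_zero adj c (by omega), graphInput_arr_zero adj c (by omega),
    flatten_take_succ _ (by simp), List.length_append]
  simp

theorem graphInput_arr_one (adj : Fin n → List (Fin n)) (c : ℚ) (i : Fin n) {k : ℕ}
    (hk : k < (adj i).length) :
    (graphInput adj c).arr 1 ((graphInput adj c).arr 0 i + k) = (adj i)[k] := by
  rw [graphInput_arr_zero adj c (by omega)]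
  simp only [graphInput, inputState, Nat.one_ne_zero, if_false, if_true]
  rw [getD_flatten _ (by simp) (by simpa using hk)]
  simp

theorem length_eq_degree [DecidableRel G.Adj] (h : IsAdjacencyLists G adj) (v : Fin n) :
    (adj v).length = G.degree v := by
  rw [← List.toFinset_card_of_nodup (h v).1]
  congr 1
  ext u
  simp [(h v).2]

theorem graphInput_arr_zero_last [DecidableRel G.Adj] (h : IsAdjacencyLists G adj) (c : ℚ) :
    (graphInput adj c).arr 0 n = 2 * G.edgeFinset.card := by
  rw [← G.sum_degrees_eq_twice_card_edges, graphInput_arr_zero adj c le_rfl,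
    List.take_of_length_le (by simp), List.length_flatten, List.map_ofFn, List.sum_ofFn]
  exact Finset.sum_congr rfl fun v _ => by simp [length_eq_degree h]

theorem card_le_neighborhoodComplexity [DecidableRel G.Adj] (A B : Finset (Fin n))
    (h : ∀ x ∈ B, ∀ y ∈ B, (∀ r ∈ A, G.Adj x r ↔ G.Adj y r) → x = y) :
    B.card ≤ neighborhoodComplexity G A.card := by
  have h1 : ((neighborhoodSystem G).image fun N => N ∩ A).card ≤
      neighborhoodComplexity G A.card := by
    unfold neighborhoodComplexity shatterFunction
    exact Finset.le_sup (f := fun A => ((neighborhoodSystem G).image fun N => N ∩ A).card) (by simp)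
  refine le_trans (Finset.card_le_card_of_injOn (fun v => G.neighborFinset v ∩ A) ?_ ?_) h1
  · intro v _
    exact Finset.mem_image.2 ⟨_, Finset.mem_image_of_mem _ (Finset.mem_univ v), rfl⟩
  · intro x hx y hy hxy
    refine h x hx y hy fun r hr => ?_
    have := Finset.ext_iff.1 hxy r
    simpa [hr] using this

theorem den_mul_card_le [DecidableRel G.Adj] {c : ℚ} (hc : 0 ≤ c)
    (hG : ∀ k : ℕ, 1 ≤ k → (neighborhoodComplexity G k : ℚ) ≤ c * k) (S T : Finset ℕ)
    (hS0 : S.Nonempty) (hS : ∀ x ∈ S, x < n) (hT : ∀ x ∈ T, x < n)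
    (h : ∀ x ∈ T, ∀ y ∈ T,
      (∀ r ∈ S, (∃ (hx : x < n) (hr : r < n), G.Adj ⟨x, hx⟩ ⟨r, hr⟩) ↔
        ∃ (hy : y < n) (hr : r < n), G.Adj ⟨y, hy⟩ ⟨r, hr⟩) → x = y) :
    c.den * T.card ≤ c.num.natAbs * S.card := by
  have h1 := card_le_neighborhoodComplexity (G := G) (S.attachFin hS) (T.attachFin hT) ?_
  · rw [Finset.card_attachFin, Finset.card_attachFin] at h1
    have h2 : (T.card : ℚ) ≤ c * S.card :=
      le_trans (by exact_mod_cast h1) (hG _ hS0.card_pos)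
    have h3 : (c.den : ℚ) * c = c.num.natAbs := by
      rw [mul_comm, Rat.mul_den_eq_num, Nat.cast_natAbs, abs_of_nonneg (Rat.num_nonneg.2 hc)]
    have h4 : (c.den : ℚ) * T.card ≤ c.num.natAbs * S.card := by
      rw [← h3, mul_assoc]
      gcongr
    exact_mod_cast h4
  · intro x hx y hy hxy
    rw [Finset.mem_attachFin] at hx hy
    refine Fin.ext (h x hx y hy fun r hr => ?_)
    have := hxy ⟨r, hS r hr⟩ (by simpa using hr)
    simpa [hS r hr] using this

/-- The memory for the input of the algorithm. -/
def GraphData.ofGraph [DecidableRel G.Adj] {c : ℚ} {w : ℕ} (hc : 1 ≤ c)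
    (hG : ∀ k : ℕ, 1 ≤ k → (neighborhoodComplexity G k : ℚ) ≤ c * k)
    (h : IsAdjacencyLists G adj) (hw : (n + c.num.natAbs + c.den + 2) ^ 4 ≤ 2 ^ w) :
    GraphData where
  n := n
  p := c.num.natAbs
  q := c.den
  w := w
  off := (graphInput adj c).arr 0
  dat := (graphInput adj c).arr 1
  E x y := ∃ (hx : x < n) (hy : y < n), G.Adj ⟨x, hx⟩ ⟨y, hy⟩
  p_pos := Int.natAbs_pos.2 (Rat.num_ne_zero.2 (by linarith))
  q_pos := c.den_pos
  q_le_p := by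
    have h1 : (c.den : ℚ) * c = c.num.natAbs := by
      rw [mul_comm, Rat.mul_den_eq_num, Nat.cast_natAbs,
        abs_of_nonneg (Rat.num_nonneg.2 (by linarith))]
    have h2 : (c.den : ℚ) * 1 ≤ c.num.natAbs := by
      rw [← h1]
      gcongr
    rw [mul_one] at h2
    exact_mod_cast h2
  word := hw
  off_zero := by simp [graphInput_arr_zero adj c]
  off_mono i hi := by
    have := graphInput_arr_zero_succ adj c ⟨i, hi⟩
    simp only at this
    omega
  off_le := by
    rw [graphInput_arr_zero_last h, ← G.sum_degrees_eq_twice_card_edges]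
    refine (Finset.sum_le_card_nsmul _ _ n fun v _ => ?_).trans (by simp)
    simpa using (G.degree_lt_card_verts v).le
  adj i hi z := by
    have h1 := graphInput_arr_zero_succ adj c ⟨i, hi⟩
    simp only at h1
    constructor
    · rintro ⟨_, hz, hiz⟩
      obtain ⟨k, hk, hkz⟩ := List.mem_iff_getElem.1 (((h ⟨i, hi⟩).2 ⟨z, hz⟩).2 hiz)
      have h2 := graphInput_arr_one adj c ⟨i, hi⟩ hk
      rw [hkz] at h2
      exact ⟨_, Nat.le_add_right _ k, by omega, h2⟩
    · rintro ⟨j, hj, hj', rfl⟩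
      obtain ⟨k, rfl⟩ := Nat.exists_eq_add_of_le hj
      have hk : k < (adj ⟨i, hi⟩).length := by omega
      rw [show (graphInput adj c).arr 1 ((graphInput adj c).arr 0 i + k) = _ from
        graphInput_arr_one adj c ⟨i, hi⟩ hk]
      exact ⟨hi, Fin.is_lt _, ((h ⟨i, hi⟩).2 _).1 (List.getElem_mem hk)⟩
  inj i hi j j' hj1 hj2 hj1' hj2' he := by
    have h1 := graphInput_arr_zero_succ adj c ⟨i, hi⟩
    simp only at h1
    obtain ⟨k, rfl⟩ := Nat.exists_eq_add_of_le hj1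
    obtain ⟨k', rfl⟩ := Nat.exists_eq_add_of_le hj1'
    have hk : k < (adj ⟨i, hi⟩).length := by omega
    have hk' : k' < (adj ⟨i, hi⟩).length := by omega
    rw [show (graphInput adj c).arr 1 ((graphInput adj c).arr 0 i + k) = _ from
      graphInput_arr_one adj c ⟨i, hi⟩ hk, show (graphInput adj c).arr 1
        ((graphInput adj c).arr 0 i + k') = _ from graphInput_arr_one adj c ⟨i, hi⟩ hk'] at he
    rw [((h ⟨i, hi⟩).1.getElem_inj_iff).1 (Fin.ext he)]
  lt := fun ⟨_, hy, _⟩ => hy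
  symm := fun ⟨hx, hy, h⟩ => ⟨hy, hx, h.symm⟩
  traces := den_mul_card_le (by linarith) hG

/-! ### The choice of the constants -/

namespace GraphData

variable {X : GraphData}

theorem lt_of_rate_lt {c : ℝ} (hc : (X.q : ℝ) * c = X.p) {N k : ℕ} (h : X.rate N < k) :
    (N : ℝ) < 2 * c ^ 2 * k := by
  have hp := X.p_pos
  have hq := X.q_pos
  rw [rate, Nat.div_lt_iff_lt_mul (by positivity)] at h
  have h1 : (N : ℝ) * X.q * X.q < k * (2 * X.p * X.p) := by exact_mod_cast h
  have h2 : (0 : ℝ) < X.q * X.q := by positivity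
  rw [← hc] at h1
  refine lt_of_mul_lt_mul_right (a := (X.q : ℝ) * X.q) ?_ h2.le
  linarith

/-- Let k be the sampling rate. As k ≥ 8, N < 2c²(k + 1) ≤ (9/4)c²k. So d > (27/4)c² ln n implies
dk/N ≥ 3 ln n, and (1 - d/N)^k ≤ exp(-dk/N) ≤ n⁻³ beats the n² pairs by a factor n. -/
theorem mul_pow_rate_le {c : ℝ} (hc : (X.q : ℝ) * c = X.p) {N d : ℕ} (hd : d ≤ N)
    (ht : 27 / 4 * c ^ 2 * Real.log X.n < d) (hr : 8 ≤ X.rate N) :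
    (X.n : ℝ) * X.n * (1 - (d : ℝ) / N) ^ X.rate N ≤ (X.n : ℝ)⁻¹ := by
  rcases Nat.eq_zero_or_pos X.n with h0 | h0
  · simp [h0]
  have hn : (0 : ℝ) < X.n := by exact_mod_cast h0
  have hN0 : 0 < N := lt_of_lt_of_le (by omega) (X.rate_le N)
  have hN : (0 : ℝ) < N := by exact_mod_cast hN0
  have hdN : (d : ℝ) / N ≤ 1 := (div_le_one hN).2 (by exact_mod_cast hd)
  have h1 := lt_of_rate_lt hc (Nat.lt_succ_self (X.rate N))
  have h8 : (8 : ℝ) ≤ X.rate N := by exact_mod_cast hr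
  have hlog : 0 ≤ Real.log X.n := Real.log_natCast_nonneg _
  have h2 : (N : ℝ) ≤ 9 / 4 * c ^ 2 * X.rate N := by
    push_cast at h1
    nlinarith [sq_nonneg c]
  have h3 : 3 * Real.log X.n ≤ (d : ℝ) / N * X.rate N := by
    rw [div_mul_eq_mul_div, le_div_iff₀ hN]
    calc 3 * Real.log X.n * N ≤ 3 * Real.log X.n * (9 / 4 * c ^ 2 * X.rate N) := by gcongr
      _ = 27 / 4 * c ^ 2 * Real.log X.n * X.rate N := by ring
      _ ≤ d * X.rate N := by gcongr
  have h4 : (1 - (d : ℝ) / N) ^ X.rate N ≤ ((X.n : ℝ) ^ 3)⁻¹ := by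
    calc (1 - (d : ℝ) / N) ^ X.rate N ≤ Real.exp (-((d : ℝ) / N)) ^ X.rate N :=
          pow_le_pow_left₀ (by linarith) (Real.one_sub_le_exp_neg _) _
      _ = Real.exp (-((d : ℝ) / N * X.rate N)) := by rw [← Real.exp_nat_mul]; ring_nf
      _ ≤ Real.exp (-(3 * Real.log X.n)) := Real.exp_le_exp.2 (by linarith)
      _ = ((X.n : ℝ) ^ 3)⁻¹ := by
        rw [Real.exp_neg, show (3 : ℝ) * Real.log X.n = ((3 : ℕ) : ℝ) * Real.log X.n by norm_num,
          Real.exp_nat_mul, Real.exp_log hn]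
  calc (X.n : ℝ) * X.n * (1 - (d : ℝ) / N) ^ X.rate N ≤ X.n * X.n * ((X.n : ℝ) ^ 3)⁻¹ := by gcongr
    _ = (X.n : ℝ)⁻¹ := by field_simp

end GraphData

variable {X : GraphData}

/-- The memory holds a compact neighborhood cover with overlap at most `B`. -/
def OutputsCover {n : ℕ} (G : SimpleGraph (Fin n)) (B : ℝ) (s : State) : Prop :=
  ∃ 𝒦 : Finset (Finset (Fin n)), OutputsFamily s 𝒦 ∧ IsCompactNeighborhoodCover G 𝒦 ∧
    (overlap 𝒦 : ℝ) ≤ B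

/-- For n ≥ 2 the logarithm is at least 1 and the right side at least 13; for 14 and 15 the
logarithm is at least 3. -/
theorem natCast_le_one_add_log_sq {n : ℕ} (hn : n < 16) {c : ℝ} (hc : 1 ≤ c) :
    (n : ℝ) ≤ 1 + 12 * c ^ 2 * Real.logb 2 n ^ 2 := by
  have hc2 : 1 ≤ c ^ 2 := by nlinarith
  rcases Nat.lt_or_ge n 2 with h | h
  · have : (n : ℝ) ≤ 1 := by exact_mod_cast Nat.lt_succ_iff.1 h
    have : 0 ≤ 12 * c ^ 2 * Real.logb 2 n ^ 2 := by positivity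
    linarith
  have hlog : ∀ k : ℕ, 2 ^ k ≤ n → (k : ℝ) ^ 2 ≤ c ^ 2 * Real.logb 2 n ^ 2 := by
    intro k hk
    have h1 : (k : ℝ) ≤ Real.logb 2 n := by
      rw [Real.le_logb_iff_rpow_le (by norm_num) (by exact_mod_cast (by omega : 0 < n)),
        Real.rpow_natCast]
      exact_mod_cast hk
    calc (k : ℝ) ^ 2 = 1 * (k : ℝ) ^ 2 := (one_mul _).symm
      _ ≤ c ^ 2 * Real.logb 2 n ^ 2 := by gcongr
  rcases Nat.lt_or_ge n 14 with h' | h'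
  · have := hlog 1 (by omega)
    have : (n : ℝ) ≤ 13 := by exact_mod_cast Nat.lt_succ_iff.1 h'
    push_cast at *
    linarith
  · have := hlog 3 (by omega)
    have : (n : ℝ) ≤ 15 := by exact_mod_cast Nat.lt_succ_iff.1 hn
    push_cast at *
    linarith

/-- Below 16 vertices the overlap is at most n anyway, so `t = n`, which no discrepancy exceeds,
allows `ε = 0`. Otherwise the overlap is at most (27/2)c² ln n · L + 16c² + 2. Since ln 2 < 0.6932,
the first term is at most 9.36 c² log² n, and log² n ≥ 16 lets the rest fit into the remaining part
of 12 c² log² n. -/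
theorem spec_coverProgram_outputsCover (G : SimpleGraph (Fin X.n))
    (hE : ∀ x y : Fin X.n, X.E x y ↔ G.Adj x y) {c : ℝ} (hc : (X.q : ℝ) * c = X.p) (hc1 : 1 ≤ c)
    {s : State} (hs : Run X.w initBlocks s (6 * X.n + 7) fun s' =>
      PhaseInv X 0 s' (List.range X.n) fun u => [u]) :
    Spec X.w ((Nat.log 2 X.n + 2) * (70 * X.n + 40 * X.off X.n + 70)) ([coverProgram], s)
      (OutputsCover G (1 + 12 * c ^ 2 * Real.logb 2 X.n ^ 2)) (1 / 3) := by
  have hL : X.n < 2 ^ (Nat.log 2 X.n + 1) := Nat.lt_pow_succ_log_self (by norm_num) _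
  rcases Nat.lt_or_ge X.n 16 with hn | hn
  · refine (spec_coverProgram hs (t := X.n) (ε := 0) (C := 2 * X.n * Nat.log 2 X.n + X.n)
      (Nat.cast_nonneg _) hL le_rfl ?_ ?_ ?_).mono le_rfl (by norm_num)
    · intro N d hN hd ht
      have : X.n < d := by exact_mod_cast ht
      omega
    · intro N hN _
      gcongr
    · intro ord s' hnd hmem _ hH
      obtain ⟨𝒦, h1, h2, h3, -⟩ := exists_cover G hE hnd hmem hH
      exact ⟨𝒦, h1, h2, le_trans (by exact_mod_cast h3) (natCast_le_one_add_log_sq hn hc1)⟩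
  · set L := Nat.log 2 X.n with hLdef
    have hn0 : (0 : ℝ) < X.n := by exact_mod_cast (by omega : 0 < X.n)
    have hL4 : 4 ≤ L := Nat.le_log_of_pow_le (by norm_num) hn
    have hLn : 2 ^ L ≤ X.n := Nat.pow_log_le_self 2 (by omega)
    have hLlog : (L : ℝ) ≤ Real.logb 2 X.n := Real.natLog_le_logb _ _
    have h4L : (4 : ℝ) ≤ L := by exact_mod_cast hL4
    have hln : Real.log X.n = Real.logb 2 X.n * Real.log 2 := by
      rw [Real.logb, div_mul_cancel₀ _ (Real.log_pos (by norm_num)).ne']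
    have hln0 : 0 ≤ Real.log X.n := Real.log_natCast_nonneg _
    have hc2 : 1 ≤ c ^ 2 := by nlinarith
    refine (spec_coverProgram hs (t := 27 / 4 * c ^ 2 * Real.log X.n) (ε := (X.n : ℝ)⁻¹)
      (C := 2 * (27 / 4 * c ^ 2 * Real.log X.n) * L + 16 * c ^ 2) (by positivity) hL
      (by positivity) ?_ ?_ ?_).mono le_rfl ?_
    · exact fun N d _ hd ht hr => GraphData.mul_pow_rate_le hc hd ht hr
    · intro N _ hr
      have := GraphData.lt_of_rate_lt hc hr
      push_cast at this
      linarith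
    · intro ord s' hnd hmem hcyc hH
      obtain ⟨𝒦, h1, h2, -, h3⟩ := exists_cover G hE hnd hmem hH
      refine ⟨𝒦, h1, h2, ?_⟩
      have h4 : (overlap 𝒦 : ℝ) ≤ 2 * (27 / 4 * c ^ 2 * Real.log X.n) * L + 16 * c ^ 2 + 2 := by
        have : Nonempty (Fin X.n) := ⟨⟨0, by omega⟩⟩
        obtain ⟨v, -, hv⟩ := Finset.exists_mem_eq_sup Finset.univ Finset.univ_nonempty
          fun v : Fin X.n => (𝒦.filter fun C => v ∈ C).card
        rw [overlap, hv]
        have h5 := h3 v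
        have h6 := hcyc v v.2
        have h7 : (((𝒦.filter fun C => v ∈ C).card : ℕ) : ℝ) ≤
            cyclicChanges (X.E v) ord + 2 := by exact_mod_cast h5
        linarith
      refine h4.trans ?_
      set l := Real.logb 2 X.n with hl
      have h5 : l * Real.log 2 * L ≤ 0.6932 * l ^ 2 := by
        have := Real.log_two_lt_d9
        have h6 : Real.log 2 ≤ 0.6932 := by linarith
        have h7 : 0 ≤ l := by linarith
        calc l * Real.log 2 * L ≤ l * 0.6932 * l := by gcongr
          _ = 0.6932 * l ^ 2 := by ring
      have h6 : 16 ≤ l ^ 2 := by nlinarith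
      rw [hln]
      calc 2 * (27 / 4 * c ^ 2 * (l * Real.log 2)) * L + 16 * c ^ 2 + 2
          = c ^ 2 * (27 / 2 * (l * Real.log 2 * L) + 16) + 2 := by ring
        _ ≤ c ^ 2 * (27 / 2 * (0.6932 * l ^ 2) + 16) + 2 := by gcongr
        _ ≤ 1 + c ^ 2 * (12 * l ^ 2) := by nlinarith
        _ = 1 + 12 * c ^ 2 * l ^ 2 := by ring
    -- The `L` phases fail with probability at most L/n in total, and 3L ≤ 2^L ≤ n because L ≥ 4.
    · have h3L : ∀ k, 4 ≤ k → 3 * k ≤ 2 ^ k := by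
        intro k hk
        induction k, hk using Nat.le_induction with
        | base => norm_num
        | succ k hk ih => rw [pow_succ]; omega
      have h1 : (3 : ℝ) * L ≤ X.n := by exact_mod_cast (h3L L hL4).trans hLn
      rw [inv_mul_eq_div, div_le_div_iff₀ hn0 (by norm_num)]
      linarith

/-- For n ≥ 2 the logarithm is at least 1, so the factors are at most 3 log n and 105(n + m). For n
≤ 1 the logarithm vanishes and there are no edges; the additive 1 pays. -/
theorem mul_log_add_two_le (n m : ℕ) (hm : 2 * m ≤ n * n) :
    (((Nat.log 2 n + 2) * (70 * n + 40 * (2 * m) + 70) : ℕ) : ℝ) ≤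
      (1000 : ℕ) * (((n : ℝ) + m) * Real.logb 2 n + 1) := by
  rcases Nat.lt_or_ge n 2 with h | h
  · have hm0 : m = 0 := by
      have : n * n ≤ 1 * 1 := Nat.mul_le_mul (by omega) (by omega)
      omega
    subst hm0
    interval_cases n <;> norm_num
  · have hLlog : (Nat.log 2 n : ℝ) ≤ Real.logb 2 n := Real.natLog_le_logb _ _
    have h1 : (1 : ℝ) ≤ Nat.log 2 n := by
      exact_mod_cast Nat.le_log_of_pow_le (by norm_num) (by simpa using h)
    have h2 : (2 : ℝ) ≤ n := by exact_mod_cast h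
    have h3 : (0 : ℝ) ≤ m := Nat.cast_nonneg _
    push_cast
    calc ((Nat.log 2 n : ℝ) + 2) * (70 * n + 40 * (2 * m) + 70)
        ≤ (3 * Real.logb 2 n) * (105 * (n + m)) := by
          gcongr <;> linarith
      _ ≤ 1000 * (((n : ℝ) + m) * Real.logb 2 n + 1) := by
          have : 0 ≤ ((n : ℝ) + m) * Real.logb 2 n := by
            have : (0 : ℝ) ≤ Real.logb 2 n := by linarith
            positivity
          nlinarith

end WordRAM

/-! ### The main theorem -/

theorem theorem5 :
    ∃ (P : WordRAM.Stmt) (K d : ℕ),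
      ∀ (n : ℕ) (G : SimpleGraph (Fin n)) [DecidableRel G.Adj] (c : ℚ)
        (adj : Fin n → List (Fin n)) (w : ℕ),
        1 ≤ c →
        (∀ k : ℕ, 1 ≤ k → (neighborhoodComplexity G k : ℚ) ≤ c * k) →
        IsAdjacencyLists G adj →
        (n + c.num.natAbs + c.den + 2) ^ d ≤ 2 ^ w →
        ∃ T : ℕ,
          (T : ℝ) ≤ K * (((n : ℝ) + G.edgeFinset.card) * Real.logb 2 n + 1) ∧
          (∀ cfg ∈ (WordRAM.steps w T ([P], graphInput adj c)).support, cfg.1 = []) ∧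
          2 / 3 ≤ (WordRAM.steps w T ([P], graphInput adj c)).toOuterMeasure
            {cfg | ∃ 𝒦 : Finset (Finset (Fin n)),
              WordRAM.OutputsFamily cfg.2 𝒦 ∧
              IsCompactNeighborhoodCover G 𝒦 ∧
              (overlap 𝒦 : ℝ) ≤ 1 + 12 * (c : ℝ) ^ 2 * Real.logb 2 n ^ 2} := by
  refine ⟨WordRAM.coverProgram, 1000, 4, fun n G _ c adj w hc hG hadj hw => ?_⟩
  let X := WordRAM.GraphData.ofGraph hc hG hadj hw
  have hoff : X.off X.n = 2 * G.edgeFinset.card := WordRAM.graphInput_arr_zero_last hadj c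
  have hqc : (X.q : ℝ) * (c : ℝ) = X.p := by
    have : (c.den : ℚ) * c = c.num.natAbs := by
      rw [mul_comm, Rat.mul_den_eq_num, Nat.cast_natAbs,
        abs_of_nonneg (Rat.num_nonneg.2 (by linarith))]
    exact_mod_cast congrArg (fun x : ℚ => (x : ℝ)) this
  have hX : X.Loaded (graphInput adj c) :=
    ⟨by simp [graphInput, WordRAM.inputState, X, WordRAM.GraphData.ofGraph], rfl, rfl, rfl, rfl⟩
  have key := WordRAM.spec_coverProgram_outputsCover (X := X) (s := graphInput adj c) G
    (fun x y => ⟨fun ⟨_, _, h⟩ => h, fun h => ⟨x.2, y.2, h⟩⟩) hqc (by exact_mod_cast hc)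
    (WordRAM.run_initBlocks hX rfl (fun _ => rfl) (fun _ => rfl) (fun _ => rfl) (fun _ => rfl)
      fun _ => rfl)
  refine ⟨_, ?_, key.halts, le_trans ?_ key.le_prob⟩
  · rw [hoff]
    exact WordRAM.mul_log_add_two_le n _ (hoff ▸ X.off_le)
  · rw [← ENNReal.ofReal_one, ← ENNReal.ofReal_sub _ (by norm_num),
      show (2 / 3 : ENNReal) = ENNReal.ofReal (2 / 3) by
        rw [ENNReal.ofReal_div_of_pos (by norm_num)]
        simp]
    exact ENNReal.ofReal_le_ofReal (by norm_num)
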